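/- Setting. Let $V=\mathbb C^n$ with the symmetric bilinear form $(v,w)=\sum_i v_iw_i$ (used to identify $V^*=V$), $\Lambda=\mathbb C[x_1,\dots,x_n]$, $L=\operatorname{Frac}\Lambda$. Let $\Phi\subset V^*$ be a finite root system (finitely many $\alpha$ with $(\alpha,\alpha)\ne0$, $\Phi\cap\mathbb C\alpha=\{\pm\alpha\}$, stable under its orthogonal reflections $s_\alpha$) with base $\Sigma$ (linearly independent; every root is a real combination of $\Sigma$ with all coefficients $\ge0$ or all $\le0$), and suppose that the reflection group $G=\langle s_\alpha:\alpha\in\Phi\rangle$ is finite. Let $\Gamma=\Lambda^G$, $\Omega\subset\Sigma$, $\Psi$ the root system generated by $\Omega$, $W=W(\Psi)$ with length $\ell$ relative to $\Omega$. A vector $u$ is $\Omega$-standard if the set $\{\alpha\in\Psi:\alpha(u)=0\}$ is generated by a subset of $\Omega$; $\Phi_0(u)=\{\alpha\in\Phi:\alpha(u)=0\}$. For $\sigma\in W$ let $\mathfrak S_\sigma=\frac1{|W|}\partial_{\sigma^{-1}\omega_0}\prod_{\alpha\in\Psi^+}\alpha$ be the Schubert polynomial ($\partial$ the divided differences built from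 $\nabla_{s_\alpha}=\frac1\alpha(1-s_\alpha)$, $\omega_0$ the longest element of $W$), let $I_W\subset\Lambda$ be the ideal generated by the $W$-invariants of positive degree, let $\Theta(P)=P(\partial/\partial x_1,\dots,\partial/\partial x_n)$, and let $P_\sigma$ be the unique polynomial with $\Theta(f)(P_\sigma)(0)=0$ for all $f\in I_W$ and $\Theta(P_\sigma)(\mathfrak S_\tau)(0)=\delta_{\sigma,\tau}$ for all $\tau\in W$. For $u\in V$ put $D_\sigma^u(F)=\Theta(P_\sigma)(F)(u)$ for $F\in L$ regular at $u$, let $\overline D{}_\sigma^u\in\Gamma^*=\operatorname{Hom}_{\mathbb C}(\Gamma,\mathbb C)$ be its restriction to $\Gamma$, and let $\mathcal D(\Omega,u)\subset\Gamma^*$ be the span of the $\overline D{}_\sigma^u$, $\sigma\in W$. The generalized Littlewood–Richardson coefficients are given by $\mathfrak S_\sigma\mathfrak S_\tau\equiv\sum_\rho c^\rho_{\sigma,\tau}\mathfrak S_\rho \pmod{I_W}$, and $D^u_{\tau,\sigma}=\sum_{\rho\in W} c^\sigma_{\tau,\rho}D^u_\rho$. Let $V$ act on $L$ by $(t_zf)(x)=f(x+z)$,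 let $L\#V$ be the smash product, and let $(l\,t_z)^\dagger=t_{-z}\,l$. A co-rational Galois order is a subalgebra $U\subset(L\#V)^G$ generated by $\Gamma$ and a finite set of elements $X\in(L\#V)^G$ for each of which there is a character $\chi$ of $G$ with $Xd_\chi\in\Lambda\#V$, where $d_\chi=\prod\{\alpha\in\Phi^+:\chi(s_\alpha)=-1\}$. Let $\mathcal Z\subset V$ be the additive monoid generated by the supports $\operatorname{supp}X^\dagger=\{z: t_z \text{ occurs in } X^\dagger\}$, $X\in U$. Theorem. Let $U$ be a co-rational Galois order and let $v\in V$ be $\Omega$-standard with $\Phi_0(v+z)\subset\Psi$ for all $z\in\mathcal Z$. Then $X^\dagger(\Gamma)\subset\Gamma$ for all $X\in U$, so that $\Gamma^*$ is a left $U$-module by $X\cdot\varphi=\varphi\circ X^\dagger$, and $$V(\Omega,T(v))=\sum_{z\in\mathcal Z}\mathcal D(\Omega,v+z)$$ is a $U$-submodule of $\Gamma^*$ and a Gelfand–Tsetlin module, in the sense that it is the direct sum, over the maximal ideals $\mathfrak m$ of $\Gamma$, of its subspaces $V(\Omega,T(v))[\mathfrak m]$ of the elements annihilated by a power of $\mathfrak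 m$. The action is given as follows. Let $X\in U$ be such that $Xd_\chi\in\Lambda\#V$ for some $\chi$ (for instance an element of $\Gamma$ or one of the given generators), and let $v'$ be an $\Omega$-standard element of $W(v+z')$, where $z'\in\mathcal Z$. Put $\widetilde\Omega=\{\alpha\in\Omega:\alpha(v')=0\}$, let $\widetilde\Psi$ be the root system that $\widetilde\Omega$ generates, and $\widetilde W=W(\widetilde\Psi)=W_{v'}$; let $Y$ be a set of $\widetilde\Omega$-standard representatives of $(\operatorname{supp}X^\dagger)/\widetilde W$, and for $y\in Y$ let $\omega^y$ be the longest one of the minimal length representatives of $\widetilde W/\widetilde W_y$, and $F_y=h_y\prod\{\alpha\in\widetilde\Psi^+:\alpha(y)\neq0\}$, where $h_y$ is the coefficient of $t_y$ in $X^\dagger$. Then every $F_y$ is regular at $v'$, and for every $\sigma\in W$ $$X\cdot\overline D{}_\sigma^{v'}=\sum_{\substack{y\in Y\\ \ell(\sigma\omega^y)=\ell(\sigma)+\ell(\omega^y)}}\ \sum_{\nu\in W}D^{v'}_{\nu,\sigma\omega^y}(F_y)\;\overline D{}_\nu^{v'+y}.$$ -/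

import Mathlib

open MvPolynomial

noncomputable section

namespace GaloisBGG

/-! ### The complex vector space, polynomials and rational functions

We work in orthonormal coordinates: `V = ℂⁿ`, with the symmetric bilinear form `∑ i, v i * w i`
(`v ⬝ᵥ w`), which identifies `V` with its dual.  A vector `α` stands for the linear form
`v ↦ α ⬝ᵥ v`. -/

/-- The space `V`. -/
abbrev Vec (n : ℕ) := Fin n → ℂ

/-- `Λ = S(V)`, the algebra of polynomial functions on `V`. -/
abbrev Poly (n : ℕ) := MvPolynomial (Fin n) ℂ

/-- `L = Frac Λ`. -/
abbrev RatFn (n : ℕ) := FractionRing (Poly n)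

variable {n : ℕ}

/-- The linear form attached to a vector, as an element of `Λ`. -/
def linForm (α : Vec n) : Poly n := ∑ i, C (α i) * X i

/-- Precomposition of polynomial functions with the affine map `v ↦ A v + b`. -/
def pull (A : Vec n →ₗ[ℂ] Vec n) (b : Vec n) : Poly n →ₐ[ℂ] Poly n :=
  aeval fun i => (∑ j, C (A (Pi.single j 1) i) * X j) + C (b i)

theorem eval_pull (A : Vec n →ₗ[ℂ] Vec n) (b x : Vec n) (f : Poly n) :
    eval x (pull A b f) = eval (A x + b) f := by
  have hA : ∀ i, ∑ j, A (Pi.single j 1) i * x j = A x i := by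
    intro i
    conv_rhs => rw [pi_eq_sum_univ' x, map_sum, Finset.sum_apply]
    refine Finset.sum_congr rfl fun j _ => ?_
    rw [map_smul, Pi.smul_apply, smul_eq_mul, mul_comm]
  induction f using MvPolynomial.induction_on with
  | C a => simp [pull]
  | add p q hp hq => rw [map_add, map_add, map_add, hp, hq]
  | mul_X p i hp =>
    rw [map_mul, map_mul, map_mul, hp]
    congr 1
    simp [pull, hA]

/-- The action of a linear automorphism on `Λ`: `(g f)(x) = f (g⁻¹ x)`. -/
def polyAct (g : Vec n ≃ₗ[ℂ] Vec n) : Poly n ≃ₐ[ℂ] Poly n :=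
  AlgEquiv.ofAlgHom (pull (g⁻¹ : Vec n ≃ₗ[ℂ] Vec n).toLinearMap 0) (pull g.toLinearMap 0)
    (AlgHom.ext fun f => MvPolynomial.funext fun x => by
      simp [eval_pull])
    (AlgHom.ext fun f => MvPolynomial.funext fun x => by
      simp [eval_pull])

/-- The translation `t_z` on `Λ`: `(t_z f)(x) = f (x + z)`. -/
def polyShift (z : Vec n) : Poly n ≃ₐ[ℂ] Poly n :=
  AlgEquiv.ofAlgHom (pull LinearMap.id z) (pull LinearMap.id (-z))
    (AlgHom.ext fun f => MvPolynomial.funext fun x => by simp [eval_pull])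
    (AlgHom.ext fun f => MvPolynomial.funext fun x => by simp [eval_pull])

/-- The extension of an automorphism of `Λ` to `L`. -/
def extendRat (e : Poly n ≃ₐ[ℂ] Poly n) : RatFn n ≃ₐ[ℂ] RatFn n :=
  IsFractionRing.algEquivOfAlgEquiv e

theorem extendRat_algebraMap (e : Poly n ≃ₐ[ℂ] Poly n) (p : Poly n) :
    extendRat e (algebraMap (Poly n) (RatFn n) p) = algebraMap (Poly n) (RatFn n) (e p) :=
  IsFractionRing.algEquivOfAlgEquiv_algebraMap e p

theorem ratAlgEquiv_ext {e f : RatFn n ≃ₐ[ℂ] RatFn n}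
    (h : ∀ p : Poly n, e (algebraMap _ _ p) = f (algebraMap _ _ p)) : e = f := by
  have : e.toRingEquiv.toRingHom = f.toRingEquiv.toRingHom :=
    IsLocalization.ringHom_ext (nonZeroDivisors (Poly n)) (RingHom.ext h)
  exact AlgEquiv.ext fun x => RingHom.congr_fun this x

/-- The action of a linear automorphism of `V` on `L`. -/
def ratAct (g : Vec n ≃ₗ[ℂ] Vec n) : RatFn n ≃ₐ[ℂ] RatFn n := extendRat (polyAct g)

/-- The translations `t_z` acting on `L`. -/
def ratShift : Multiplicative (Vec n) →* (RatFn n ≃ₐ[ℂ] RatFn n) where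
  toFun z := extendRat (polyShift z.toAdd)
  map_one' := ratAlgEquiv_ext fun p => by
    rw [extendRat_algebraMap, AlgEquiv.one_apply]
    refine congrArg _ ?_
    exact MvPolynomial.funext fun x => by simp [polyShift, eval_pull]
  map_mul' y z := ratAlgEquiv_ext fun p => by
    rw [AlgEquiv.mul_apply, extendRat_algebraMap, extendRat_algebraMap, extendRat_algebraMap]
    refine congrArg _ ?_
    exact MvPolynomial.funext fun x => by simp [polyShift, eval_pull, add_assoc]

/-! ### The smash product `L # V` and its operators -/

instance : MulSemiringAction (Multiplicative (Vec n)) (RatFn n) :=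
  MulSemiringAction.compHom (RatFn n) ratShift

theorem shift_smul_def (z : Multiplicative (Vec n)) (f : RatFn n) : z • f = ratShift z f := rfl

instance : SMulCommClass (Multiplicative (Vec n)) ℂ (RatFn n) where
  smul_comm z c f := by rw [shift_smul_def, shift_smul_def]; exact (ratShift z).toLinearMap.map_smul c f

/-- The smash product `L # V`: `X.coeff (ofAdd z)` is the coefficient of `t_z` in `X`. -/
abbrev Smash (n : ℕ) := SkewMonoidAlgebra (RatFn n) (Multiplicative (Vec n))

/-- The embedding of `L` in `L # V`. -/
def ofRat : RatFn n →ₐ[ℂ] Smash n where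
  toFun f := SkewMonoidAlgebra.single 1 f
  map_one' := rfl
  map_zero' := SkewMonoidAlgebra.single_zero _
  map_add' := SkewMonoidAlgebra.single_add _
  map_mul' f g := by simp [SkewMonoidAlgebra.single_mul_single]
  commutes' c := by rw [SkewMonoidAlgebra.coe_algebraMap]; rfl

/-- The action of `L # V` on `L`: `(∑ l_z t_z)(f) = ∑ l_z t_z(f)`. -/
def toOp : Smash n →ₐ[ℂ] Module.End ℂ (RatFn n) :=
  SkewMonoidAlgebra.liftNCAlgHom (Algebra.lmul ℂ (RatFn n))
    { toFun := fun z => (ratShift z).toLinearMap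
      map_one' := by rw [map_one]; rfl
      map_mul' := fun y z => by rw [map_mul]; rfl }
    (fun {f z} => LinearMap.ext fun h => by
      change ratShift z f * ratShift z h = ratShift z (f * h)
      rw [map_mul])

/-- The anti-homomorphism `†` of `L # V`, `(l t_z)† = t_z⁻¹ l`. -/
def dagger : Smash n →ₐ[ℂ] (Smash n)ᵐᵒᵖ :=
  SkewMonoidAlgebra.liftNCAlgHom
    (ofRat.toOpposite fun f g => (Commute.all f g).map ofRat)
    { toFun := fun z => MulOpposite.op (SkewMonoidAlgebra.single z⁻¹ 1)
      map_one' := by rw [inv_one]; rfl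
      map_mul' := fun y z => by
        rw [← MulOpposite.op_mul, SkewMonoidAlgebra.single_mul_single]
        simp [mul_comm] }
    (fun {f z} => by
      change MulOpposite.op (SkewMonoidAlgebra.single 1 (z • f)) *
          MulOpposite.op (SkewMonoidAlgebra.single z⁻¹ 1)
        = MulOpposite.op (SkewMonoidAlgebra.single z⁻¹ 1) *
          MulOpposite.op (SkewMonoidAlgebra.single 1 f)
      rw [← MulOpposite.op_mul, ← MulOpposite.op_mul, SkewMonoidAlgebra.single_mul_single,
        SkewMonoidAlgebra.single_mul_single]
      simp)

/-- The operator `X†` on `L`. -/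
def daggerOp (X : Smash n) : Module.End ℂ (RatFn n) := toOp (dagger X).unop

/-- The partial derivative `∂/∂x_i`, packaged with the identity: `p ↦ p + ε ∂p`. -/
def dualLift (i : Fin n) : Poly n →+* TrivSqZeroExt (RatFn n) (RatFn n) where
  toFun p := (algebraMap _ _ p, algebraMap _ _ (pderiv i p))
  map_one' := by
    rw [pderiv_one, map_zero, map_one]; rfl
  map_zero' := by
    rw [map_zero, map_zero, map_zero]; rfl
  map_add' p q := by
    rw [map_add, map_add, map_add]; rfl
  map_mul' p q := by
    rw [Derivation.leibniz, map_add, map_mul, smul_eq_mul, smul_eq_mul, map_mul, map_mul]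
    refine Prod.ext rfl ?_
    change _ = algebraMap (Poly n) (RatFn n) p * algebraMap (Poly n) (RatFn n) (pderiv i q)
      + algebraMap (Poly n) (RatFn n) (pderiv i p) * algebraMap (Poly n) (RatFn n) q
    ring

/-- The extension of `dualLift i` to `L`. -/
def dualLiftRat (i : Fin n) : RatFn n →+* TrivSqZeroExt (RatFn n) (RatFn n) :=
  IsLocalization.lift (M := nonZeroDivisors (Poly n)) (g := dualLift i) fun q => by
    rw [TrivSqZeroExt.isUnit_iff_isUnit_fst]
    exact IsLocalization.map_units (RatFn n) q

theorem dualLiftRat_fst (i : Fin n) (f : RatFn n) : (dualLiftRat i f).fst = f := by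
  have : (TrivSqZeroExt.fstHom ℂ (RatFn n) (RatFn n)).toRingHom.comp (dualLiftRat i)
      = RingHom.id _ :=
    IsLocalization.ringHom_ext (nonZeroDivisors (Poly n)) (RingHom.ext fun p => by
      change (dualLiftRat i (algebraMap _ _ p)).fst = _
      rw [dualLiftRat, IsLocalization.lift_eq]
      rfl)
  exact RingHom.congr_fun this f

theorem dualLiftRat_snd (i : Fin n) (p : Poly n) :
    (dualLiftRat i (algebraMap _ _ p)).snd = algebraMap _ _ (pderiv i p) := by
  rw [dualLiftRat, IsLocalization.lift_eq]
  rfl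

/-- The derivation `∂/∂x_i` of `L`. -/
def ratDeriv (i : Fin n) : Derivation ℂ (RatFn n) (RatFn n) :=
  Derivation.mk'
    { toFun := fun f => (dualLiftRat i f).snd
      map_add' := fun f g => by simp
      map_smul' := fun c f => by
        have key : ∀ x : RatFn n, c • x = algebraMap (Poly n) (RatFn n) (C c) * x := fun x => by
          rw [Algebra.smul_def]; rfl
        rw [key, map_mul, TrivSqZeroExt.snd_mul, dualLiftRat_snd, dualLiftRat_fst,
          dualLiftRat_fst, pderiv_C, map_zero, RingHom.id_apply, key, smul_zero, add_zero]
        rfl }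
    (fun f g => by
      change (dualLiftRat i (f * g)).snd = f * (dualLiftRat i g).snd + g * (dualLiftRat i f).snd
      rw [map_mul, TrivSqZeroExt.snd_mul, dualLiftRat_fst, dualLiftRat_fst, op_smul_eq_smul,
        smul_eq_mul, smul_eq_mul])

theorem ratDeriv_algebraMap (i : Fin n) (p : Poly n) :
    ratDeriv i (algebraMap _ _ p) = algebraMap _ _ (pderiv i p) := dualLiftRat_snd i p

/-! ### Root systems, reflection groups, lengths -/

/-- The orthogonal reflection `s_α(v) = v - 2 (α,v)/(α,α) α` (for `(α,α) ≠ 0`). -/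
def rootRefl (α : Vec n) : Vec n ≃ₗ[ℂ] Vec n :=
  LinearEquiv.ofInvolutive
    { toFun := fun v => v - (2 * (α ⬝ᵥ v) / (α ⬝ᵥ α)) • α
      map_add' := fun v w => by
        rw [dotProduct_add, mul_add, add_div, add_smul]; abel
      map_smul' := fun c v => by
        rw [dotProduct_smul, smul_eq_mul, RingHom.id_apply, smul_sub, smul_smul]
        congr 2; ring }
    (fun v => by
      by_cases h : α ⬝ᵥ α = 0
      · simp [h]
      · simp only [LinearMap.coe_mk, AddHom.coe_mk, dotProduct_sub, dotProduct_smul, smul_eq_mul]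
        rw [sub_sub, ← add_smul, sub_eq_self]
        convert zero_smul ℂ α
        field_simp
        ring)

/-- Finite root systems `Φ` (not necessarily crystallographic, nor spanning). -/
structure IsRootSystem (Φ : Set (Vec n)) : Prop where
  finite : Φ.Finite
  nonisotropic : ∀ α ∈ Φ, α ⬝ᵥ α ≠ 0
  reduced : ∀ α ∈ Φ, ∀ c : ℂ, c • α ∈ Φ ↔ c = 1 ∨ c = -1
  reflection_mem : ∀ α ∈ Φ, ∀ β ∈ Φ, rootRefl α β ∈ Φ

/-- `S` is a base (simple system) of `Φ`: it is a linearly independent subset of `Φ`, and each root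
is a real combination of elements of `S` with coefficients all `≥ 0` or all `≤ 0`. -/
structure IsBase (Φ S : Set (Vec n)) : Prop where
  subset : S ⊆ Φ
  linearIndependent : LinearIndepOn ℂ id S
  nonneg_or_nonpos : ∀ α ∈ Φ, α ∈ Submodule.span NNReal S ∨ -α ∈ Submodule.span NNReal S

/-- The group generated by the reflections `s_α`, `α ∈ S`. -/
def reflGroup (S : Set (Vec n)) : Subgroup (Vec n ≃ₗ[ℂ] Vec n) := Subgroup.closure (rootRefl '' S)

/-- The root system generated by a set of simple roots `Ω`: the images of the elements of `Ω` under
the group `W = reflGroup Ω` that their reflections generate. The Weyl group of this system is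
`W`, because `s_{gα} = g s_α g⁻¹`. -/
def subsystem (Ω : Set (Vec n)) : Set (Vec n) := {β | ∃ g ∈ reflGroup Ω, ∃ α ∈ Ω, β = g α}

/-- The positive elements of `Ψ` with respect to the base `Ω`. -/
def posRoots (Ψ Ω : Set (Vec n)) : Set (Vec n) := {α ∈ Ψ | α ∈ Submodule.span NNReal Ω}

/-- `Ψ_0(v)`, the roots that vanish at `v`. -/
def rootsAt (Ψ : Set (Vec n)) (v : Vec n) : Set (Vec n) := {α ∈ Ψ | α ⬝ᵥ v = 0}

/-- `v` is `Ω`-standard: the roots of `Ψ = subsystem Ω` that vanish at `v` form a standard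
subsystem, that is, one generated by a subset of `Ω`. -/
def IsStandard (Ω : Set (Vec n)) (v : Vec n) : Prop :=
  ∃ Θ ⊆ Ω, rootsAt (subsystem Ω) v = subsystem Θ

/-- The length `ℓ(g)` with respect to the simple reflections `s_α`, `α ∈ Ω`. -/
def weylLength (Ω : Set (Vec n)) (g : Vec n ≃ₗ[ℂ] Vec n) : ℕ :=
  sInf {k | ∃ l : List (Vec n), l.length = k ∧ (∀ α ∈ l, α ∈ Ω) ∧ (l.map rootRefl).prod = g}

/-- A chosen reduced decomposition `g = s_{α_1} ⋯ s_{α_k}`, as a list of simple roots. -/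
def reducedWord (Ω : Set (Vec n)) (g : Vec n ≃ₗ[ℂ] Vec n) : List (Vec n) :=
  Classical.epsilon fun l =>
    l.length = weylLength Ω g ∧ (∀ α ∈ l, α ∈ Ω) ∧ (l.map rootRefl).prod = g

/-- `g` is a longest element of the set `A`. -/
def IsLongest (Ω : Set (Vec n)) (A : Set (Vec n ≃ₗ[ℂ] Vec n)) (g : Vec n ≃ₗ[ℂ] Vec n) : Prop :=
  g ∈ A ∧ ∀ h ∈ A, weylLength Ω h ≤ weylLength Ω g

/-- The longest element `ω_0` of `W = reflGroup Ω`. -/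
def longest (Ω : Set (Vec n)) : Vec n ≃ₗ[ℂ] Vec n :=
  Classical.epsilon (IsLongest Ω (reflGroup Ω))

/-- `W^v`: the elements of minimal length in their left coset of the stabilizer `W_v`. -/
def minReps (Ω : Set (Vec n)) (v : Vec n) : Set (Vec n ≃ₗ[ℂ] Vec n) :=
  {g | g ∈ reflGroup Ω ∧ ∀ h ∈ reflGroup Ω, h v = v → weylLength Ω g ≤ weylLength Ω (g * h)}

/-! ### Invariants, Schubert polynomials, Postnikov–Stanley operators -/

/-- The algebra of invariants of `reflGroup S` in `Λ`. -/
def invariants (S : Set (Vec n)) : Subalgebra ℂ (Poly n) where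
  carrier := {f | ∀ g ∈ reflGroup S, polyAct g f = f}
  mul_mem' ha hb g hg := by rw [map_mul, ha g hg, hb g hg]
  add_mem' ha hb g hg := by rw [map_add, ha g hg, hb g hg]
  algebraMap_mem' c g _ := (polyAct g).commutes c

/-- The twisted derivation `∇_α f = (f - s_α f)/α` on `Λ` (an exact division). -/
def nabla (α : Vec n) (f : Poly n) : Poly n :=
  Classical.epsilon fun q => linForm α * q = f - polyAct (rootRefl α) f

/-- The divided difference `∂_σ = ∇_{s_1} ∘ ⋯ ∘ ∇_{s_k}`, for a reduced decomposition of `σ`. -/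
def divDiff (Ω : Set (Vec n)) (σ : Vec n ≃ₗ[ℂ] Vec n) (f : Poly n) : Poly n :=
  (reducedWord Ω σ).foldr nabla f

/-- `Δ(Ψ)`, the product of the positive roots of `Ψ = subsystem Ω`. -/
def vandermonde (Ω : Set (Vec n)) : Poly n := ∏ᶠ α ∈ posRoots (subsystem Ω) Ω, linForm α

/-- The Schubert polynomial `𝔖_σ = |W|⁻¹ ∂_{σ⁻¹ω_0} Δ(Ψ)`. -/
def schubert (Ω : Set (Vec n)) (σ : Vec n ≃ₗ[ℂ] Vec n) : Poly n :=
  C ((Nat.card (reflGroup Ω) : ℂ)⁻¹) * divDiff Ω (σ⁻¹ * longest Ω) (vandermonde Ω)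

/-- `I_W`: the ideal of `Λ` generated by the invariants of `W = reflGroup Ω` of positive degree. -/
def coinvIdeal (Ω : Set (Vec n)) : Ideal (Poly n) :=
  Ideal.span {f | f ∈ invariants Ω ∧ ∃ d, 0 < d ∧ f.IsHomogeneous d}

/-- Substitution of (commuting) operators `d i` for the variables of a polynomial. -/
def substOp {A : Type*} [AddCommGroup A] [Module ℂ A] (d : Fin n → Module.End ℂ A) (P : Poly n) :
    Module.End ℂ A :=
  ∑ m ∈ P.support, P.coeff m • (List.ofFn fun i => d i ^ m i).prod

/-- `Θ(P)`: the differential operator on `Λ` obtained from `P` by `x_i ↦ ∂/∂x_i`. -/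
def theta (P : Poly n) : Module.End ℂ (Poly n) := substOp (fun i => (pderiv i).toLinearMap) P

/-- The extension of `Θ(P)` to `L`. -/
def thetaRat (P : Poly n) : Module.End ℂ (RatFn n) :=
  substOp (fun i => (ratDeriv i).toLinearMap) P

/-- The pairing `(f, g)_Θ = Θ(f)(g)(0)` on `Λ`. -/
def pairing (f g : Poly n) : ℂ := eval 0 (theta f g)

/-- The defining property of `P_σ`: it is orthogonal to `I_W`, and dual to the Schubert
polynomials. -/
def IsDualSchubert (Ω : Set (Vec n)) (σ : Vec n ≃ₗ[ℂ] Vec n) (P : Poly n) : Prop :=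
  (∀ f ∈ coinvIdeal Ω, pairing f P = 0) ∧ pairing P (schubert Ω σ) = 1 ∧
    ∀ τ ∈ reflGroup Ω, τ ≠ σ → pairing P (schubert Ω τ) = 0

/-- The Postnikov–Stanley polynomial `P_σ`, the unique one with the property above. -/
def psPoly (Ω : Set (Vec n)) (σ : Vec n ≃ₗ[ℂ] Vec n) : Poly n :=
  Classical.epsilon (IsDualSchubert Ω σ)

/-- The generalized Littlewood–Richardson coefficients: `𝔖_σ 𝔖_τ ≡ ∑_ρ c^ρ_{σ,τ} 𝔖_ρ` modulo
`I_W`; `lrCoeff Ω σ τ ρ` is `c^ρ_{σ,τ}`. -/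
def lrCoeff (Ω : Set (Vec n)) (σ τ : Vec n ≃ₗ[ℂ] Vec n) : reflGroup Ω → ℂ :=
  Classical.epsilon fun c =>
    schubert Ω σ * schubert Ω τ - ∑ᶠ ρ : reflGroup Ω, C (c ρ) * schubert Ω ρ ∈ coinvIdeal Ω

/-- A rational function is regular at `v` if it has a denominator that does not vanish at `v`. -/
def IsRegularAt (v : Vec n) (F : RatFn n) : Prop :=
  ∃ p q : Poly n, eval v q ≠ 0 ∧ F * algebraMap _ _ q = algebraMap _ _ p

/-- The value at `v` of a rational function that is regular at `v`. -/
def evalRat (v : Vec n) (F : RatFn n) : ℂ :=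
  Classical.epsilon fun c =>
    ∃ p q : Poly n, eval v q ≠ 0 ∧ F * algebraMap _ _ q = algebraMap _ _ p ∧
      c = eval v p / eval v q

/-- `D_σ^v(F)`, the value at `v` of `Θ(P_σ)(F)`, for a rational function `F` regular at `v`. -/
def psValue (Ω : Set (Vec n)) (σ : Vec n ≃ₗ[ℂ] Vec n) (v : Vec n) (F : RatFn n) : ℂ :=
  evalRat v (thetaRat (psPoly Ω σ) F)

/-- `D_{τ,σ}^v(F) = ∑_ρ c^σ_{τ,ρ} D_ρ^v(F)`. -/
def psValue₂ (Ω : Set (Vec n)) (τ : Vec n ≃ₗ[ℂ] Vec n) (σ : reflGroup Ω) (v : Vec n)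
    (F : RatFn n) : ℂ :=
  ∑ᶠ ρ : reflGroup Ω, lrCoeff Ω τ ρ σ * psValue Ω ρ v F

/-! ### The spaces of BGG differential operators -/

/-- `Γ*`, the complex dual of the algebra `Γ` of invariants of the group of `Φ`. -/
def GammaDual (Φ : Set (Vec n)) : Type := Module.Dual ℂ (invariants Φ)

instance (Φ : Set (Vec n)) : AddCommGroup (GammaDual Φ) :=
  inferInstanceAs (AddCommGroup (invariants Φ →ₗ[ℂ] ℂ))

instance (Φ : Set (Vec n)) : Module ℂ (GammaDual Φ) :=
  inferInstanceAs (Module ℂ (invariants Φ →ₗ[ℂ] ℂ))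

/-- The restriction of `D_σ^v` to `Γ`, the invariants of the group of `Φ`:
`γ ↦ Θ(P_σ)(γ)(v)`. -/
def bgg (Φ Ω : Set (Vec n)) (σ : Vec n ≃ₗ[ℂ] Vec n) (v : Vec n) :
    GammaDual Φ :=
  (MvPolynomial.aeval v).toLinearMap ∘ₗ theta (psPoly Ω σ) ∘ₗ (invariants Φ).val.toLinearMap

/-- `𝒟(Ω, v) ⊆ Γ*`, the span of the restrictions of the `D_σ^v`, `σ ∈ W`. -/
def bggSpace (Φ Ω : Set (Vec n)) (v : Vec n) : Submodule ℂ (GammaDual Φ) :=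
  Submodule.span ℂ ((fun σ => bgg Φ Ω σ v) '' (reflGroup Ω))

/-- `V(Ω, T(v)) = ∑_{z ∈ Z} 𝒟(Ω, v + z)`. -/
def bggSum (Φ Ω : Set (Vec n)) (v : Vec n) (Z : AddSubmonoid (Vec n)) :
    Submodule ℂ (GammaDual Φ) :=
  ⨆ z ∈ Z, bggSpace Φ Ω (v + z)

/-! ### Co-rational Galois orders -/

/-- The embedding of `Γ` in `L # V`. -/
def ofGamma (Φ : Set (Vec n)) : invariants Φ →ₐ[ℂ] Smash n :=
  ofRat.comp ((Algebra.algHom ℂ (Poly n) (RatFn n)).comp (invariants Φ).val)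

/-- `X ∈ (L # V)^G`, where `σ (l t_z) = σ(l) t_{σ z}`. -/
def IsInvariantOp (Φ : Set (Vec n)) (X : Smash n) : Prop :=
  ∀ g ∈ reflGroup Φ, ∀ z : Vec n,
    X.coeff (Multiplicative.ofAdd (g z)) = ratAct g (X.coeff (Multiplicative.ofAdd z))

/-- `d_χ`, the generator of the relative invariants of the character `χ`: the product of the
positive roots `α` with `χ(s_α) = -1`. -/
def relInvariant (Φ S : Set (Vec n)) (χ : reflGroup Φ →* ℂˣ) : Poly n :=
  ∏ᶠ α ∈ {α | α ∈ posRoots Φ S ∧ ∃ h : rootRefl α ∈ reflGroup Φ, χ ⟨rootRefl α, h⟩ = -1}, linForm α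

/-- `X d_χ ∈ Λ # V` for some character `χ` of `G`. -/
def HasRationalDenominator (Φ S : Set (Vec n)) (X : Smash n) : Prop :=
  ∃ χ : reflGroup Φ →* ℂˣ, ∀ z,
    (X * ofRat (algebraMap _ _ (relInvariant Φ S χ))).coeff z ∈
      (algebraMap (Poly n) (RatFn n)).range

/-- Co-rational Galois orders: the subalgebras of `L # V` that are generated by `Γ` and a finite
set of invariant operators `X` such that `X d_χ ∈ Λ # V` for some `χ`. -/
def IsCorationalGaloisOrder (Φ S : Set (Vec n)) (U : Subalgebra ℂ (Smash n)) : Prop :=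
  ∃ 𝒳 : Set (Smash n), 𝒳.Finite ∧
    (∀ X ∈ 𝒳, IsInvariantOp Φ X ∧ HasRationalDenominator Φ S X) ∧
    U = Algebra.adjoin ℂ (Set.range (ofGamma Φ) ∪ 𝒳)

theorem IsCorationalGaloisOrder.gamma_mem {Φ S : Set (Vec n)} {U : Subalgebra ℂ (Smash n)}
    (hU : IsCorationalGaloisOrder Φ S U) (γ : invariants Φ) : ofGamma Φ γ ∈ U := by
  obtain ⟨𝒳, -, -, rfl⟩ := hU
  exact Algebra.subset_adjoin (Or.inl ⟨γ, rfl⟩)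

/-- The embedding of `Γ` in `U`. -/
def gammaHom {Φ S : Set (Vec n)} {U : Subalgebra ℂ (Smash n)}
    (hU : IsCorationalGaloisOrder Φ S U) : invariants Φ →ₐ[ℂ] U :=
  (ofGamma Φ).codRestrict U hU.gamma_mem

/-- The support of `X†`: the set of the `z` such that `t_z` occurs in `X†`. -/
def daggerSupport (X : Smash n) : Set (Vec n) :=
  {z | (dagger X).unop.coeff (Multiplicative.ofAdd z) ≠ 0}

/-- The additive monoid generated by the supports of the operators `X†`, `X ∈ U`. -/
def shiftMonoid (U : Subalgebra ℂ (Smash n)) : AddSubmonoid (Vec n) :=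
  AddSubmonoid.closure (⋃ X ∈ U, daggerSupport X)

/-! ### The action on `Γ*` -/

/-- The right Hartwig order: the `X` with `X†(Γ) ⊆ Γ`. -/
def rightHartwigOrder (Φ : Set (Vec n)) : Subalgebra ℂ (Smash n) where
  carrier := {X | ∀ γ : invariants Φ, ∃ γ' : invariants Φ,
    daggerOp X (algebraMap _ _ (γ : Poly n)) = algebraMap _ _ (γ' : Poly n)}
  mul_mem' {X Y} hX hY γ := by
    obtain ⟨γ₁, h₁⟩ := hX γ
    obtain ⟨γ₂, h₂⟩ := hY γ₁
    refine ⟨γ₂, ?_⟩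
    rw [← h₂, ← h₁, daggerOp, map_mul, MulOpposite.unop_mul, map_mul]
    rfl
  add_mem' {X Y} hX hY γ := by
    obtain ⟨γ₁, h₁⟩ := hX γ
    obtain ⟨γ₂, h₂⟩ := hY γ
    refine ⟨γ₁ + γ₂, ?_⟩
    rw [daggerOp, map_add, MulOpposite.unop_add, map_add, LinearMap.add_apply]
    rw [daggerOp] at h₁ h₂
    rw [h₁, h₂, ← map_add]
    rfl
  algebraMap_mem' c γ := by
    refine ⟨c • γ, ?_⟩
    rw [daggerOp, AlgHom.commutes, MulOpposite.algebraMap_apply, MulOpposite.unop_op,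
      AlgHom.commutes, Module.algebraMap_end_apply]
    exact ((Algebra.algHom ℂ (Poly n) (RatFn n)).toLinearMap.map_smul c (γ : Poly n)).symm

/-- The operator `X†` on `Γ`, for `X` in the right Hartwig order. -/
def daggerGamma {Φ : Set (Vec n)} (X : rightHartwigOrder Φ) (γ : invariants Φ) : invariants Φ :=
  (X.2 γ).choose

theorem daggerGamma_spec {Φ : Set (Vec n)} (X : rightHartwigOrder Φ) (γ : invariants Φ) :
    algebraMap (Poly n) (RatFn n) (daggerGamma X γ) = daggerOp X.1 (algebraMap _ _ (γ : Poly n)) :=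
  (X.2 γ).choose_spec.symm

theorem daggerGamma_eq {Φ : Set (Vec n)} {X : rightHartwigOrder Φ} {γ γ' : invariants Φ}
    (h : daggerOp X.1 (algebraMap _ _ (γ : Poly n)) = algebraMap _ _ (γ' : Poly n)) :
    daggerGamma X γ = γ' :=
  Subtype.ext (IsFractionRing.injective (Poly n) (RatFn n) ((daggerGamma_spec X γ).trans h))

theorem daggerOp_add (X Y : Smash n) : daggerOp (X + Y) = daggerOp X + daggerOp Y := by
  rw [daggerOp, map_add, MulOpposite.unop_add, map_add]; rfl

theorem daggerOp_mul (X Y : Smash n) : daggerOp (X * Y) = daggerOp Y * daggerOp X := by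
  rw [daggerOp, map_mul, MulOpposite.unop_mul, map_mul]; rfl

/-- `daggerGamma X` as a linear endomorphism of `Γ`. -/
def daggerGammaLin {Φ : Set (Vec n)} (X : rightHartwigOrder Φ) :
    invariants Φ →ₗ[ℂ] invariants Φ where
  toFun := daggerGamma X
  map_add' γ δ := daggerGamma_eq (by
    change daggerOp X.1 (algebraMap _ _ ((γ : Poly n) + (δ : Poly n))) =
      algebraMap _ _ ((daggerGamma X γ : Poly n) + (daggerGamma X δ : Poly n))
    rw [map_add, map_add, map_add, daggerGamma_spec, daggerGamma_spec])
  map_smul' c γ := daggerGamma_eq (by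
    have key : ∀ p : Poly n, algebraMap (Poly n) (RatFn n) (c • p) = c • algebraMap _ _ p :=
      fun p => (Algebra.algHom ℂ (Poly n) (RatFn n)).toLinearMap.map_smul c p
    change daggerOp X.1 (algebraMap _ _ (c • (γ : Poly n))) =
      algebraMap _ _ (c • (daggerGamma X γ : Poly n))
    rw [key, key, LinearMap.map_smul, daggerGamma_spec])

/-- Precomposition of a functional on `Γ` with the restriction of `X†` to `Γ`. -/
def dualAct {Φ : Set (Vec n)} (X : rightHartwigOrder Φ) (φ : GammaDual Φ) : GammaDual Φ :=
  LinearMap.comp (show invariants Φ →ₗ[ℂ] ℂ from φ) (daggerGammaLin X)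

/-- The value of an element of `Γ*` at an element of `Γ`. -/
def GammaDual.val {Φ : Set (Vec n)} (φ : GammaDual Φ) : invariants Φ →ₗ[ℂ] ℂ := φ

theorem GammaDual.ext {Φ : Set (Vec n)} {φ ψ : GammaDual Φ} (h : ∀ γ, φ.val γ = ψ.val γ) :
    φ = ψ := LinearMap.ext h

theorem dualAct_val {Φ : Set (Vec n)} (X : rightHartwigOrder Φ) (φ : GammaDual Φ)
    (γ : invariants Φ) : (dualAct X φ).val γ = φ.val (daggerGamma X γ) := rfl

theorem daggerGamma_one {Φ : Set (Vec n)} (γ : invariants Φ) : daggerGamma 1 γ = γ :=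
  daggerGamma_eq (by
    change daggerOp 1 _ = _
    rw [daggerOp, map_one, MulOpposite.unop_one, map_one]; rfl)

theorem daggerGamma_mul {Φ : Set (Vec n)} (X Y : rightHartwigOrder Φ) (γ : invariants Φ) :
    daggerGamma (X * Y) γ = daggerGamma Y (daggerGamma X γ) :=
  daggerGamma_eq (by
    rw [daggerGamma_spec, daggerGamma_spec]
    change daggerOp (X.1 * Y.1) _ = _
    rw [daggerOp_mul]; rfl)

theorem daggerGamma_add {Φ : Set (Vec n)} (X Y : rightHartwigOrder Φ) (γ : invariants Φ) :
    daggerGamma (X + Y) γ = daggerGamma X γ + daggerGamma Y γ :=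
  daggerGamma_eq (by
    change daggerOp (X.1 + Y.1) _ =
      algebraMap _ _ ((daggerGamma X γ : Poly n) + (daggerGamma Y γ : Poly n))
    rw [map_add, daggerGamma_spec, daggerGamma_spec, daggerOp_add]; rfl)

theorem daggerGamma_zero {Φ : Set (Vec n)} (γ : invariants Φ) : daggerGamma 0 γ = 0 :=
  daggerGamma_eq (by
    change daggerOp 0 _ = algebraMap (Poly n) (RatFn n) 0
    rw [daggerOp, map_zero, MulOpposite.unop_zero, map_zero, map_zero]; rfl)

/-- The left action of the right Hartwig order on `Γ*`: `X • φ = φ ∘ X†`. -/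
instance dualModule (Φ : Set (Vec n)) : Module (rightHartwigOrder Φ) (GammaDual Φ) where
  smul := dualAct
  one_smul φ := GammaDual.ext fun γ => congrArg φ.val (daggerGamma_one γ)
  mul_smul X Y φ := GammaDual.ext fun γ => congrArg φ.val (daggerGamma_mul X Y γ)
  smul_zero _ := GammaDual.ext fun _ => rfl
  smul_add _ _ _ := GammaDual.ext fun _ => rfl
  add_smul X Y φ := GammaDual.ext fun γ =>
    (congrArg φ.val (daggerGamma_add X Y γ)).trans (φ.val.map_add _ _)
  zero_smul φ := GammaDual.ext fun γ =>
    (congrArg φ.val (daggerGamma_zero γ)).trans φ.val.map_zero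

/-- The `U`-module structure of `Γ*`, for a subalgebra `U` of the right Hartwig order. -/
abbrev dualModuleOf {Φ : Set (Vec n)} {U : Subalgebra ℂ (Smash n)}
    (h : U ≤ rightHartwigOrder Φ) : Module U (GammaDual Φ) :=
  Module.compHom _ (Subalgebra.inclusion h).toRingHom

/-! ### Gelfand–Tsetlin modules -/

/-- `M[𝔪]`: the elements of `M` that are annihilated by a power of `𝔪`. -/
def weightSpace {R A : Type*} [CommSemiring R] [Semiring A] (j : R →+* A) (M : Type*) [AddCommMonoid M]
    [Module A M] (𝔪 : Ideal R) : AddSubmonoid M where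
  carrier := {x | ∃ k : ℕ, ∀ r ∈ 𝔪 ^ k, j r • x = 0}
  zero_mem' := ⟨0, fun _ _ => smul_zero _⟩
  add_mem' := by
    rintro x y ⟨k, hk⟩ ⟨l, hl⟩
    refine ⟨k + l, fun r hr => ?_⟩
    rw [smul_add, hk r (Ideal.pow_le_pow_right (Nat.le_add_right k l) hr),
      hl r (Ideal.pow_le_pow_right (Nat.le_add_left l k) hr), add_zero]

/-- The submodule `N` of `M` is a Gelfand–Tsetlin module: it is the direct sum of the `N[𝔪]`, where
`𝔪` runs over the maximal ideals of `R`. -/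
def IsGelfandTsetlin {R A M : Type*} [CommSemiring R] [Semiring A] [AddCommMonoid M] [Module A M]
    (j : R →+* A) (N : Submodule A M) : Prop :=
  letI := Classical.decEq (MaximalSpectrum R)
  DirectSum.IsInternal fun 𝔪 : MaximalSpectrum R => weightSpace j N 𝔪.asIdeal

/-! ### The terms of the explicit formula -/

/-- `F_y = h_y Δ(Ψ̃)^y`, where `h_y` is the coefficient of `t_y` in `X†` and `Δ(Ψ̃)^y` is the product
of the positive roots of `Ψ̃ = subsystem Θ` that do not vanish at `y`. -/
def formulaCoeff (Θ : Set (Vec n)) (X : Smash n) (y : Vec n) : RatFn n :=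
  (dagger X).unop.coeff (Multiplicative.ofAdd y) *
    algebraMap (Poly n) (RatFn n)
      (∏ᶠ α ∈ {α | α ∈ posRoots (subsystem Θ) Θ ∧ α ⬝ᵥ y ≠ 0}, linForm α)

/-- `Y` is a set of `Θ`-standard representatives of the orbits of `reflGroup Θ` in `A`. -/
def IsStandardReps (Θ A : Set (Vec n)) (Y : Finset (Vec n)) : Prop :=
  (∀ y ∈ Y, y ∈ A ∧ IsStandard Θ y) ∧
    ∀ z ∈ A, ∃! y, y ∈ Y ∧ ∃ g ∈ reflGroup Θ, g z = y

end GaloisBGG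

end

open MvPolynomial

noncomputable section

namespace GaloisBGG

variable {n : ℕ}

/-! ### Reflections -/

/-! The proof turns differential operators into divided differences. The functionals `f ↦
∂_w(f)(0)`, `w ∈ W`, vanish on `I_W` and are dual to the Schubert polynomials, so pairing with `P_σ`
is the functional `f ↦ ∂_σ(f)(0)` (`pairing_psPoly`). On `Γ` the operator `D_σ^u` is therefore `γ ↦
∂_σ(t_u γ)(0)` (`bgg_val`). For a rational `F` regular at `u`, write `t_u F = p/q` with `q`
invariant under `W` and `q(0) = 1`; then `D_σ^u(F) = ∂_σ(p)(0)` (`psValue_eq`). Multiplying Schubert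
expansions gives a coproduct formula whose coefficients are the Littlewood–Richardson coefficients
(`divEval_mul`).

The operator is `X†(γ) = ∑ h_z t_z(γ)`. For `γ ∈ Γ` the summands are permuted by the stabilizer `W̃`
of the standard point `v'`. A sum over a `W̃`-orbit is a single divided difference `∂_{ω^y}(F_y t_y
γ)` (`SimpleSystem.orbit_sum`). This rests on the symmetrization formula `∂_{ω₀} F = ∑_w w(F/Δ)` and
on the factorization of `ω₀` into `ω^y` and the longest element of `W̃_y`
(`SimpleSystem.card_mul_ratDiv_minRep`). The roots of `W̃` vanish at `v'`, so `t_{v'}` commutes with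
`∂_{ω^y}`. Now apply `∂_σ` and evaluate at `0`: the composite `∂_σ ∂_{ω^y}` is `∂_{σω^y}` or zero
according to lengths, and the coproduct formula separates `F_y` from `γ`. This is the explicit
formula (`dualAct_bgg`).

Poles are controlled by one remark: a rational function invariant under `s_α` has no simple pole
along `α` (`linForm_dvd_of_invariant`). It shows that `X†` preserves `Γ`, and that `h_y` has no
poles along roots vanishing at `y`. The remaining poles through `v'` belong to `Ψ̃`, by the
hypothesis on `Φ_0`, and the product in `F_y` cancels them (`isRegularAt_formulaCoeff`).

For the submodule property, `𝒟(Ω, gu) = 𝒟(Ω, u)` for `g ∈ W` (`bggSpace_map`), so `v + z` may be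
replaced by a standard vector and the formula applied to generators of `U`. The space `𝒟(Ω, u)`
consists of vectors killed by powers of the maximal ideal of `u`. Sums of such weight spaces are
direct, because powers of distinct maximal ideals are coprime (`weightSpace_injective`).

Two classical facts are proved along the way. Divided differences do not depend on the reduced word:
the difference of two candidates is semilinear and kills `1` (`SimpleSystem.wordOp_aux`). The
functionals `∂_w(·)(0)` cut out exactly `I_W`, by induction on degree and averaging
(`SimpleSystem.mem_coinvIdeal_of_words`). -/

theorem rootRefl_apply (α v : Vec n) :
    rootRefl α v = v - (2 * (α ⬝ᵥ v) / (α ⬝ᵥ α)) • α := rfl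

theorem rootRefl_rootRefl (α v : Vec n) : rootRefl α (rootRefl α v) = v :=
  (rootRefl α).apply_symm_apply v

theorem rootRefl_mul_self (α : Vec n) : rootRefl α * rootRefl α = 1 :=
  LinearEquiv.ext fun v => rootRefl_rootRefl α v

theorem rootRefl_inv (α : Vec n) : (rootRefl α)⁻¹ = rootRefl α :=
  inv_eq_of_mul_eq_one_left (rootRefl_mul_self α)

theorem rootRefl_self {α : Vec n} (h : α ⬝ᵥ α ≠ 0) : rootRefl α α = -α := by
  rw [rootRefl_apply, mul_div_assoc, div_self h, mul_one, two_smul]; abel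

theorem rootRefl_of_dotProduct_eq_zero {α v : Vec n} (h : α ⬝ᵥ v = 0) : rootRefl α v = v := by
  rw [rootRefl_apply, h]; simp

theorem dotProduct_rootRefl (α x y : Vec n) : rootRefl α x ⬝ᵥ rootRefl α y = x ⬝ᵥ y := by
  by_cases h : α ⬝ᵥ α = 0
  · simp [rootRefl_apply, h]
  · simp only [rootRefl_apply, dotProduct_sub, sub_dotProduct, dotProduct_smul, smul_dotProduct,
      smul_eq_mul, dotProduct_comm x α]
    field_simp
    ring

theorem dotProduct_map_map {S : Set (Vec n)} {g : Vec n ≃ₗ[ℂ] Vec n} (hg : g ∈ reflGroup S) :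
    ∀ x y : Vec n, g x ⬝ᵥ g y = x ⬝ᵥ y := by
  induction hg using Subgroup.closure_induction with
  | mem g hg => obtain ⟨α, -, rfl⟩ := hg; exact dotProduct_rootRefl α
  | one => exact fun _ _ => rfl
  | mul g h _ _ hg hh => exact fun x y => (hg _ _).trans (hh _ _)
  | inv g _ hg =>
    intro x y
    rw [← hg, ← LinearEquiv.mul_apply, ← LinearEquiv.mul_apply, mul_inv_cancel]
    rfl

theorem map_dotProduct {S : Set (Vec n)} {g : Vec n ≃ₗ[ℂ] Vec n} (hg : g ∈ reflGroup S)
    (x y : Vec n) : g x ⬝ᵥ y = x ⬝ᵥ g⁻¹ y := by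
  rw [← dotProduct_map_map hg x, ← LinearEquiv.mul_apply, mul_inv_cancel]; rfl

theorem rootRefl_map {S : Set (Vec n)} {g : Vec n ≃ₗ[ℂ] Vec n} (hg : g ∈ reflGroup S)
    (α : Vec n) : rootRefl (g α) = g * rootRefl α * g⁻¹ := by
  refine LinearEquiv.ext fun v => ?_
  rw [LinearEquiv.mul_apply, LinearEquiv.mul_apply, rootRefl_apply, rootRefl_apply, map_sub,
    map_smul, dotProduct_map_map hg, map_dotProduct hg, ← LinearEquiv.mul_apply, mul_inv_cancel]
  rfl

theorem rootRefl_neg (α : Vec n) : rootRefl (-α) = rootRefl α := by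
  refine LinearEquiv.ext fun v => ?_
  simp [rootRefl_apply, neg_div]

theorem rootRefl_mem {S : Set (Vec n)} {α : Vec n} (h : α ∈ S) : rootRefl α ∈ reflGroup S :=
  Subgroup.subset_closure ⟨α, h, rfl⟩

theorem reflGroup_mono {S T : Set (Vec n)} (h : S ⊆ T) : reflGroup S ≤ reflGroup T :=
  Subgroup.closure_mono (Set.image_mono h)

/-! ### The subsystem generated by a set of roots -/

theorem subset_subsystem (Ω : Set (Vec n)) : Ω ⊆ subsystem Ω :=
  fun α h => ⟨1, one_mem _, α, h, rfl⟩

theorem subsystem_mono {S T : Set (Vec n)} (h : S ⊆ T) : subsystem S ⊆ subsystem T := by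
  rintro _ ⟨g, hg, α, hα, rfl⟩
  exact ⟨g, reflGroup_mono h hg, α, h hα, rfl⟩

theorem map_mem_subsystem {Ω : Set (Vec n)} {g : Vec n ≃ₗ[ℂ] Vec n} (hg : g ∈ reflGroup Ω)
    {β : Vec n} (hβ : β ∈ subsystem Ω) : g β ∈ subsystem Ω := by
  obtain ⟨k, hk, α, hα, rfl⟩ := hβ
  exact ⟨g * k, mul_mem hg hk, α, hα, rfl⟩

theorem rootRefl_mem_of_mem_subsystem {Ω : Set (Vec n)} {β : Vec n} (hβ : β ∈ subsystem Ω) :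
    rootRefl β ∈ reflGroup Ω := by
  obtain ⟨k, hk, α, hα, rfl⟩ := hβ
  rw [rootRefl_map hk]
  exact mul_mem (mul_mem hk (rootRefl_mem hα)) (inv_mem hk)

theorem IsRootSystem.map_mem {Φ : Set (Vec n)} (h : IsRootSystem Φ) {g : Vec n ≃ₗ[ℂ] Vec n}
    (hg : g ∈ reflGroup Φ) : ∀ β ∈ Φ, g β ∈ Φ := by
  induction hg using Subgroup.closure_induction'' with
  | one => exact fun _ h => h
  | mem g hg => obtain ⟨α, hα, rfl⟩ := hg; exact fun β hβ => h.reflection_mem α hα β hβ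
  | inv_mem g hg =>
    obtain ⟨α, hα, rfl⟩ := hg
    rw [rootRefl_inv]
    exact fun β hβ => h.reflection_mem α hα β hβ
  | mul g k _ _ hg hk => exact fun β hβ => hg _ (hk β hβ)

/-- A set of simple roots: it is linearly independent, the group `reflGroup Ω` is finite, and
`subsystem Ω` is a finite reduced system of nonisotropic vectors with base `Ω`. -/
structure SimpleSystem (Ω : Set (Vec n)) : Prop where
  finite : (subsystem Ω).Finite
  finiteGroup : Finite (reflGroup Ω)
  nonisotropic : ∀ α ∈ subsystem Ω, α ⬝ᵥ α ≠ 0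
  reduced : ∀ α ∈ subsystem Ω, ∀ c : ℂ, c • α ∈ subsystem Ω → c = 1 ∨ c = -1
  linearIndependent : LinearIndepOn ℂ id Ω
  nonneg_or_nonpos : ∀ α ∈ subsystem Ω,
    α ∈ Submodule.span NNReal Ω ∨ -α ∈ Submodule.span NNReal Ω

/-- The positive roots of the system generated by `Ω`. -/
abbrev Pos (Ω : Set (Vec n)) : Set (Vec n) := posRoots (subsystem Ω) Ω

/-! ### Cones over a linearly independent set -/

theorem exists_functional {Ω : Set (Vec n)} (h : LinearIndepOn ℂ id Ω) (c : Vec n → ℂ) :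
    ∃ f : Vec n →ₗ[ℂ] ℂ, ∀ α ∈ Ω, f α = c α := by
  have hli : LinearIndependent ℂ ((↑) : Ω → Vec n) := h
  obtain ⟨f, hf⟩ := LinearMap.exists_extend ((Module.Basis.span hli).constr ℂ fun α : Ω => c α)
  refine ⟨f, fun α hα => ?_⟩
  have := LinearMap.congr_fun hf (Module.Basis.span hli ⟨α, hα⟩)
  rw [Module.Basis.constr_basis] at this
  rw [← this]
  change f α = f _
  congr 1
  exact (congrArg Subtype.val (Module.Basis.span_apply hli ⟨α, hα⟩)).symm

/-- If a functional, zero on `Θ ⊆ Ω` and one on the rest of `Ω`, vanishes on an element of the cone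
of `Ω`, then that element lies in the cone of `Θ`. -/
theorem cone_face {Ω Θ : Set (Vec n)} {f : Vec n →ₗ[ℂ] ℂ}
    (h0 : ∀ α ∈ Ω, α ∈ Θ → f α = 0) (h1 : ∀ α ∈ Ω, α ∉ Θ → f α = 1) {β : Vec n}
    (hβ : β ∈ Submodule.span NNReal Ω) :
    ∃ r : NNReal, f β = (r : ℝ) ∧ (r = 0 → β ∈ Submodule.span NNReal Θ) := by
  induction hβ using Submodule.span_induction with
  | mem α h =>
    by_cases hα : α ∈ Θ
    · exact ⟨0, by simp [h0 α h hα], fun _ => Submodule.subset_span hα⟩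
    · exact ⟨1, by simp [h1 α h hα], fun h => absurd h one_ne_zero⟩
  | zero => exact ⟨0, by simp, fun _ => zero_mem _⟩
  | add x y _ _ hx hy =>
    obtain ⟨r, hr, hr'⟩ := hx
    obtain ⟨s, hs, hs'⟩ := hy
    refine ⟨r + s, by rw [map_add, hr, hs]; push_cast; rfl, fun h => ?_⟩
    rw [add_eq_zero] at h
    exact add_mem (hr' h.1) (hs' h.2)
  | smul a x _ hx =>
    obtain ⟨r, hr, hr'⟩ := hx
    refine ⟨a * r, ?_, fun h => ?_⟩
    · have : a • x = ((a : ℝ) : ℂ) • x := rfl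
      rw [this, map_smul, hr, smul_eq_mul]; push_cast; rfl
    · rcases mul_eq_zero.mp h with h | h
      · rw [h, zero_smul]; exact zero_mem _
      · exact Submodule.smul_mem _ _ (hr' h)

/-- The height, the functional equal to `1` on `Ω`, is nonnegative on the cone and vanishes there
only at `0`. -/
theorem cone_pointed {Ω : Set (Vec n)} (h : LinearIndepOn ℂ id Ω) {β : Vec n}
    (hβ : β ∈ Submodule.span NNReal Ω) (hβ' : -β ∈ Submodule.span NNReal Ω) : β = 0 := by
  obtain ⟨f, hf⟩ := exists_functional h fun _ => 1
  obtain ⟨r, hr, hr'⟩ := cone_face (Θ := ∅) (by simp) (fun α h _ => hf α h) hβ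
  obtain ⟨s, hs, -⟩ := cone_face (Θ := ∅) (by simp) (fun α h _ => hf α h) hβ'
  have hrs : (r : ℝ) + s = 0 := by
    have : f β + f (-β) = 0 := by rw [← map_add, add_neg_cancel, map_zero]
    rw [hr, hs] at this
    exact_mod_cast this
  have : r = 0 := by
    have h1 := r.2; have h2 := s.2
    exact NNReal.eq (by rw [NNReal.coe_zero]; linarith [NNReal.coe_nonneg r, NNReal.coe_nonneg s])
  simpa using hr' this

/-- An element of the span of `Θ ⊆ Ω` that lies in the cone of `Ω` lies in the cone of `Θ`. -/
theorem cone_of_span {Ω Θ : Set (Vec n)} (h : LinearIndepOn ℂ id Ω) {β : Vec n}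
    (hβ : β ∈ Submodule.span NNReal Ω) (hβ' : β ∈ Submodule.span ℂ (Ω ∩ Θ)) :
    β ∈ Submodule.span NNReal Θ := by
  classical
  obtain ⟨f, hf⟩ := exists_functional h fun α => if α ∈ Θ then 0 else 1
  obtain ⟨r, hr, hr'⟩ := cone_face (Θ := Θ) (f := f) (fun α h h' => by rw [hf α h, if_pos h'])
    (fun α h h' => by rw [hf α h, if_neg h']) hβ
  refine hr' ?_
  have : f β = 0 := by
    refine LinearMap.mem_ker.mp ((Submodule.span_le.mpr fun α hα => ?_) hβ')
    exact LinearMap.mem_ker.mpr (by rw [hf α hα.1, if_pos hα.2])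
  rw [this] at hr
  exact_mod_cast hr.symm

/-- Each reflection moves a vector along its root. This confines the subsystem of `Θ` to the complex
span of `Θ`. -/
theorem sub_mem_span {S : Set (Vec n)} {g : Vec n ≃ₗ[ℂ] Vec n} (hg : g ∈ reflGroup S) :
    ∀ v, g v - v ∈ Submodule.span ℂ S := by
  induction hg using Subgroup.closure_induction'' with
  | one => intro v; simp
  | mem g hg =>
    obtain ⟨α, hα, rfl⟩ := hg
    intro v
    rw [rootRefl_apply, sub_sub_cancel_left]
    exact neg_mem (Submodule.smul_mem _ _ (Submodule.subset_span hα))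
  | inv_mem g hg =>
    obtain ⟨α, hα, rfl⟩ := hg
    intro v
    rw [rootRefl_inv, rootRefl_apply, sub_sub_cancel_left]
    exact neg_mem (Submodule.smul_mem _ _ (Submodule.subset_span hα))
  | mul g k _ _ hg hk =>
    intro v
    have := add_mem (hg (k v)) (hk v)
    rwa [sub_add_sub_cancel] at this

theorem subsystem_subset_span {S : Set (Vec n)} {β : Vec n} (hβ : β ∈ subsystem S) :
    β ∈ Submodule.span ℂ S := by
  obtain ⟨g, hg, α, hα, rfl⟩ := hβ
  have := add_mem (sub_mem_span hg α) (Submodule.subset_span hα)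
  rwa [sub_add_cancel] at this

/-- Positivity is inherited because the roots of the smaller system lie in the complex span of `Θ`,
and the cone of `Ω` meets that span in the cone of `Θ`. -/
theorem SimpleSystem.mono {Ω Θ : Set (Vec n)} (h : SimpleSystem Ω) (hΘ : Θ ⊆ Ω) :
    SimpleSystem Θ where
  finite := h.finite.subset (subsystem_mono hΘ)
  finiteGroup :=
    haveI := h.finiteGroup
    Finite.of_injective _ (Subgroup.inclusion_injective (reflGroup_mono hΘ))
  nonisotropic α hα := h.nonisotropic α (subsystem_mono hΘ hα)
  reduced α hα c hc := h.reduced α (subsystem_mono hΘ hα) c (subsystem_mono hΘ hc)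
  linearIndependent := h.linearIndependent.mono hΘ
  nonneg_or_nonpos α hα := by
    have hs := subsystem_subset_span hα
    rw [← Set.inter_eq_right.mpr hΘ] at hs
    rcases h.nonneg_or_nonpos α (subsystem_mono hΘ hα) with h1 | h1
    · exact Or.inl (cone_of_span h.linearIndependent h1 hs)
    · exact Or.inr (cone_of_span h.linearIndependent h1 (neg_mem hs))

theorem IsBase.subsystem_subset {Φ S Ω : Set (Vec n)} (hS : IsBase Φ S) (hΦ : IsRootSystem Φ)
    (hΩ : Ω ⊆ S) : subsystem Ω ⊆ Φ := by
  rintro _ ⟨g, hg, α, hα, rfl⟩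
  exact hΦ.map_mem (reflGroup_mono (hΩ.trans hS.subset) hg) _ (hS.subset (hΩ hα))

theorem IsBase.simpleSystem {Φ S Ω : Set (Vec n)} (hΦ : IsRootSystem Φ)
    (hG : Finite (reflGroup Φ)) (hS : IsBase Φ S) (hΩ : Ω ⊆ S) : SimpleSystem Ω := by
  have hsub := hS.subsystem_subset hΦ (subset_refl S)
  refine SimpleSystem.mono (Ω := S) ⟨hΦ.finite.subset hsub, ?_,
    fun α hα => hΦ.nonisotropic α (hsub hα),
    fun α hα c hc => (hΦ.reduced α (hsub hα) c).mp (hsub hc), hS.linearIndependent,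
    fun α hα => hS.nonneg_or_nonpos α (hsub hα)⟩ hΩ
  exact Finite.of_injective _ (Subgroup.inclusion_injective (reflGroup_mono hS.subset))

/-! ### Positive roots -/

section

variable {Ω : Set (Vec n)}

theorem SimpleSystem.neg_mem (h : SimpleSystem Ω) {α : Vec n} (hα : α ∈ subsystem Ω) :
    -α ∈ subsystem Ω := by
  rw [← rootRefl_self (h.nonisotropic α hα)]
  exact map_mem_subsystem (rootRefl_mem_of_mem_subsystem hα) hα

theorem SimpleSystem.pos_or_neg (h : SimpleSystem Ω) {α : Vec n} (hα : α ∈ subsystem Ω) :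
    α ∈ Pos Ω ∨ -α ∈ Pos Ω :=
  (h.nonneg_or_nonpos α hα).imp (fun h1 => ⟨hα, h1⟩) fun h1 => ⟨h.neg_mem hα, h1⟩

theorem SimpleSystem.ne_zero (h : SimpleSystem Ω) {α : Vec n} (hα : α ∈ subsystem Ω) :
    α ≠ 0 := fun h0 => h.nonisotropic α hα (by rw [h0, dotProduct_zero])

theorem SimpleSystem.not_neg_pos (h : SimpleSystem Ω) {α : Vec n} (hα : α ∈ Pos Ω) :
    -α ∉ Pos Ω := fun h' => h.ne_zero hα.1 (cone_pointed h.linearIndependent hα.2 h'.2)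

theorem SimpleSystem.not_pos_iff (h : SimpleSystem Ω) {α : Vec n} (hα : α ∈ subsystem Ω) :
    α ∉ Pos Ω ↔ -α ∈ Pos Ω :=
  ⟨fun h1 => (h.pos_or_neg hα).resolve_left h1, fun h1 h2 => h.not_neg_pos h2 h1⟩

theorem simple_pos {α : Vec n} (hα : α ∈ Ω) : α ∈ Pos Ω :=
  ⟨subset_subsystem Ω hα, Submodule.subset_span hα⟩

theorem SimpleSystem.pos_finite (h : SimpleSystem Ω) : (Pos Ω).Finite :=
  h.finite.subset fun _ h => h.1

/-- A simple reflection permutes the positive roots other than its own. -/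
theorem SimpleSystem.rootRefl_pos (h : SimpleSystem Ω) {α β : Vec n} (hα : α ∈ Ω)
    (hβ : β ∈ Pos Ω) (hne : β ≠ α) : rootRefl α β ∈ Pos Ω := by
  classical
  have hmem : rootRefl α β ∈ subsystem Ω := map_mem_subsystem (rootRefl_mem hα) hβ.1
  refine (h.pos_or_neg hmem).resolve_right fun hneg => ?_
  -- `f` adds up the coordinates other than that of `α`, so `s_α` does not change it. If `β` and
  -- `-s_α β` both lie in the cone, `f` vanishes at `β`, and `β` is a multiple of `α`.
  obtain ⟨f, hf⟩ := exists_functional h.linearIndependent fun γ => if γ = α then 0 else 1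
  have h0 : ∀ γ ∈ Ω, γ ∈ ({α} : Set (Vec n)) → f γ = 0 := fun γ h1 h2 => by
    rw [hf γ h1, if_pos (Set.mem_singleton_iff.mp h2)]
  have h1 : ∀ γ ∈ Ω, γ ∉ ({α} : Set (Vec n)) → f γ = 1 := fun γ h1 h2 => by
    rw [hf γ h1, if_neg fun h3 => h2 (Set.mem_singleton_iff.mpr h3)]
  obtain ⟨r, hr, hr'⟩ := cone_face h0 h1 hβ.2
  obtain ⟨s, hs, -⟩ := cone_face h0 h1 hneg.2
  have hrs : (r : ℝ) + s = 0 := by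
    have : f β + f (-rootRefl α β) = 0 := by
      rw [rootRefl_apply, ← map_add, neg_sub, add_sub_cancel, map_smul, h0 α hα rfl, smul_zero]
    rw [hr, hs] at this
    exact_mod_cast this
  have hr0 : r = 0 :=
    NNReal.eq (by rw [NNReal.coe_zero]; linarith [NNReal.coe_nonneg r, NNReal.coe_nonneg s])
  obtain ⟨c, hc⟩ := Submodule.mem_span_singleton.mp (hr' hr0)
  have hc' : ((c : ℝ) : ℂ) • α = β := hc
  rcases h.reduced α (subset_subsystem Ω hα) _ (hc' ▸ hβ.1) with h2 | h2
  · rw [h2, one_smul] at hc'; exact hne hc'.symm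
  · rw [h2, neg_one_smul] at hc'
    exact h.not_neg_pos (simple_pos hα) (hc' ▸ hβ)

end

/-! ### Words and lengths -/

/-- The element of the group that a word in the roots represents. -/
def wordProd (l : List (Vec n)) : Vec n ≃ₗ[ℂ] Vec n := (l.map rootRefl).prod

theorem wordProd_nil : wordProd ([] : List (Vec n)) = 1 := rfl

theorem wordProd_cons (α : Vec n) (l : List (Vec n)) :
    wordProd (α :: l) = rootRefl α * wordProd l := by simp [wordProd]

theorem wordProd_append (l m : List (Vec n)) :
    wordProd (l ++ m) = wordProd l * wordProd m := by simp [wordProd]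

theorem wordProd_reverse (l : List (Vec n)) : wordProd l.reverse = (wordProd l)⁻¹ := by
  induction l with
  | nil => simp [wordProd_nil]
  | cons α l ih =>
    rw [List.reverse_cons, wordProd_append, wordProd_cons, wordProd_cons, wordProd_nil, mul_one,
      mul_inv_rev, rootRefl_inv, ih]

/-- A word all of whose letters are in `Ω`. -/
def IsWord (Ω : Set (Vec n)) (l : List (Vec n)) : Prop := ∀ α ∈ l, α ∈ Ω

section

variable {Ω : Set (Vec n)}

theorem isWord_nil : IsWord Ω [] := by simp [IsWord]

theorem isWord_cons {α : Vec n} {l : List (Vec n)} :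
    IsWord Ω (α :: l) ↔ α ∈ Ω ∧ IsWord Ω l := List.forall_mem_cons

theorem isWord_append {l m : List (Vec n)} :
    IsWord Ω (l ++ m) ↔ IsWord Ω l ∧ IsWord Ω m := List.forall_mem_append

theorem isWord_reverse {l : List (Vec n)} : IsWord Ω l.reverse ↔ IsWord Ω l := by
  simp [IsWord]

theorem IsWord.wordProd_mem {l : List (Vec n)} (h : IsWord Ω l) : wordProd l ∈ reflGroup Ω := by
  induction l with
  | nil => exact one_mem _
  | cons α l ih =>
    rw [isWord_cons] at h
    rw [wordProd_cons]
    exact mul_mem (rootRefl_mem h.1) (ih h.2)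

theorem exists_word {w : Vec n ≃ₗ[ℂ] Vec n} (hw : w ∈ reflGroup Ω) :
    ∃ l, IsWord Ω l ∧ wordProd l = w := by
  induction hw using Subgroup.closure_induction'' with
  | one => exact ⟨[], isWord_nil, rfl⟩
  | mem g hg =>
    obtain ⟨α, hα, rfl⟩ := hg
    exact ⟨[α], isWord_cons.mpr ⟨hα, isWord_nil⟩, by rw [wordProd_cons, wordProd_nil, mul_one]⟩
  | inv_mem g hg =>
    obtain ⟨α, hα, rfl⟩ := hg
    exact ⟨[α], isWord_cons.mpr ⟨hα, isWord_nil⟩, by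
      rw [wordProd_cons, wordProd_nil, mul_one, rootRefl_inv]⟩
  | mul g k _ _ hg hk =>
    obtain ⟨l, hl, rfl⟩ := hg
    obtain ⟨m, hm, rfl⟩ := hk
    exact ⟨l ++ m, isWord_append.mpr ⟨hl, hm⟩, wordProd_append l m⟩

theorem weylLength_le {l : List (Vec n)} (h : IsWord Ω l) :
    weylLength Ω (wordProd l) ≤ l.length := Nat.sInf_le ⟨l, rfl, h, rfl⟩

/-- A reduced word. -/
def IsReduced (Ω : Set (Vec n)) (l : List (Vec n)) : Prop :=
  IsWord Ω l ∧ l.length = weylLength Ω (wordProd l)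

theorem exists_isReduced {w : Vec n ≃ₗ[ℂ] Vec n} (hw : w ∈ reflGroup Ω) :
    ∃ l, IsReduced Ω l ∧ wordProd l = w := by
  obtain ⟨l, hl, rfl⟩ := exists_word hw
  obtain ⟨m, hm, hm', hm''⟩ := Nat.sInf_mem
    (s := {k | ∃ m : List (Vec n), m.length = k ∧ (∀ α ∈ m, α ∈ Ω) ∧
      (m.map rootRefl).prod = wordProd l}) ⟨l.length, l, rfl, hl, rfl⟩
  refine ⟨m, ⟨hm', ?_⟩, hm''⟩
  have h3 : wordProd m = wordProd l := hm''
  rw [h3]; exact hm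

theorem reducedWord_spec {w : Vec n ≃ₗ[ℂ] Vec n} (hw : w ∈ reflGroup Ω) :
    IsReduced Ω (reducedWord Ω w) ∧ wordProd (reducedWord Ω w) = w := by
  have : ∃ l : List (Vec n), l.length = weylLength Ω w ∧ (∀ α ∈ l, α ∈ Ω) ∧
      (l.map rootRefl).prod = w := by
    obtain ⟨l, hl, rfl⟩ := exists_isReduced hw
    exact ⟨l, hl.2, hl.1, rfl⟩
  obtain ⟨h1, h2, h3⟩ := Classical.epsilon_spec this
  have h4 : wordProd (reducedWord Ω w) = w := h3
  exact ⟨⟨h2, by rw [h4]; exact h1⟩, h4⟩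

theorem IsReduced.tail {α : Vec n} {l : List (Vec n)} (h : IsReduced Ω (α :: l)) :
    IsReduced Ω l := by
  have hw := isWord_cons.mp h.1
  refine ⟨hw.2, le_antisymm ?_ (weylLength_le hw.2)⟩
  obtain ⟨m, hm, hm'⟩ := exists_isReduced hw.2.wordProd_mem
  have h1 := weylLength_le (isWord_cons.mpr ⟨hw.1, hm.1⟩ : IsWord Ω (α :: m))
  rw [wordProd_cons, hm', ← wordProd_cons, ← h.2, List.length_cons, List.length_cons, hm.2,
    hm'] at h1
  omega

theorem weylLength_inv {w : Vec n ≃ₗ[ℂ] Vec n} (hw : w ∈ reflGroup Ω) :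
    weylLength Ω w⁻¹ = weylLength Ω w := by
  have key : ∀ u ∈ reflGroup Ω, weylLength Ω u⁻¹ ≤ weylLength Ω u := fun u hu => by
    obtain ⟨l, hl, rfl⟩ := exists_isReduced hu
    rw [← wordProd_reverse, ← hl.2, ← List.length_reverse]
    exact weylLength_le (isWord_reverse.mpr hl.1)
  refine le_antisymm (key w hw) ?_
  have := key w⁻¹ (inv_mem hw)
  rwa [inv_inv] at this

theorem weylLength_one : weylLength Ω (1 : Vec n ≃ₗ[ℂ] Vec n) = 0 :=
  Nat.le_zero.mp (weylLength_le (Ω := Ω) isWord_nil)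

end

/-- The words obtained by deleting a letter from `l`, together with the corresponding roots `β`, such
that deleting the letter amounts to multiplying by `s_β` on the right. -/
def deletions : List (Vec n) → List (Vec n × List (Vec n))
  | [] => []
  | α :: l => ((wordProd l)⁻¹ α, l) :: (deletions l).map fun p => (p.1, α :: p.2)

/-- The roots that become negative along the word `l`. -/
def invList (l : List (Vec n)) : List (Vec n) := (deletions l).map Prod.fst

theorem invList_cons (α : Vec n) (l : List (Vec n)) :
    invList (α :: l) = (wordProd l)⁻¹ α :: invList l := by
  simp [invList, deletions]

theorem length_invList (l : List (Vec n)) : (invList l).length = l.length := by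
  induction l with
  | nil => rfl
  | cons α l ih => rw [invList_cons, List.length_cons, List.length_cons, ih]

/-! ### Inversions and length -/

section

variable {Ω : Set (Vec n)}

theorem deletions_spec {l : List (Vec n)} (hl : IsWord Ω l) :
    ∀ p ∈ deletions l, IsWord Ω p.2 ∧ p.2.length + 1 = l.length ∧
      wordProd p.2 = wordProd l * rootRefl p.1 ∧ p.1 ∈ subsystem Ω := by
  induction l with
  | nil => simp [deletions]
  | cons α l ih =>
    rw [isWord_cons] at hl
    intro p hp
    rw [deletions, List.mem_cons, List.mem_map] at hp
    rcases hp with rfl | ⟨q, hq, rfl⟩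
    · refine ⟨hl.2, rfl, ?_, map_mem_subsystem (inv_mem hl.2.wordProd_mem)
        (subset_subsystem Ω hl.1)⟩
      rw [wordProd_cons, rootRefl_map (inv_mem hl.2.wordProd_mem), inv_inv]
      simp only [mul_assoc, mul_inv_cancel_left]
      rw [← mul_assoc, rootRefl_mul_self, one_mul]
    · obtain ⟨h1, h2, h3, h4⟩ := ih hl.2 q hq
      refine ⟨isWord_cons.mpr ⟨hl.1, h1⟩, by simp [← h2], ?_, h4⟩
      rw [wordProd_cons, wordProd_cons, h3, mul_assoc]

/-- The positive roots that `w` makes negative. -/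
def inversions (Ω : Set (Vec n)) (w : Vec n ≃ₗ[ℂ] Vec n) : Set (Vec n) :=
  {β ∈ Pos Ω | -w β ∈ Pos Ω}

/-- `s_α` changes the sign of no positive root except `α`, so `w` and `s_α w` can differ in their
inversions only at `w⁻¹ α`. -/
theorem SimpleSystem.inversions_refl_mul (h : SimpleSystem Ω) {w : Vec n ≃ₗ[ℂ] Vec n}
    (hw : w ∈ reflGroup Ω) {α : Vec n} (hα : α ∈ Ω) (hpos : w⁻¹ α ∈ Pos Ω) :
    inversions Ω (rootRefl α * w) = insert (w⁻¹ α) (inversions Ω w) := by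
  have hwα : w (w⁻¹ α) = α := by rw [← LinearEquiv.mul_apply, mul_inv_cancel]; rfl
  have hiso := h.nonisotropic α (subset_subsystem Ω hα)
  ext β
  rw [Set.mem_insert_iff]
  constructor
  · rintro ⟨h1, h2⟩
    by_cases hβ : β = w⁻¹ α
    · exact Or.inl hβ
    · refine Or.inr ⟨h1, ?_⟩
      rw [← h.not_pos_iff (map_mem_subsystem hw h1.1)]
      intro h3
      refine h.not_neg_pos (h.rootRefl_pos hα h3 fun h4 => hβ ?_) h2
      rw [← h4, ← LinearEquiv.mul_apply, inv_mul_cancel]; rfl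
  · rintro (rfl | ⟨h1, h2⟩)
    · refine ⟨hpos, ?_⟩
      rw [LinearEquiv.mul_apply, hwα, rootRefl_self hiso, neg_neg]
      exact simple_pos hα
    · refine ⟨h1, ?_⟩
      rw [LinearEquiv.mul_apply, ← map_neg]
      refine h.rootRefl_pos hα h2 fun h4 => h.not_neg_pos hpos ?_
      rw [← h4, map_neg, neg_neg, ← LinearEquiv.mul_apply, inv_mul_cancel]
      exact h1

theorem SimpleSystem.inversions_one (h : SimpleSystem Ω) :
    inversions Ω (1 : Vec n ≃ₗ[ℂ] Vec n) = ∅ :=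
  Set.eq_empty_of_forall_notMem fun _ hβ => h.not_neg_pos hβ.1 hβ.2

/-- The roots of a reduced word are the inversions of its element, each occurring once. -/
theorem SimpleSystem.invList_spec (h : SimpleSystem Ω) {l : List (Vec n)} (hl : IsReduced Ω l) :
    (invList l).Nodup ∧ ∀ β, β ∈ invList l ↔ β ∈ inversions Ω (wordProd l) := by
  induction l with
  | nil => simp [invList, deletions, wordProd_nil, h.inversions_one]
  | cons α l ih =>
    obtain ⟨ih1, ih2⟩ := ih hl.tail
    have hα := (isWord_cons.mp hl.1).1
    have hlw := hl.tail.1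
    have hw := hlw.wordProd_mem
    have hwα : wordProd l ((wordProd l)⁻¹ α) = α := by
      rw [← LinearEquiv.mul_apply, mul_inv_cancel]; rfl
    -- The exchange argument: otherwise the negative of this root is an inversion of the tail, so it
    -- belongs to a letter of the tail. Deleting that letter gives a word for `s_α` times the tail
    -- that is shorter than the given reduced one.
    have hpos : (wordProd l)⁻¹ α ∈ Pos Ω := by
      by_contra hneg
      rw [h.not_pos_iff (map_mem_subsystem (inv_mem hw) (subset_subsystem Ω hα))] at hneg
      have hin : -(wordProd l)⁻¹ α ∈ inversions Ω (wordProd l) :=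
        ⟨hneg, by rw [map_neg, neg_neg, hwα]; exact simple_pos hα⟩
      rw [← ih2, invList, List.mem_map] at hin
      obtain ⟨p, hp, hp'⟩ := hin
      obtain ⟨h1, h2, h3, -⟩ := deletions_spec hlw p hp
      rw [hp', rootRefl_neg, rootRefl_map (inv_mem hw), inv_inv, mul_assoc, mul_inv_cancel_left,
        ← wordProd_cons] at h3
      have h4 := weylLength_le h1
      rw [h3, ← hl.2, List.length_cons] at h4
      omega
    rw [invList_cons, wordProd_cons, h.inversions_refl_mul hw hα hpos]
    refine ⟨List.nodup_cons.mpr ⟨fun h1 => ?_, ih1⟩, fun β => ?_⟩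
    · have h2 := ((ih2 _).mp h1).2
      rw [hwα] at h2
      exact h.not_neg_pos (simple_pos hα) h2
    · rw [List.mem_cons, Set.mem_insert_iff, ih2]

theorem SimpleSystem.inversions_finite (h : SimpleSystem Ω) (w : Vec n ≃ₗ[ℂ] Vec n) :
    (inversions Ω w).Finite := h.pos_finite.subset fun _ hβ => hβ.1

/-- The length is the number of inversions. -/
theorem SimpleSystem.weylLength_eq (h : SimpleSystem Ω) {w : Vec n ≃ₗ[ℂ] Vec n}
    (hw : w ∈ reflGroup Ω) : weylLength Ω w = (inversions Ω w).ncard := by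
  classical
  obtain ⟨l, hl, rfl⟩ := exists_isReduced hw
  obtain ⟨h1, h2⟩ := h.invList_spec hl
  have : inversions Ω (wordProd l) = ((invList l).toFinset : Set (Vec n)) := by
    ext β; simp [h2]
  rw [this, Set.ncard_coe_finset, List.toFinset_card_of_nodup h1, length_invList, hl.2]

theorem SimpleSystem.weylLength_refl_mul (h : SimpleSystem Ω) {w : Vec n ≃ₗ[ℂ] Vec n}
    (hw : w ∈ reflGroup Ω) {α : Vec n} (hα : α ∈ Ω) (hpos : w⁻¹ α ∈ Pos Ω) :
    weylLength Ω (rootRefl α * w) = weylLength Ω w + 1 := by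
  rw [h.weylLength_eq hw, h.weylLength_eq (mul_mem (rootRefl_mem hα) hw),
    h.inversions_refl_mul hw hα hpos, Set.ncard_insert_of_notMem _ (h.inversions_finite w)]
  rintro ⟨-, h1⟩
  rw [← LinearEquiv.mul_apply, mul_inv_cancel] at h1
  exact h.not_neg_pos (simple_pos hα) h1

theorem SimpleSystem.weylLength_refl_mul_of_neg (h : SimpleSystem Ω) {w : Vec n ≃ₗ[ℂ] Vec n}
    (hw : w ∈ reflGroup Ω) {α : Vec n} (hα : α ∈ Ω) (hneg : w⁻¹ α ∉ Pos Ω) :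
    weylLength Ω (rootRefl α * w) + 1 = weylLength Ω w := by
  have hiso := h.nonisotropic α (subset_subsystem Ω hα)
  have hw' := mul_mem (rootRefl_mem hα) hw
  have := h.weylLength_refl_mul hw' hα (by
    rw [mul_inv_rev, rootRefl_inv, LinearEquiv.mul_apply, rootRefl_self hiso, map_neg]
    exact (h.not_pos_iff (map_mem_subsystem (inv_mem hw) (subset_subsystem Ω hα))).mp hneg)
  rw [← mul_assoc, rootRefl_mul_self, one_mul] at this
  exact this.symm

theorem SimpleSystem.weylLength_mul_refl (h : SimpleSystem Ω) {w : Vec n ≃ₗ[ℂ] Vec n}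
    (hw : w ∈ reflGroup Ω) {α : Vec n} (hα : α ∈ Ω) (hpos : w α ∈ Pos Ω) :
    weylLength Ω (w * rootRefl α) = weylLength Ω w + 1 := by
  rw [← weylLength_inv (mul_mem hw (rootRefl_mem hα)), mul_inv_rev, rootRefl_inv,
    h.weylLength_refl_mul (inv_mem hw) hα (by rwa [inv_inv]), weylLength_inv hw]

theorem SimpleSystem.weylLength_mul_refl_of_neg (h : SimpleSystem Ω) {w : Vec n ≃ₗ[ℂ] Vec n}
    (hw : w ∈ reflGroup Ω) {α : Vec n} (hα : α ∈ Ω) (hneg : w α ∉ Pos Ω) :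
    weylLength Ω (w * rootRefl α) + 1 = weylLength Ω w := by
  rw [← weylLength_inv (mul_mem hw (rootRefl_mem hα)), mul_inv_rev, rootRefl_inv,
    h.weylLength_refl_mul_of_neg (inv_mem hw) hα (by rwa [inv_inv]), weylLength_inv hw]

theorem eq_one_of_weylLength {w : Vec n ≃ₗ[ℂ] Vec n}
    (hw : w ∈ reflGroup Ω) (h0 : weylLength Ω w = 0) : w = 1 := by
  obtain ⟨l, hl, rfl⟩ := exists_isReduced hw
  rw [← hl.2, List.length_eq_zero_iff] at h0
  rw [h0, wordProd_nil]

/-- The last letter `α` of a reduced word of `w` works: if `w α` were positive, `w s_α` would be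
longer than `w`. The last letter is obtained as the first letter of a reduced word of `w⁻¹`. -/
theorem SimpleSystem.exists_neg (h : SimpleSystem Ω) {w : Vec n ≃ₗ[ℂ] Vec n}
    (hw : w ∈ reflGroup Ω) (h1 : w ≠ 1) : ∃ α ∈ Ω, w α ∉ Pos Ω := by
  obtain ⟨l, hl, hl'⟩ := exists_isReduced (inv_mem hw)
  cases l with
  | nil => exact absurd (inv_eq_one.mp hl'.symm) h1
  | cons α l =>
    have hα := (isWord_cons.mp hl.1).1
    refine ⟨α, hα, fun hpos => ?_⟩
    have h2 := h.weylLength_refl_mul (inv_mem hw) hα (by rwa [inv_inv])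
    rw [← hl', wordProd_cons, ← mul_assoc, rootRefl_mul_self, one_mul, ← wordProd_cons, ← hl.2,
      ← hl.tail.2, List.length_cons] at h2
    omega

/-- The sign character of `reflGroup Ω`. -/
def sgn (Ω : Set (Vec n)) (w : Vec n ≃ₗ[ℂ] Vec n) : ℂ := (-1) ^ weylLength Ω w

theorem SimpleSystem.sgn_refl_mul (h : SimpleSystem Ω) {w : Vec n ≃ₗ[ℂ] Vec n}
    (hw : w ∈ reflGroup Ω) {α : Vec n} (hα : α ∈ Ω) : sgn Ω (rootRefl α * w) = -sgn Ω w := by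
  by_cases hpos : w⁻¹ α ∈ Pos Ω
  · rw [sgn, sgn, h.weylLength_refl_mul hw hα hpos, pow_succ, mul_neg_one]
  · rw [sgn, sgn, ← h.weylLength_refl_mul_of_neg hw hα hpos, pow_succ, mul_neg_one, neg_neg]

end

/-! ### The longest element -/

section

variable {Ω : Set (Vec n)}

theorem SimpleSystem.exists_isLongest (h : SimpleSystem Ω) {A : Set (Vec n ≃ₗ[ℂ] Vec n)}
    (hA : A ⊆ reflGroup Ω) (hne : A.Nonempty) : ∃ g, IsLongest Ω A g := by
  have : Finite (reflGroup Ω) := h.finiteGroup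
  have hfin : A.Finite := (Set.toFinite (reflGroup Ω : Set (Vec n ≃ₗ[ℂ] Vec n))).subset hA
  obtain ⟨g, hg, hg'⟩ := hfin.exists_maximalFor (weylLength Ω) A hne
  exact ⟨g, hg, fun k hk => (le_total _ _).elim id fun h1 => hg' hk h1⟩

theorem SimpleSystem.isLongest_longest (h : SimpleSystem Ω) :
    IsLongest Ω (reflGroup Ω) (longest Ω) :=
  Classical.epsilon_spec (h.exists_isLongest (subset_refl _) ⟨1, one_mem _⟩)

theorem SimpleSystem.longest_mem (h : SimpleSystem Ω) : longest Ω ∈ reflGroup Ω :=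
  h.isLongest_longest.1

/-- If `w` sends `Ω` to elements of the cone of `Θ`, then it sends the cone of `Ω` there. -/
theorem map_cone {Θ : Set (Vec n)} (w : Vec n →ₗ[ℂ] Vec n)
    (hw : ∀ α ∈ Θ, w α ∈ Submodule.span NNReal Ω) {β : Vec n}
    (hβ : β ∈ Submodule.span NNReal Θ) : w β ∈ Submodule.span NNReal Ω := by
  induction hβ using Submodule.span_induction with
  | mem α h => exact hw α h
  | zero => rw [map_zero]; exact zero_mem _
  | add x y _ _ hx hy => rw [map_add]; exact add_mem hx hy
  | smul a x _ hx =>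
    have : a • x = ((a : ℝ) : ℂ) • x := rfl
    rw [this, map_smul]
    exact Submodule.smul_mem _ a hx

/-- A simple root with positive image would make `w s_α` longer than `w`. So all simple roots, and
with them their cone, go to negatives. -/
theorem SimpleSystem.longest_neg (h : SimpleSystem Ω) {w : Vec n ≃ₗ[ℂ] Vec n}
    (hw : IsLongest Ω (reflGroup Ω) w) {β : Vec n} (hβ : β ∈ Pos Ω) : -w β ∈ Pos Ω := by
  refine ⟨h.neg_mem (map_mem_subsystem hw.1 hβ.1), ?_⟩
  refine map_cone (-w.toLinearMap) (fun α hα => ?_) hβ.2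
  have : w α ∉ Pos Ω := fun hpos => by
    have h1 := hw.2 _ (mul_mem hw.1 (rootRefl_mem hα))
    rw [h.weylLength_mul_refl hw.1 hα hpos] at h1
    omega
  exact ((h.not_pos_iff (map_mem_subsystem hw.1 (subset_subsystem Ω hα))).mp this).2

/-- The map `β ↦ -w₀ β` permutes the positive roots and carries the inversions of `w w₀` onto the
positive roots that are not inversions of `w`. -/
theorem SimpleSystem.weylLength_mul_longest (h : SimpleSystem Ω) {w w₀ : Vec n ≃ₗ[ℂ] Vec n}
    (hw₀ : IsLongest Ω (reflGroup Ω) w₀) (hw : w ∈ reflGroup Ω) :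
    weylLength Ω (w * w₀) + weylLength Ω w = weylLength Ω w₀ := by
  have h0 : inversions Ω w₀ = Pos Ω :=
    Set.Subset.antisymm (fun _ h => h.1) fun β hβ => ⟨hβ, h.longest_neg hw₀ hβ⟩
  have hneg : ∀ β, -w₀ β ∈ Pos Ω → β ∈ Pos Ω := fun β hβ => by
    by_contra hn
    have hβ' : β ∈ subsystem Ω := by
      have := map_mem_subsystem (inv_mem hw₀.1) (h.neg_mem hβ.1)
      rwa [neg_neg, ← LinearEquiv.mul_apply, inv_mul_cancel] at this
    have h1 := h.longest_neg hw₀ ((h.not_pos_iff hβ').mp hn)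
    rw [map_neg] at h1
    exact h.not_neg_pos hβ h1
  have himg : (fun β => -w₀ β) '' inversions Ω (w * w₀) = Pos Ω \ inversions Ω w := by
    ext γ
    constructor
    · rintro ⟨β, ⟨h1, h2⟩, rfl⟩
      refine ⟨h.longest_neg hw₀ h1, fun h3 => ?_⟩
      have h4 := h3.2
      rw [map_neg] at h4
      exact h.not_neg_pos h2 h4
    · rintro ⟨h1, h2⟩
      have e : w₀ (w₀⁻¹ γ) = γ := by
        rw [← LinearEquiv.mul_apply, mul_inv_cancel]; rfl
      have e' : -w₀ (-w₀⁻¹ γ) = γ := by rw [map_neg, neg_neg, e]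
      refine ⟨-w₀⁻¹ γ, ⟨hneg _ (e'.symm ▸ h1), ?_⟩, e'⟩
      rw [LinearEquiv.mul_apply, ← map_neg, e']
      by_contra h3
      exact h2 ⟨h1, (h.not_pos_iff (map_mem_subsystem hw h1.1)).mp h3⟩
  have hinj : Function.Injective fun β => -w₀ β := neg_injective.comp w₀.injective
  have hcard := congrArg Set.ncard himg
  rw [Set.ncard_image_of_injective _ hinj, Set.ncard_sdiff (fun _ h => h.1)
    (h.inversions_finite w)] at hcard
  have hle := Set.ncard_le_ncard (s := inversions Ω w) (fun _ h => h.1) h.pos_finite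
  rw [h.weylLength_eq (mul_mem hw hw₀.1), h.weylLength_eq hw, h.weylLength_eq hw₀.1, h0, hcard]
  omega

/-- Complementation of lengths, applied to `w w'⁻¹`, leaves this element length zero. -/
theorem SimpleSystem.isLongest_unique (h : SimpleSystem Ω) {w w' : Vec n ≃ₗ[ℂ] Vec n}
    (hw : IsLongest Ω (reflGroup Ω) w) (hw' : IsLongest Ω (reflGroup Ω) w') : w = w' := by
  have h1 := h.weylLength_mul_longest hw' (mul_mem hw.1 (inv_mem hw'.1))
  rw [inv_mul_cancel_right, le_antisymm (hw'.2 _ hw.1) (hw.2 _ hw'.1)] at h1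
  exact mul_inv_eq_one.mp (eq_one_of_weylLength (mul_mem hw.1 (inv_mem hw'.1)) (by omega))

/-! ### Standard parabolic subgroups -/

variable {Θ : Set (Vec n)}

theorem SimpleSystem.mem_pos_sub (h : SimpleSystem Ω) (hΘ : Θ ⊆ Ω) {β : Vec n} :
    β ∈ Pos Θ ↔ β ∈ Pos Ω ∧ β ∈ subsystem Θ := by
  constructor
  · exact fun hβ => ⟨⟨subsystem_mono hΘ hβ.1, Submodule.span_mono hΘ hβ.2⟩, hβ.1⟩
  · rintro ⟨h1, h2⟩
    refine ⟨h2, cone_of_span h.linearIndependent h1.2 ?_⟩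
    rw [Set.inter_eq_right.mpr hΘ]
    exact subsystem_subset_span h2

/-- A simple reflection of `Θ` makes only its own root negative, and that root belongs to the
subsystem of `Θ`. -/
theorem SimpleSystem.map_pos_of_notMem (h : SimpleSystem Ω) (hΘ : Θ ⊆ Ω)
    {g : Vec n ≃ₗ[ℂ] Vec n} (hg : g ∈ reflGroup Θ) {β : Vec n} (hβ : β ∈ Pos Ω)
    (hβ' : β ∉ subsystem Θ) : g β ∈ Pos Ω ∧ g β ∉ subsystem Θ := by
  refine ⟨?_, fun h1 => hβ' ?_⟩
  · obtain ⟨l, hl, rfl⟩ := exists_word hg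
    induction l with
    | nil => exact hβ
    | cons α l ih =>
      rw [isWord_cons] at hl
      rw [wordProd_cons, LinearEquiv.mul_apply]
      refine h.rootRefl_pos (hΘ hl.1) (ih hl.2 hl.2.wordProd_mem) fun h2 => hβ' ?_
      have := map_mem_subsystem (inv_mem hl.2.wordProd_mem)
        (h2.symm ▸ subset_subsystem Θ hl.1 : wordProd l β ∈ subsystem Θ)
      rwa [← LinearEquiv.mul_apply, inv_mul_cancel] at this
  · have := map_mem_subsystem (inv_mem hg) h1
    rwa [← LinearEquiv.mul_apply, inv_mul_cancel] at this

/-- A positive root outside the subsystem of `Θ` stays positive under the longest element of its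
group, which however sends the cone of `Θ` to its negative. -/
theorem SimpleSystem.mem_subsystem_of_cone (h : SimpleSystem Ω) (hΘ : Θ ⊆ Ω) {β : Vec n}
    (hβ : β ∈ subsystem Ω) (hβ' : β ∈ Submodule.span NNReal Θ) : β ∈ subsystem Θ := by
  by_contra hn
  have hΘs := h.mono hΘ
  have hpos : β ∈ Pos Ω := ⟨hβ, Submodule.span_mono hΘ hβ'⟩
  have h1 := (h.map_pos_of_notMem hΘ hΘs.longest_mem hpos hn).1
  have h2 : -longest Θ β ∈ Submodule.span NNReal Ω :=
    Submodule.span_mono hΘ (map_cone (-(longest Θ).toLinearMap)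
      (fun α hα => (hΘs.longest_neg hΘs.isLongest_longest (simple_pos hα)).2) hβ')
  exact h.ne_zero h1.1 (cone_pointed h.linearIndependent h1.2 h2)

theorem SimpleSystem.inversions_sub (h : SimpleSystem Ω) (hΘ : Θ ⊆ Ω)
    {g : Vec n ≃ₗ[ℂ] Vec n} (hg : g ∈ reflGroup Θ) : inversions Θ g = inversions Ω g := by
  ext β
  constructor
  · exact fun hβ => ⟨((h.mem_pos_sub hΘ).mp hβ.1).1, ((h.mem_pos_sub hΘ).mp hβ.2).1⟩
  · rintro ⟨h1, h2⟩
    have h3 : β ∈ subsystem Θ := by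
      by_contra h3
      exact h.not_neg_pos (h.map_pos_of_notMem hΘ hg h1 h3).1 h2
    exact ⟨(h.mem_pos_sub hΘ).mpr ⟨h1, h3⟩,
      (h.mem_pos_sub hΘ).mpr ⟨h2, (h.mono hΘ).neg_mem (map_mem_subsystem hg h3)⟩⟩

theorem SimpleSystem.weylLength_sub (h : SimpleSystem Ω) (hΘ : Θ ⊆ Ω)
    {g : Vec n ≃ₗ[ℂ] Vec n} (hg : g ∈ reflGroup Θ) : weylLength Θ g = weylLength Ω g := by
  rw [h.weylLength_eq (reflGroup_mono hΘ hg), (h.mono hΘ).weylLength_eq hg,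
    h.inversions_sub hΘ hg]

theorem SimpleSystem.isReduced_sub (h : SimpleSystem Ω) (hΘ : Θ ⊆ Ω) {l : List (Vec n)}
    (hl : IsReduced Θ l) : IsReduced Ω l :=
  ⟨fun α hα => hΘ (hl.1 α hα), by rw [hl.2, h.weylLength_sub hΘ hl.1.wordProd_mem]⟩

/-! ### Dominant vectors and stabilizers -/

/-- Nonnegativity in the lexicographic order of `ℂ`. -/
def LexNonneg (z : ℂ) : Prop := 0 < z.re ∨ (z.re = 0 ∧ 0 ≤ z.im)

theorem LexNonneg.zero : LexNonneg 0 := Or.inr ⟨rfl, le_rfl⟩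

theorem LexNonneg.add {z w : ℂ} (hz : LexNonneg z) (hw : LexNonneg w) : LexNonneg (z + w) := by
  unfold LexNonneg at *
  rw [Complex.add_re, Complex.add_im]
  rcases hz with h | ⟨h, h'⟩ <;> rcases hw with h1 | ⟨h1, h1'⟩
  · exact Or.inl (add_pos h h1)
  · exact Or.inl (by linarith)
  · exact Or.inl (by linarith)
  · exact Or.inr ⟨by linarith, by linarith⟩

theorem LexNonneg.eq_zero {z : ℂ} (hz : LexNonneg z) (hz' : LexNonneg (-z)) : z = 0 := by
  unfold LexNonneg at *
  rw [Complex.neg_re, Complex.neg_im] at hz'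
  refine Complex.ext ?_ ?_
  · rcases hz with h | ⟨h, h'⟩ <;> rcases hz' with h1 | ⟨h1, h1'⟩ <;> rw [Complex.zero_re] <;>
      linarith
  · rcases hz with h | ⟨h, h'⟩ <;> rcases hz' with h1 | ⟨h1, h1'⟩ <;> rw [Complex.zero_im] <;>
      linarith

theorem LexNonneg.add_eq_zero {z w : ℂ} (hz : LexNonneg z) (hw : LexNonneg w)
    (h : z + w = 0) : z = 0 ∧ w = 0 := by
  have h1 : w = -z := by rw [eq_neg_iff_add_eq_zero, add_comm, h]
  have h2 : z = 0 := hz.eq_zero (h1 ▸ hw)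
  exact ⟨h2, by rw [h1, h2, neg_zero]⟩

theorem lexNonneg_or_neg (z : ℂ) : LexNonneg z ∨ LexNonneg (-z) := by
  unfold LexNonneg
  rw [Complex.neg_re, Complex.neg_im]
  rcases lt_trichotomy z.re 0 with h | h | h
  · exact Or.inr (Or.inl (by linarith))
  · rcases le_total 0 z.im with h1 | h1
    · exact Or.inl (Or.inr ⟨h, h1⟩)
    · exact Or.inr (Or.inr ⟨by linarith, by linarith⟩)
  · exact Or.inl (Or.inl h)

theorem LexNonneg.smul {z : ℂ} (hz : LexNonneg z) (a : NNReal) : LexNonneg ((a : ℝ) * z) := by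
  rcases eq_or_lt_of_le a.2 with h | h
  · have : a = 0 := NNReal.eq h.symm
    rw [this]; simpa using LexNonneg.zero
  · have h' : (0 : ℝ) < a := h
    unfold LexNonneg at *
    rw [Complex.re_ofReal_mul, Complex.im_ofReal_mul]
    rcases hz with h1 | ⟨h1, h2⟩
    · exact Or.inl (mul_pos h' h1)
    · exact Or.inr ⟨by rw [h1, mul_zero], by positivity⟩

/-- `u` is dominant, with respect to the lexicographic order of `ℂ`. -/
def IsDominant (Ω : Set (Vec n)) (u : Vec n) : Prop := ∀ α ∈ Ω, LexNonneg (α ⬝ᵥ u)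

theorem IsDominant.cone {u : Vec n} (hu : IsDominant Ω u) {β : Vec n}
    (hβ : β ∈ Submodule.span NNReal Ω) :
    LexNonneg (β ⬝ᵥ u) ∧ (β ⬝ᵥ u = 0 → β ∈ Submodule.span NNReal (rootsAt Ω u)) := by
  induction hβ using Submodule.span_induction with
  | mem α h => exact ⟨hu α h, fun h1 => Submodule.subset_span ⟨h, h1⟩⟩
  | zero => exact ⟨by rw [zero_dotProduct]; exact LexNonneg.zero, fun _ => zero_mem _⟩
  | add x y _ _ hx hy =>
    rw [add_dotProduct]
    refine ⟨hx.1.add hy.1, fun h => ?_⟩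
    obtain ⟨h1, h2⟩ := hx.1.add_eq_zero hy.1 h
    exact add_mem (hx.2 h1) (hy.2 h2)
  | smul a x _ hx =>
    have e : a • x = ((a : ℝ) : ℂ) • x := rfl
    rw [e, smul_dotProduct, smul_eq_mul]
    refine ⟨hx.1.smul a, fun h => ?_⟩
    rcases mul_eq_zero.mp h with h | h
    · rw [h, zero_smul]; exact zero_mem _
    · exact Submodule.smul_mem _ a (hx.2 h)

theorem fixes_of_mem_reflGroup_rootsAt {S : Set (Vec n)} {u : Vec n} {g : Vec n ≃ₗ[ℂ] Vec n}
    (hg : g ∈ reflGroup (rootsAt S u)) : g u = u := by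
  induction hg using Subgroup.closure_induction'' with
  | one => rfl
  | mem g hg => obtain ⟨α, hα, rfl⟩ := hg; exact rootRefl_of_dotProduct_eq_zero hα.2
  | inv_mem g hg =>
    obtain ⟨α, hα, rfl⟩ := hg; rw [rootRefl_inv]; exact rootRefl_of_dotProduct_eq_zero hα.2
  | mul g k _ _ hg hk => rw [LinearEquiv.mul_apply, hk, hg]

theorem dotProduct_eq_zero_of_mem_subsystem {S : Set (Vec n)} {u : Vec n} {β : Vec n}
    (hβ : β ∈ subsystem (rootsAt S u)) : β ⬝ᵥ u = 0 := by
  obtain ⟨g, hg, α, hα, rfl⟩ := hβ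
  rw [map_dotProduct hg, fixes_of_mem_reflGroup_rootsAt (inv_mem hg)]
  exact hα.2

theorem rootsAt_subset (S : Set (Vec n)) (u : Vec n) : rootsAt S u ⊆ S := fun _ h => h.1

/-- The generating subset in the definition can always be taken to be the set of all simple roots
that vanish at `u`. -/
theorem IsStandard.rootsAt_eq {u : Vec n} (hu : IsStandard Ω u) :
    rootsAt (subsystem Ω) u = subsystem (rootsAt Ω u) := by
  obtain ⟨T, hT, hT'⟩ := hu
  refine Set.Subset.antisymm ?_ fun β hβ =>
    ⟨subsystem_mono (rootsAt_subset Ω u) hβ, dotProduct_eq_zero_of_mem_subsystem hβ⟩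
  rw [hT']
  refine subsystem_mono fun α hα => ⟨hT hα, ?_⟩
  have : α ∈ rootsAt (subsystem Ω) u := hT' ▸ subset_subsystem T hα
  exact this.2

theorem SimpleSystem.isStandard_of_isDominant (h : SimpleSystem Ω) {u : Vec n}
    (hu : IsDominant Ω u) : IsStandard Ω u := by
  refine ⟨rootsAt Ω u, rootsAt_subset Ω u, Set.Subset.antisymm ?_ fun β hβ =>
    ⟨subsystem_mono (rootsAt_subset Ω u) hβ, dotProduct_eq_zero_of_mem_subsystem hβ⟩⟩
  rintro β ⟨hβ, hβ'⟩
  have key : ∀ γ ∈ Pos Ω, γ ⬝ᵥ u = 0 → γ ∈ subsystem (rootsAt Ω u) := fun γ hγ h0 =>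
    h.mem_subsystem_of_cone (rootsAt_subset Ω u) hγ.1 ((hu.cone hγ.2).2 h0)
  rcases h.pos_or_neg hβ with h1 | h1
  · exact key β h1 hβ'
  · have := (h.mono (rootsAt_subset Ω u)).neg_mem (key _ h1 (by rw [neg_dotProduct, hβ', neg_zero]))
    rwa [neg_neg] at this

/-- The values `α ⬝ᵥ u` are complex, so dominance uses a total order compatible with addition and
nonnegative real scaling. A `g` that minimizes the number of positive roots with negative value at
`g u` works, since reflecting in a simple root of negative value lowers this number. -/
theorem SimpleSystem.exists_isDominant (h : SimpleSystem Ω) (u : Vec n) :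
    ∃ g ∈ reflGroup Ω, IsDominant Ω (g u) := by
  have : Finite (reflGroup Ω) := h.finiteGroup
  let N : Vec n → Set (Vec n) := fun x => {β ∈ Pos Ω | ¬ LexNonneg (β ⬝ᵥ x)}
  have hN : ∀ x, (N x).Finite := fun x => h.pos_finite.subset fun _ h => h.1
  obtain ⟨g, hg, hmin⟩ := (Set.toFinite (reflGroup Ω : Set (Vec n ≃ₗ[ℂ] Vec n))).exists_minimalFor
    (fun g => (N (g u)).ncard) _ ⟨1, one_mem _⟩
  refine ⟨g, hg, fun α hα => ?_⟩
  by_contra hneg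
  have hlt : (N ((rootRefl α * g) u)).ncard < (N (g u)).ncard := by
    rw [← Set.ncard_image_of_injective _ (rootRefl α).injective]
    refine Set.ncard_lt_ncard ⟨?_, fun hsub => ?_⟩ (hN _)
    · rintro _ ⟨β, ⟨h1, h2⟩, rfl⟩
      have h2' : ¬ LexNonneg (rootRefl α β ⬝ᵥ g u) := by
        rwa [LinearEquiv.mul_apply, ← dotProduct_rootRefl α, rootRefl_rootRefl] at h2
      refine ⟨h.rootRefl_pos hα h1 ?_, h2'⟩
      rintro rfl
      rw [rootRefl_self (h.nonisotropic β h1.1), neg_dotProduct] at h2'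
      exact (lexNonneg_or_neg _).elim hneg h2'
    · obtain ⟨β, ⟨h1, -⟩, h2⟩ := hsub (a := α) ⟨simple_pos hα, hneg⟩
      have h3 : β = -α := by
        have h4 := congrArg (rootRefl α) h2
        rwa [rootRefl_rootRefl, rootRefl_self (h.nonisotropic α (subset_subsystem Ω hα))] at h4
      exact h.not_neg_pos (simple_pos hα) (h3 ▸ h1)
  exact absurd (hmin (mul_mem (rootRefl_mem hα) hg) hlt.le) (not_le.mpr hlt)

theorem SimpleSystem.exists_isStandard (h : SimpleSystem Ω) (u : Vec n) :
    ∃ g ∈ reflGroup Ω, IsStandard Ω (g u) :=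
  let ⟨g, hg, hg'⟩ := h.exists_isDominant u
  ⟨g, hg, h.isStandard_of_isDominant hg'⟩

/-- If `g` fixes `u` and makes the simple root `α` negative, then `α ⬝ᵥ u = g α ⬝ᵥ u` has both signs
and vanishes. So `s_α` fixes `u`, and `g s_α` is a shorter element fixing `u`. -/
theorem SimpleSystem.stabilizer_of_isDominant (h : SimpleSystem Ω) {u : Vec n}
    (hu : IsDominant Ω u) : ∀ k : ℕ, ∀ g ∈ reflGroup Ω, weylLength Ω g = k → g u = u →
      g ∈ reflGroup (rootsAt Ω u) := by
  intro k
  induction k with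
  | zero =>
    intro g hg hk _
    rw [eq_one_of_weylLength hg hk]
    exact one_mem _
  | succ k ih =>
    intro g hg hk hgu
    have hne : g ≠ 1 := by
      rintro rfl
      rw [weylLength_one] at hk
      omega
    obtain ⟨α, hα, hneg⟩ := h.exists_neg hg hne
    have h1 := (h.not_pos_iff (map_mem_subsystem hg (subset_subsystem Ω hα))).mp hneg
    have h2 : g α ⬝ᵥ u = α ⬝ᵥ u := by
      conv_lhs => rw [← hgu]
      exact dotProduct_map_map hg α u
    have h3 := (hu.cone h1.2).1
    rw [neg_dotProduct, h2] at h3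
    have h0 : α ∈ rootsAt Ω u := ⟨hα, (hu α hα).eq_zero h3⟩
    have h4 := h.weylLength_mul_refl_of_neg hg hα hneg
    have h5 := ih (g * rootRefl α) (mul_mem hg (rootRefl_mem hα)) (by omega)
      (by rw [LinearEquiv.mul_apply, rootRefl_of_dotProduct_eq_zero h0.2, hgu])
    have := mul_mem h5 (rootRefl_mem h0)
    rwa [mul_assoc, rootRefl_mul_self, mul_one] at this

/-- The stabilizer of a standard vector is generated by the simple reflections that it contains. -/
theorem SimpleSystem.stabilizer (h : SimpleSystem Ω) {u : Vec n} (hu : IsStandard Ω u)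
    {g : Vec n ≃ₗ[ℂ] Vec n} (hg : g ∈ reflGroup Ω) (hgu : g u = u) :
    g ∈ reflGroup (rootsAt Ω u) := by
  obtain ⟨k, hk, hdom⟩ := h.exists_isDominant u
  have h1 : k * g * k⁻¹ ∈ reflGroup (rootsAt Ω (k u)) := by
    refine h.stabilizer_of_isDominant hdom _ _ (mul_mem (mul_mem hk hg) (inv_mem hk)) rfl ?_
    rw [← LinearEquiv.mul_apply, inv_mul_cancel_right, LinearEquiv.mul_apply, hgu]
  -- Conjugation turns `s_α` into the reflection in `k⁻¹ α`, a root that vanishes at `u` but need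
  -- not be simple. Standardness of `u` puts it in the subsystem of the simple roots at `u`.
  have key : ∀ x ∈ reflGroup (rootsAt Ω (k u)), k⁻¹ * x * k ∈ reflGroup (rootsAt Ω u) := by
    intro x hx
    have hgen : ∀ α ∈ rootsAt Ω (k u), k⁻¹ * rootRefl α * k ∈ reflGroup (rootsAt Ω u) := by
      intro α hα
      have e := rootRefl_map (inv_mem hk) α
      rw [inv_inv] at e
      rw [← e]
      refine rootRefl_mem_of_mem_subsystem ?_
      rw [← hu.rootsAt_eq]
      refine ⟨map_mem_subsystem (inv_mem hk) (subset_subsystem Ω hα.1), ?_⟩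
      rw [map_dotProduct (inv_mem hk), inv_inv]
      exact hα.2
    induction hx using Subgroup.closure_induction'' with
    | one => rw [mul_one, inv_mul_cancel]; exact one_mem _
    | mem x hx => obtain ⟨α, hα, rfl⟩ := hx; exact hgen α hα
    | inv_mem x hx => obtain ⟨α, hα, rfl⟩ := hx; rw [rootRefl_inv]; exact hgen α hα
    | mul x y _ _ hx hy =>
      have := mul_mem hx hy
      simp only [mul_assoc, mul_inv_cancel_left] at this ⊢
      exact this
  have := key _ h1
  rwa [← mul_assoc, ← mul_assoc, inv_mul_cancel, one_mul, inv_mul_cancel_right] at this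

/-! ### Minimal length representatives -/

theorem SimpleSystem.minRep_pos (h : SimpleSystem Ω) {u : Vec n} {g : Vec n ≃ₗ[ℂ] Vec n}
    (hg : g ∈ minReps Ω u) {α : Vec n} (hα : α ∈ rootsAt Ω u) : g α ∈ Pos Ω := by
  by_contra hneg
  have h1 := hg.2 _ (rootRefl_mem hα.1) (rootRefl_of_dotProduct_eq_zero hα.2)
  have h2 := h.weylLength_mul_refl_of_neg hg.1 hα.1 hneg
  omega

/-- Each letter that lengthens `x` inside the group of `Θ` also lengthens `g x`: the relevant root
is a nonnegative combination of `Θ`, and `g` sends it to a positive root. -/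
theorem SimpleSystem.weylLength_mul_of_pos (h : SimpleSystem Ω) (hΘ : Θ ⊆ Ω)
    {g : Vec n ≃ₗ[ℂ] Vec n} (hg : g ∈ reflGroup Ω) (hpos : ∀ α ∈ Θ, g α ∈ Pos Ω) :
    ∀ k : ℕ, ∀ x ∈ reflGroup Θ, weylLength Θ x = k →
      weylLength Ω (g * x) = weylLength Ω g + k := by
  intro k
  induction k with
  | zero =>
    intro x hx hk
    rw [eq_one_of_weylLength hx hk, mul_one, add_zero]
  | succ k ih =>
    intro x hx hk
    have hΘs := h.mono hΘ
    have hne : x ≠ 1 := by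
      rintro rfl
      rw [weylLength_one] at hk
      omega
    obtain ⟨α, hα, hneg⟩ := hΘs.exists_neg hx hne
    have h1 := hΘs.weylLength_mul_refl_of_neg hx hα hneg
    have hx' := mul_mem hx (rootRefl_mem hα)
    have h2 := ih _ hx' (by omega)
    have h3 : (x * rootRefl α) α ∈ Pos Θ := by
      rw [LinearEquiv.mul_apply, rootRefl_self (hΘs.nonisotropic α (subset_subsystem Θ hα)),
        map_neg]
      exact (hΘs.not_pos_iff (map_mem_subsystem hx (subset_subsystem Θ hα))).mp hneg
    have h4 : (g * (x * rootRefl α)) α ∈ Pos Ω :=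
      ⟨map_mem_subsystem (mul_mem hg (reflGroup_mono hΘ hx'))
        (subset_subsystem Ω (hΘ hα)),
        map_cone g.toLinearMap (fun β hβ => (hpos β hβ).2) h3.2⟩
    have h5 := h.weylLength_mul_refl (mul_mem hg (reflGroup_mono hΘ hx')) (hΘ hα) h4
    rw [h2, mul_assoc, mul_assoc, rootRefl_mul_self, mul_one] at h5
    omega

/-- A longest one among the minimal length representatives of `W/W_u`, times the longest element of
`W_u`, is the longest element of `W`. -/
theorem SimpleSystem.longest_minRep (h : SimpleSystem Ω) {u : Vec n} (hu : IsStandard Ω u)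
    {g : Vec n ≃ₗ[ℂ] Vec n} (hg : IsLongest Ω (minReps Ω u) g) :
    g * longest (rootsAt Ω u) = longest Ω ∧
      weylLength Ω (g * longest (rootsAt Ω u)) =
        weylLength Ω g + weylLength Ω (longest (rootsAt Ω u)) := by
  set Θ := rootsAt Ω u with hΘdef
  have hΘ : Θ ⊆ Ω := rootsAt_subset Ω u
  have hΘs := h.mono hΘ
  have hy := hΘs.longest_mem
  have hy' := reflGroup_mono hΘ hy
  have hadd := h.weylLength_mul_of_pos hΘ hg.1.1 (fun α hα => h.minRep_pos hg.1 hα) _ _ hy rfl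
  rw [h.weylLength_sub hΘ hy] at hadd
  refine ⟨?_, hadd⟩
  -- The expected value of `g`. It sends `Θ` to positive roots, hence is a minimal representative.
  -- Maximality of `g` then makes `g` times the longest element of `Θ` at least as long as `ω₀`, and
  -- the longest element is unique.
  set k := longest Ω * (longest Θ)⁻¹ with hk
  have hkW : k ∈ reflGroup Ω := mul_mem h.longest_mem (inv_mem hy')
  have hkpos : ∀ α ∈ Θ, k α ∈ Pos Ω := by
    intro α hα
    have h1 : -(longest Θ)⁻¹ α ∈ Pos Θ := by
      have hs := map_mem_subsystem (inv_mem hy) (subset_subsystem Θ hα)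
      refine (hΘs.not_pos_iff hs).mp fun h2 => ?_
      have h3 := hΘs.longest_neg hΘs.isLongest_longest h2
      rw [← LinearEquiv.mul_apply, mul_inv_cancel] at h3
      exact hΘs.not_neg_pos (simple_pos hα) h3
    have h2 := h.longest_neg h.isLongest_longest ((h.mem_pos_sub hΘ).mp h1).1
    rwa [map_neg, neg_neg] at h2
  have hkadd := h.weylLength_mul_of_pos hΘ hkW hkpos _ _ hy rfl
  rw [hk, inv_mul_cancel_right, ← hk, h.weylLength_sub hΘ hy] at hkadd
  have hkmin : k ∈ minReps Ω u := by
    refine ⟨hkW, fun x hx hxu => ?_⟩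
    rw [h.weylLength_mul_of_pos hΘ hkW hkpos _ _ (h.stabilizer hu hx hxu) rfl]
    omega
  refine h.isLongest_unique ⟨mul_mem hg.1.1 hy', fun x hx => ?_⟩ h.isLongest_longest
  have h1 := h.isLongest_longest.2 x hx
  have h2 := hg.2 k hkmin
  omega

end

/-! ### Linear forms and the action of linear automorphisms -/

theorem eval_linForm (α x : Vec n) : eval x (linForm α) = α ⬝ᵥ x := by
  simp [linForm, dotProduct]

theorem linForm_add (α β : Vec n) : linForm (α + β) = linForm α + linForm β :=
  MvPolynomial.funext fun x => by rw [map_add, eval_linForm, eval_linForm, eval_linForm,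
    add_dotProduct]

theorem linForm_smul (c : ℂ) (α : Vec n) : linForm (c • α) = C c * linForm α :=
  MvPolynomial.funext fun x => by
    rw [map_mul, eval_linForm, eval_linForm, smul_dotProduct, eval_C, smul_eq_mul]

theorem linForm_neg (α : Vec n) : linForm (-α) = -linForm α :=
  MvPolynomial.funext fun x => by rw [map_neg, eval_linForm, eval_linForm, neg_dotProduct]

theorem linForm_sub (α β : Vec n) : linForm (α - β) = linForm α - linForm β := by
  rw [sub_eq_add_neg, linForm_add, linForm_neg, sub_eq_add_neg]

theorem linForm_single (i : Fin n) : linForm (Pi.single i 1) = X i :=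
  MvPolynomial.funext fun x => by rw [eval_linForm, eval_X, single_one_dotProduct]

theorem linForm_injective : Function.Injective (linForm : Vec n → Poly n) := fun α β h => by
  refine dotProduct_eq α β fun x => ?_
  rw [← eval_linForm, h, eval_linForm]

theorem linForm_ne_zero {α : Vec n} (h : α ≠ 0) : linForm α ≠ 0 := fun h0 => h <| by
  refine linForm_injective (h0.trans ?_)
  have := linForm_smul (0 : ℂ) α
  rwa [zero_smul, C_0, zero_mul, eq_comm] at this

theorem eval_polyAct (g : Vec n ≃ₗ[ℂ] Vec n) (f : Poly n) (x : Vec n) :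
    eval x (polyAct g f) = eval (g⁻¹ x) f := by
  change eval x (pull (g⁻¹ : Vec n ≃ₗ[ℂ] Vec n).toLinearMap 0 f) = _
  rw [eval_pull, add_zero]; rfl

theorem eval_polyShift (z : Vec n) (f : Poly n) (x : Vec n) :
    eval x (polyShift z f) = eval (x + z) f := by
  change eval x (pull LinearMap.id z f) = _
  rw [eval_pull]; rfl

theorem polyAct_mul (g k : Vec n ≃ₗ[ℂ] Vec n) (f : Poly n) :
    polyAct (g * k) f = polyAct g (polyAct k f) :=
  MvPolynomial.funext fun x => by
    rw [eval_polyAct, eval_polyAct, eval_polyAct, mul_inv_rev, LinearEquiv.mul_apply]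

theorem polyAct_one (f : Poly n) : polyAct 1 f = f :=
  MvPolynomial.funext fun x => by rw [eval_polyAct, inv_one]; rfl

theorem polyAct_linForm {S : Set (Vec n)} {g : Vec n ≃ₗ[ℂ] Vec n} (hg : g ∈ reflGroup S)
    (α : Vec n) : polyAct g (linForm α) = linForm (g α) :=
  MvPolynomial.funext fun x => by
    rw [eval_polyAct, eval_linForm, eval_linForm, map_dotProduct hg]

theorem polyAct_rootRefl_linForm (α β : Vec n) :
    polyAct (rootRefl α) (linForm β) = linForm (rootRefl α β) :=
  polyAct_linForm (rootRefl_mem (Set.mem_singleton α)) β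

/-- The inclusion of `Λ` in `L`. -/
abbrev emb : Poly n →+* RatFn n := algebraMap (Poly n) (RatFn n)

theorem emb_injective : Function.Injective (emb : Poly n → RatFn n) :=
  IsFractionRing.injective (Poly n) (RatFn n)

theorem emb_ne_zero {p : Poly n} (h : p ≠ 0) : emb p ≠ 0 := fun h0 =>
  h (emb_injective (h0.trans (map_zero emb).symm))

theorem emb_C_mul (c : ℂ) (F : RatFn n) : emb (C c) * F = c • F := by
  rw [Algebra.smul_def]; rfl

theorem ratAct_emb (g : Vec n ≃ₗ[ℂ] Vec n) (p : Poly n) :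
    ratAct g (emb p) = emb (polyAct g p) := extendRat_algebraMap _ _

theorem ratAct_mul (g k : Vec n ≃ₗ[ℂ] Vec n) (F : RatFn n) :
    ratAct (g * k) F = ratAct g (ratAct k F) := by
  have : ratAct (g * k) = ratAct g * ratAct k := ratAlgEquiv_ext fun p => by
    rw [AlgEquiv.mul_apply, ratAct_emb, ratAct_emb, ratAct_emb, polyAct_mul]
  rw [this]; rfl

theorem ratAct_one (F : RatFn n) : ratAct 1 F = F := by
  have : ratAct (1 : Vec n ≃ₗ[ℂ] Vec n) = 1 := ratAlgEquiv_ext fun p => by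
    rw [ratAct_emb, polyAct_one]; rfl
  rw [this]; rfl

theorem ratAct_rootRefl_rootRefl (α : Vec n) (F : RatFn n) :
    ratAct (rootRefl α) (ratAct (rootRefl α) F) = F := by
  rw [← ratAct_mul, rootRefl_mul_self, ratAct_one]

/-- The linear form of a vector, as an element of `L`. -/
def lin (α : Vec n) : RatFn n := emb (linForm α)

theorem lin_ne_zero {α : Vec n} (h : α ≠ 0) : lin α ≠ 0 := emb_ne_zero (linForm_ne_zero h)

theorem ratAct_lin {S : Set (Vec n)} {g : Vec n ≃ₗ[ℂ] Vec n} (hg : g ∈ reflGroup S)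
    (α : Vec n) : ratAct g (lin α) = lin (g α) := by
  rw [lin, ratAct_emb, polyAct_linForm hg]; rfl

theorem lin_neg (α : Vec n) : lin (-α) = -lin α := by rw [lin, linForm_neg, map_neg]; rfl

/-- Makes the group elements distinct multiplicative characters of `L`, as Dedekind's independence
theorem requires. -/
theorem ratAct_injective {S : Set (Vec n)} {g k : Vec n ≃ₗ[ℂ] Vec n} (hg : g ∈ reflGroup S)
    (hk : k ∈ reflGroup S) (h : ∀ F : RatFn n, ratAct g F = ratAct k F) : g = k := by
  refine LinearEquiv.ext fun v => linForm_injective (emb_injective ?_)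
  have := h (lin v)
  rwa [ratAct_lin hg, ratAct_lin hk] at this

/-! ### Divided differences on `L` -/

/-- The twisted derivation `∇_α F = (F - s_α F)/α` on `L`. -/
def nablaRat (α : Vec n) : RatFn n →ₗ[ℂ] RatFn n :=
  LinearMap.mulLeft ℂ (lin α)⁻¹ ∘ₗ (LinearMap.id - (ratAct (rootRefl α)).toLinearMap)

theorem nablaRat_apply (α : Vec n) (F : RatFn n) :
    nablaRat α F = (lin α)⁻¹ * (F - ratAct (rootRefl α) F) := rfl

/-- For a linear first factor the divided difference is a scalar, so iterating the rule produces
only scalar multiples of shorter words. -/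
theorem nablaRat_leibniz {α : Vec n} (h : α ⬝ᵥ α ≠ 0) (v : Vec n) (F : RatFn n) :
    nablaRat α (lin v * F) =
      (2 * (α ⬝ᵥ v) / (α ⬝ᵥ α)) • F + lin (rootRefl α v) * nablaRat α F := by
  have hα : lin α ≠ 0 := lin_ne_zero fun h0 => h (by rw [h0, dotProduct_zero])
  have e : lin v - lin (rootRefl α v) = emb (C (2 * (α ⬝ᵥ v) / (α ⬝ᵥ α))) * lin α := by
    rw [lin, lin, lin, ← map_sub, ← linForm_sub, rootRefl_apply, sub_sub_cancel, linForm_smul,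
      map_mul]
  have e' := sub_eq_iff_eq_add.mp e
  rw [nablaRat_apply, nablaRat_apply, map_mul, ratAct_lin (rootRefl_mem (Set.mem_singleton α)),
    ← emb_C_mul, e']
  field_simp
  ring

theorem nablaRat_invariant_mul {α : Vec n} {G : RatFn n} (hG : ratAct (rootRefl α) G = G)
    (F : RatFn n) : nablaRat α (G * F) = G * nablaRat α F := by
  rw [nablaRat_apply, nablaRat_apply, map_mul, hG]; ring

theorem ratAct_nablaRat {α : Vec n} (h : α ⬝ᵥ α ≠ 0) (F : RatFn n) :
    ratAct (rootRefl α) (nablaRat α F) = nablaRat α F := by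
  rw [nablaRat_apply, map_mul, map_inv₀, ratAct_lin (rootRefl_mem (Set.mem_singleton α)),
    rootRefl_self h, lin_neg, map_sub, ratAct_rootRefl_rootRefl]
  have hα : lin α ≠ 0 := lin_ne_zero fun h0 => h (by rw [h0, dotProduct_zero])
  field_simp
  ring

theorem nablaRat_ratAct (α : Vec n) (F : RatFn n) :
    nablaRat α (ratAct (rootRefl α) F) = -nablaRat α F := by
  rw [nablaRat_apply, nablaRat_apply, ratAct_rootRefl_rootRefl]
  ring

theorem nablaRat_nablaRat {α : Vec n} (h : α ⬝ᵥ α ≠ 0) (F : RatFn n) :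
    nablaRat α (nablaRat α F) = 0 := by
  rw [nablaRat_apply, ratAct_nablaRat h, sub_self, mul_zero]

/-- The composition of the twisted derivations of the letters of a word. -/
def wordOp : List (Vec n) → RatFn n →ₗ[ℂ] RatFn n
  | [] => LinearMap.id
  | α :: l => nablaRat α ∘ₗ wordOp l

theorem wordOp_cons (α : Vec n) (l : List (Vec n)) (F : RatFn n) :
    wordOp (α :: l) F = nablaRat α (wordOp l F) := rfl

theorem wordOp_append (l m : List (Vec n)) (F : RatFn n) :
    wordOp (l ++ m) F = wordOp l (wordOp m F) := by
  induction l with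
  | nil => rfl
  | cons α l ih => rw [List.cons_append, wordOp_cons, wordOp_cons, ih]

section

variable {Ω : Set (Vec n)}

theorem wordOp_invariant_mul {l : List (Vec n)} (hl : IsWord Ω l) {G : RatFn n}
    (hG : ∀ α ∈ Ω, ratAct (rootRefl α) G = G) (F : RatFn n) :
    wordOp l (G * F) = G * wordOp l F := by
  induction l with
  | nil => rfl
  | cons α l ih =>
    rw [isWord_cons] at hl
    rw [wordOp_cons, ih hl.2, nablaRat_invariant_mul (hG α hl.1), wordOp_cons]

/-- At most one letter can differentiate `v`, since the result is a scalar and comes out of all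
later operators. The terms are thus the full word and its one-letter deletions. -/
theorem SimpleSystem.wordOp_leibniz (h : SimpleSystem Ω) {l : List (Vec n)} (hl : IsWord Ω l)
    (v : Vec n) (F : RatFn n) :
    wordOp l (lin v * F) = lin (wordProd l v) * wordOp l F +
      ((deletions l).map fun p => (2 * (p.1 ⬝ᵥ v) / (p.1 ⬝ᵥ p.1)) • wordOp p.2 F).sum := by
  induction l with
  | nil => simp [wordOp, deletions, wordProd_nil]
  | cons α l ih =>
    rw [isWord_cons] at hl
    have hw := hl.2.wordProd_mem
    have h1 : (wordProd l)⁻¹ α ⬝ᵥ v = α ⬝ᵥ wordProd l v := by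
      rw [map_dotProduct (inv_mem hw), inv_inv]
    have h2 : (wordProd l)⁻¹ α ⬝ᵥ (wordProd l)⁻¹ α = α ⬝ᵥ α := dotProduct_map_map (inv_mem hw) _ _
    rw [wordOp_cons, ih hl.2, map_add,
      nablaRat_leibniz (h.nonisotropic α (subset_subsystem Ω hl.1)), map_list_sum, deletions,
      List.map_cons, List.sum_cons, List.map_map, List.map_map, wordProd_cons, h1, h2,
      LinearEquiv.mul_apply, wordOp_cons]
    have h3 : (nablaRat α ∘ fun p : Vec n × List (Vec n) =>
        (2 * (p.1 ⬝ᵥ v) / (p.1 ⬝ᵥ p.1)) • wordOp p.2 F) =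
        (fun p : Vec n × List (Vec n) => (2 * (p.1 ⬝ᵥ v) / (p.1 ⬝ᵥ p.1)) • wordOp p.2 F) ∘
          fun p => (p.1, α :: p.2) := by
      funext p
      simp only [Function.comp_apply, map_smul, wordOp_cons]
    rw [h3]
    abel

/-! ### Independence of the reduced word -/

theorem wordOp_cons_one (α : Vec n) (l : List (Vec n)) : wordOp (α :: l) (1 : RatFn n) = 0 := by
  induction l generalizing α with
  | nil => rw [wordOp_cons]; change nablaRat α 1 = 0; rw [nablaRat_apply, map_one, sub_self, mul_zero]
  | cons β l ih => rw [wordOp_cons, ih, map_zero]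

/-- A linear operator on `L` that is semilinear over `Λ` with respect to `w` and kills `1`
vanishes. -/
theorem eq_zero_of_semilinear (E : RatFn n →ₗ[ℂ] RatFn n) {S : Set (Vec n)}
    {w : Vec n ≃ₗ[ℂ] Vec n} (hw : w ∈ reflGroup S)
    (hE : ∀ v F, E (lin v * F) = lin (w v) * E F) (h1 : E 1 = 0) : E = 0 := by
  have key : ∀ (p : Poly n) (F : RatFn n), E (emb p * F) = ratAct w (emb p) * E F := by
    intro p
    induction p using MvPolynomial.induction_on with
    | C a =>
      intro F
      rw [emb_C_mul, map_smul, ratAct_emb, ← algebraMap_eq, AlgEquiv.commutes, algebraMap_eq,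
        emb_C_mul]
    | add p q hp hq =>
      intro F
      rw [map_add, add_mul, map_add, hp, hq, map_add, add_mul]
    | mul_X p i hp =>
      intro F
      rw [map_mul emb, mul_assoc, hp, ← linForm_single]
      change _ * E (lin _ * F) = _
      rw [hE, map_mul, mul_assoc, ← ratAct_lin hw]
      rfl
  refine LinearMap.ext fun F => ?_
  obtain ⟨p, q, hq, rfl⟩ := IsFractionRing.div_surjective (A := Poly n) F
  have hq0 : emb q ≠ 0 := emb_ne_zero (nonZeroDivisors.ne_zero hq)
  -- `E(p) = w(q) E(p/q)`, while also `E(p) = w(p) E(1) = 0`.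
  have h2 := key q (emb p / emb q)
  rw [mul_div_cancel₀ _ hq0, ← mul_one (emb p), key p, h1, mul_zero] at h2
  rcases mul_eq_zero.mp h2.symm with h3 | h3
  · exact absurd h3 ((map_ne_zero_iff _ (ratAct w).injective).mpr hq0)
  · rw [mul_one] at h3; exact h3

theorem SimpleSystem.exists_reduced_cons (h : SimpleSystem Ω) {α : Vec n} {l : List (Vec n)}
    (hα : α ∈ Ω) (hl : IsReduced Ω l) (hn : ¬ IsReduced Ω (α :: l)) :
    ∃ m, IsReduced Ω (α :: m) ∧ wordProd (α :: m) = wordProd l := by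
  have hw := hl.1.wordProd_mem
  have hneg : (wordProd l)⁻¹ α ∉ Pos Ω := fun hpos => hn ⟨isWord_cons.mpr ⟨hα, hl.1⟩, by
    rw [wordProd_cons, h.weylLength_refl_mul hw hα hpos, List.length_cons, hl.2]⟩
  obtain ⟨m, hm, hm'⟩ := exists_isReduced (mul_mem (rootRefl_mem hα) hw)
  have e : wordProd (α :: m) = wordProd l := by
    rw [wordProd_cons, hm', ← mul_assoc, rootRefl_mul_self, one_mul]
  refine ⟨m, ⟨isWord_cons.mpr ⟨hα, hm.1⟩, ?_⟩, e⟩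
  rw [e, ← h.weylLength_refl_mul_of_neg hw hα hneg, ← hm', ← hm.2, List.length_cons]

/-- Divided differences along reduced words depend on the element of the group only; along
nonreduced words they vanish. -/
theorem SimpleSystem.wordOp_aux (h : SimpleSystem Ω) : ∀ k : ℕ,
    (∀ l l' : List (Vec n), IsReduced Ω l → IsReduced Ω l' → l.length = k →
      wordProd l = wordProd l' → wordOp l = wordOp l') ∧
    (∀ l : List (Vec n), IsWord Ω l → ¬ IsReduced Ω l → l.length = k → wordOp l = 0) := by
  intro k
  induction k with
  | zero =>
    constructor
    · intro l l' hl hl' hk he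
      have : l'.length = 0 := by rw [hl'.2, ← he, ← hl.2, hk]
      rw [List.length_eq_zero_iff.mp hk, List.length_eq_zero_iff.mp this]
    · intro l _ hn hk
      rw [List.length_eq_zero_iff.mp hk] at hn
      exact absurd ⟨isWord_nil, by rw [wordProd_nil, weylLength_one, List.length_nil]⟩ hn
  | succ k ih =>
    obtain ⟨iha, ihb⟩ := ih
    constructor
    · intro l l' hl hl' hk he
      have hk' : l'.length = k + 1 := by rw [hl'.2, ← he, ← hl.2, hk]
      classical
      -- By induction the operator of a deletion depends only on its group element, and vanishes if
      -- the deletion is not reduced. So the correction terms depend on the group element and its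
      -- inversions, not on the word.
      have hdel : ∀ (m : List (Vec n)), IsReduced Ω m → m.length = k + 1 → ∀ v F,
          wordOp m (lin v * F) = lin (wordProd m v) * wordOp m F +
            ((invList m).map fun β => (2 * (β ⬝ᵥ v) / (β ⬝ᵥ β)) •
              (if weylLength Ω (wordProd m * rootRefl β) = k then
                wordOp (reducedWord Ω (wordProd m * rootRefl β)) F else 0)).sum := by
        intro m hm hmk v F
        rw [h.wordOp_leibniz hm.1, invList, List.map_map]
        congr 2
        refine List.map_congr_left fun p hp => ?_
        obtain ⟨h1, h2, h3, h4⟩ := deletions_spec hm.1 p hp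
        have hlen : p.2.length = k := by omega
        simp only [Function.comp_apply]
        rw [← h3]
        by_cases hr : weylLength Ω (wordProd p.2) = k
        · obtain ⟨h5, h6⟩ := reducedWord_spec (Ω := Ω) h1.wordProd_mem
          rw [if_pos hr, iha p.2 _ ⟨h1, by rw [hr, hlen]⟩ h5 hlen h6.symm]
        · rw [if_neg hr, ihb p.2 h1 (fun h5 => hr (by rw [← h5.2, hlen])) hlen]
          rfl
      have hperm : (invList l).Perm (invList l') := by
        obtain ⟨h1, h2⟩ := h.invList_spec hl
        obtain ⟨h3, h4⟩ := h.invList_spec hl'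
        exact (List.perm_ext_iff_of_nodup h1 h3).mpr fun β => by rw [h2, h4, he]
      have hone : ∀ m : List (Vec n), m.length = k + 1 → wordOp m (1 : RatFn n) = 0 := by
        intro m hm
        cases m with
        | nil => simp at hm
        | cons α m => exact wordOp_cons_one α m
      -- The two words have the same inversions, so the correction terms cancel in the difference.
      -- It is therefore semilinear and kills `1`; braid relations never enter.
      refine sub_eq_zero.mp (eq_zero_of_semilinear _ hl.1.wordProd_mem (fun v F => ?_) ?_)
      · rw [LinearMap.sub_apply, LinearMap.sub_apply, hdel l hl hk, hdel l' hl' hk', ← he,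
          (hperm.map _).sum_eq, add_sub_add_right_eq_sub, mul_sub]
      · rw [LinearMap.sub_apply, hone l hk, hone l' hk', sub_zero]
    · intro l hl hn hk
      cases l with
      | nil => simp at hk
      | cons α l =>
        have hl' := isWord_cons.mp hl
        have hlk : l.length = k := by simpa using hk
        -- The operator of a reduced tail may be computed along a word that begins with `α`, and
        -- `∇_α² = 0`. A nonreduced tail gives zero by induction.
        by_cases hr : IsReduced Ω l
        · obtain ⟨m, hm, hm'⟩ := h.exists_reduced_cons hl'.1 hr hn
          have e := iha l (α :: m) hr hm hlk hm'.symm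
          refine LinearMap.ext fun F => ?_
          rw [wordOp_cons, e, wordOp_cons,
            nablaRat_nablaRat (h.nonisotropic α (subset_subsystem Ω hl'.1))]
          rfl
        · refine LinearMap.ext fun F => ?_
          rw [wordOp_cons, ihb l hl'.2 hr hlk, LinearMap.zero_apply, map_zero]

/-- The divided difference of an element of the reflection group, on `L`. -/
def ratDiv (Ω : Set (Vec n)) (w : Vec n ≃ₗ[ℂ] Vec n) : RatFn n →ₗ[ℂ] RatFn n :=
  wordOp (reducedWord Ω w)

theorem SimpleSystem.wordOp_eq_ratDiv (h : SimpleSystem Ω) {l : List (Vec n)}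
    (hl : IsReduced Ω l) : wordOp l = ratDiv Ω (wordProd l) := by
  obtain ⟨h1, h2⟩ := reducedWord_spec (Ω := Ω) hl.1.wordProd_mem
  exact (h.wordOp_aux _).1 l _ hl h1 rfl h2.symm

theorem SimpleSystem.wordOp_eq_zero (h : SimpleSystem Ω) {l : List (Vec n)} (hl : IsWord Ω l)
    (hn : ¬ IsReduced Ω l) : wordOp l = 0 := (h.wordOp_aux _).2 l hl hn rfl

theorem SimpleSystem.ratDiv_mul (h : SimpleSystem Ω) {u w : Vec n ≃ₗ[ℂ] Vec n}
    (hu : u ∈ reflGroup Ω) (hw : w ∈ reflGroup Ω)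
    (hl : weylLength Ω (u * w) = weylLength Ω u + weylLength Ω w) (F : RatFn n) :
    ratDiv Ω u (ratDiv Ω w F) = ratDiv Ω (u * w) F := by
  obtain ⟨l, hl1, rfl⟩ := exists_isReduced hu
  obtain ⟨m, hm1, rfl⟩ := exists_isReduced hw
  rw [← h.wordOp_eq_ratDiv hl1, ← h.wordOp_eq_ratDiv hm1, ← wordOp_append, ← wordProd_append,
    h.wordOp_eq_ratDiv]
  exact ⟨isWord_append.mpr ⟨hl1.1, hm1.1⟩, by
    rw [wordProd_append, hl, ← hl1.2, ← hm1.2, List.length_append]⟩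

theorem SimpleSystem.ratDiv_mul_eq_zero (h : SimpleSystem Ω) {u w : Vec n ≃ₗ[ℂ] Vec n}
    (hu : u ∈ reflGroup Ω) (hw : w ∈ reflGroup Ω)
    (hl : weylLength Ω (u * w) ≠ weylLength Ω u + weylLength Ω w) (F : RatFn n) :
    ratDiv Ω u (ratDiv Ω w F) = 0 := by
  obtain ⟨l, hl1, rfl⟩ := exists_isReduced hu
  obtain ⟨m, hm1, rfl⟩ := exists_isReduced hw
  rw [← h.wordOp_eq_ratDiv hl1, ← h.wordOp_eq_ratDiv hm1, ← wordOp_append,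
    h.wordOp_eq_zero (isWord_append.mpr ⟨hl1.1, hm1.1⟩)]
  · rfl
  · intro hr
    refine hl ?_
    rw [← wordProd_append, ← hr.2, ← hl1.2, ← hm1.2, List.length_append]

theorem ratDiv_invariant_mul {w : Vec n ≃ₗ[ℂ] Vec n}
    (hw : w ∈ reflGroup Ω) {G : RatFn n} (hG : ∀ α ∈ Ω, ratAct (rootRefl α) G = G)
    (F : RatFn n) : ratDiv Ω w (G * F) = G * ratDiv Ω w F :=
  wordOp_invariant_mul (reducedWord_spec hw).1.1 hG F

theorem SimpleSystem.ratDiv_sub (h : SimpleSystem Ω) {Θ : Set (Vec n)} (hΘ : Θ ⊆ Ω)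
    {w : Vec n ≃ₗ[ℂ] Vec n} (hw : w ∈ reflGroup Θ) : ratDiv Θ w = ratDiv Ω w := by
  obtain ⟨l, hl, rfl⟩ := exists_isReduced hw
  rw [← (h.mono hΘ).wordOp_eq_ratDiv hl, h.wordOp_eq_ratDiv (h.isReduced_sub hΘ hl)]

theorem SimpleSystem.ratDiv_rootRefl (h : SimpleSystem Ω) {α : Vec n} (hα : α ∈ Ω) :
    ratDiv Ω (rootRefl α) = nablaRat α := by
  have hr : IsReduced Ω [α] := by
    by_contra hn
    obtain ⟨m, hm, hm'⟩ := h.exists_reduced_cons hα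
      ⟨isWord_nil, by rw [wordProd_nil, weylLength_one, List.length_nil]⟩ hn
    have := hm.2
    rw [hm', wordProd_nil, weylLength_one] at this
    simp at this
  have := h.wordOp_eq_ratDiv hr
  rw [wordProd_cons, wordProd_nil, mul_one] at this
  exact this.symm

end

/-! ### Products of linear forms -/

/-- The product of the linear forms of the elements of a set of vectors. -/
abbrev prodLin (A : Set (Vec n)) : Poly n := ∏ᶠ α ∈ A, linForm α

theorem prodLin_ne_zero {A : Set (Vec n)} (h : ∀ α ∈ A, α ≠ 0) : prodLin A ≠ 0 :=
  finprod_mem_induction (· ≠ (0 : Poly n)) one_ne_zero (fun _ _ => mul_ne_zero) fun α hα =>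
    linForm_ne_zero (h α hα)

theorem eval_prodLin_ne_zero {A : Set (Vec n)} {v : Vec n} (h : ∀ α ∈ A, α ⬝ᵥ v ≠ 0) :
    eval v (prodLin A) ≠ 0 :=
  finprod_mem_induction (fun p : Poly n => eval v p ≠ 0) (by simp)
    (fun _ _ h1 h2 => by rw [map_mul]; exact mul_ne_zero h1 h2) fun α hα => by
      rw [eval_linForm]; exact h α hα

theorem polyAct_prodLin {S A : Set (Vec n)} (hA : A.Finite) {g : Vec n ≃ₗ[ℂ] Vec n}
    (hg : g ∈ reflGroup S) (h : ∀ α ∈ A, g α ∈ A) : polyAct g (prodLin A) = prodLin A := by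
  have e : polyAct g (prodLin A) = ∏ᶠ α ∈ A, polyAct g (linForm α) :=
    MonoidHom.map_finprod_mem linForm (polyAct g : Poly n →* Poly n) hA
  rw [e]
  refine finprod_mem_eq_of_bijOn g ⟨h, g.injective.injOn, ?_⟩ fun α _ => polyAct_linForm hg α
  refine (Set.eq_of_subset_of_ncard_le (Set.image_subset_iff.mpr h) ?_ hA).ge
  rw [Set.ncard_image_of_injective _ g.injective]

theorem prodLin_insert {A : Set (Vec n)} (hA : A.Finite) {α : Vec n} (h : α ∉ A) :
    prodLin (insert α A) = linForm α * prodLin A := finprod_mem_insert _ h hA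

theorem prodLin_union {A B : Set (Vec n)} (hA : A.Finite) (hB : B.Finite) (h : Disjoint A B) :
    prodLin (A ∪ B) = prodLin A * prodLin B := finprod_mem_union h hA hB

/-! ### The Vandermonde product and the sign -/

section

variable {Ω : Set (Vec n)}

theorem ratAct_smul (g : Vec n ≃ₗ[ℂ] Vec n) (c : ℂ) (F : RatFn n) :
    ratAct g (c • F) = c • ratAct g F := (ratAct g).toLinearMap.map_smul c F

theorem sgn_one : sgn Ω (1 : Vec n ≃ₗ[ℂ] Vec n) = 1 := by rw [sgn, weylLength_one, pow_zero]

theorem sgn_mul_self (w : Vec n ≃ₗ[ℂ] Vec n) : sgn Ω w * sgn Ω w = 1 := by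
  rw [sgn, ← mul_pow]; simp

theorem SimpleSystem.polyAct_vandermonde_of_simple (h : SimpleSystem Ω) {α : Vec n}
    (hα : α ∈ Ω) : polyAct (rootRefl α) (vandermonde Ω) = -vandermonde Ω := by
  have hfin : (Pos Ω \ {α}).Finite := h.pos_finite.subset Set.sdiff_subset
  have hs : insert α (Pos Ω \ {α}) = Pos Ω := by
    rw [Set.insert_sdiff_singleton, Set.insert_eq_of_mem (simple_pos hα)]
  have e : vandermonde Ω = linForm α * prodLin (Pos Ω \ {α}) := by
    rw [← prodLin_insert hfin (by simp), hs]; rfl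
  rw [e, map_mul, polyAct_prodLin hfin (rootRefl_mem hα), polyAct_linForm (rootRefl_mem hα),
    rootRefl_self (h.nonisotropic α (subset_subsystem Ω hα)), linForm_neg, neg_mul]
  rintro β ⟨hβ, hne⟩
  refine ⟨h.rootRefl_pos hα hβ hne, fun h1 => ?_⟩
  have h2 := congrArg (rootRefl α) (Set.mem_singleton_iff.mp h1)
  rw [rootRefl_rootRefl, rootRefl_self (h.nonisotropic α (subset_subsystem Ω hα))] at h2
  exact h.not_neg_pos (simple_pos hα) (h2 ▸ hβ)

theorem vandermonde_eq (Ω : Set (Vec n)) : vandermonde Ω = prodLin (Pos Ω) := rfl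

theorem SimpleSystem.vandermonde_ne_zero (h : SimpleSystem Ω) : vandermonde Ω ≠ 0 :=
  prodLin_ne_zero fun _ hα => h.ne_zero hα.1

theorem SimpleSystem.ratAct_vandermonde (h : SimpleSystem Ω) {w : Vec n ≃ₗ[ℂ] Vec n}
    (hw : w ∈ reflGroup Ω) :
    ratAct w (emb (vandermonde Ω)) = sgn Ω w • emb (vandermonde Ω) := by
  obtain ⟨l, hl, rfl⟩ := exists_word hw
  clear hw
  induction l with
  | nil => rw [wordProd_nil, ratAct_one, sgn_one, one_smul]
  | cons α l ih =>
    rw [isWord_cons] at hl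
    rw [wordProd_cons, ratAct_mul, ih hl.2, h.sgn_refl_mul hl.2.wordProd_mem hl.1, ratAct_smul,
      ratAct_emb, h.polyAct_vandermonde_of_simple hl.1, map_neg, smul_neg, neg_smul]

/-! ### The divided difference of the longest element -/

/-- Multiplying out the factors `(1 - s_α)/α` gives an `L`-combination of group elements. For a
reduced word the top element arises only by choosing the reflection in every factor, which
determines its coefficient. -/
theorem wordOp_expansion [Fintype (reflGroup Ω)] (h : SimpleSystem Ω) {l : List (Vec n)}
    (hl : IsWord Ω l) :
    ∃ c : reflGroup Ω → RatFn n, (∀ F, wordOp l F = ∑ u, c u * ratAct u F) ∧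
      (∀ u : reflGroup Ω, l.length < weylLength Ω u → c u = 0) ∧
      (IsReduced Ω l → c ⟨wordProd l, hl.wordProd_mem⟩ =
        ratAct (wordProd l) ((invList l).map lin).prod⁻¹) := by
  classical
  induction l with
  | nil =>
    refine ⟨fun u => if u = 1 then 1 else 0, fun F => ?_, fun u hu => ?_, fun _ => ?_⟩
    · simp [wordOp, ratAct_one]
    · refine if_neg ?_
      rintro rfl
      rw [Subgroup.coe_one, weylLength_one] at hu
      simp at hu
    · simp [wordProd_nil, ratAct_one, invList, deletions]
  | cons α l ih =>
    have hl' := isWord_cons.mp hl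
    obtain ⟨c, h1, h2, h3⟩ := ih hl'.2
    obtain ⟨s, hs⟩ : ∃ s : reflGroup Ω, (s : Vec n ≃ₗ[ℂ] Vec n) = rootRefl α :=
      ⟨⟨_, rootRefl_mem hl'.1⟩, rfl⟩
    refine ⟨fun u => (lin α)⁻¹ * (c u - ratAct (rootRefl α) (c (s * u))), fun F => ?_,
      fun u hu => ?_, fun hr => ?_⟩
    · rw [wordOp_cons, nablaRat_apply, h1, map_sum]
      have : ∑ u : reflGroup Ω, ratAct (rootRefl α) (c u * ratAct u F) =
          ∑ u : reflGroup Ω, ratAct (rootRefl α) (c (s * u)) * ratAct u F := by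
        rw [← Equiv.sum_comp (Equiv.mulLeft s)]
        refine Finset.sum_congr rfl fun u _ => ?_
        rw [Equiv.coe_mulLeft, map_mul, ← ratAct_mul, Subgroup.coe_mul, hs, ← mul_assoc,
          rootRefl_mul_self, one_mul]
      rw [this, ← Finset.sum_sub_distrib, Finset.mul_sum]
      exact Finset.sum_congr rfl fun u _ => by rw [← sub_mul, mul_assoc]
    · rw [List.length_cons] at hu
      have hlen : weylLength Ω u ≤ weylLength Ω (s * u : reflGroup Ω) + 1 := by
        by_cases hpos : (u : Vec n ≃ₗ[ℂ] Vec n)⁻¹ α ∈ Pos Ω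
        · have := h.weylLength_refl_mul u.2 hl'.1 hpos
          rw [Subgroup.coe_mul, hs]; omega
        · have := h.weylLength_refl_mul_of_neg u.2 hl'.1 hpos
          rw [Subgroup.coe_mul, hs]; omega
      change (lin α)⁻¹ * (c u - ratAct (rootRefl α) (c (s * u))) = 0
      rw [h2 u (by omega), h2 (s * u) (by omega), map_zero, sub_zero, mul_zero]
    · have e : s * ⟨wordProd (α :: l), hl.wordProd_mem⟩ = ⟨wordProd l, hl'.2.wordProd_mem⟩ :=
        Subtype.ext (by
          rw [Subgroup.coe_mul, hs]
          change rootRefl α * wordProd (α :: l) = wordProd l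
          rw [wordProd_cons, ← mul_assoc, rootRefl_mul_self, one_mul])
      have h0 : l.length < weylLength Ω (wordProd (α :: l)) := by
        rw [← hr.2, List.length_cons]; omega
      simp only [e]
      rw [h2 _ h0, h3 hr.tail, zero_sub, invList_cons, List.map_cons, List.prod_cons,
        wordProd_cons, ratAct_mul, mul_inv, map_mul, map_mul, map_inv₀ _ (lin _),
        ratAct_lin hl'.2.wordProd_mem]
      have e' : wordProd l ((wordProd l)⁻¹ α) = α := by
        rw [← LinearEquiv.mul_apply, mul_inv_cancel]; rfl
      rw [e', map_inv₀ _ (lin _), ratAct_lin (rootRefl_mem hl'.1),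
        rootRefl_self (h.nonisotropic α (subset_subsystem Ω hl'.1)), lin_neg]
      have hα := lin_ne_zero (h.ne_zero (subset_subsystem Ω hl'.1))
      field_simp

/-- Antisymmetrization with respect to `reflGroup Ω`. -/
def antisym (Ω : Set (Vec n)) [Fintype (reflGroup Ω)] (F : RatFn n) : RatFn n :=
  ∑ u : reflGroup Ω, sgn Ω u • ratAct u F

theorem SimpleSystem.ratAct_antisym [Fintype (reflGroup Ω)] (h : SimpleSystem Ω) {α : Vec n}
    (hα : α ∈ Ω) (F : RatFn n) : ratAct (rootRefl α) (antisym Ω F) = -antisym Ω F := by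
  let s : reflGroup Ω := ⟨rootRefl α, rootRefl_mem hα⟩
  have : antisym Ω F = ∑ u : reflGroup Ω, sgn Ω (s * u : reflGroup Ω) •
      ratAct (s * u : reflGroup Ω) F :=
    (Equiv.sum_comp (Equiv.mulLeft s) fun u : reflGroup Ω => sgn Ω u • ratAct u F).symm
  rw [this, ← Finset.sum_neg_distrib, ← this, antisym, map_sum]
  refine Finset.sum_congr rfl fun u _ => ?_
  rw [Subgroup.coe_mul, h.sgn_refl_mul u.2 hα, ratAct_smul, neg_smul, neg_neg, ratAct_mul]

/-- Every simple `α` can be the last letter of a reduced word of `ω₀`, so `∂_{ω₀}` factors through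
`∇_α`, which changes sign when its argument is reflected. -/
theorem SimpleSystem.ratDiv_longest_ratAct (h : SimpleSystem Ω) {w : Vec n ≃ₗ[ℂ] Vec n}
    (hw : w ∈ reflGroup Ω) (F : RatFn n) :
    ratDiv Ω (longest Ω) (ratAct w F) = sgn Ω w • ratDiv Ω (longest Ω) F := by
  obtain ⟨l, hl, rfl⟩ := exists_word hw
  clear hw
  induction l generalizing F with
  | nil => rw [wordProd_nil, ratAct_one, sgn_one, one_smul]
  | cons α l ih =>
    rw [isWord_cons] at hl
    have hW := h.longest_mem
    have hs := rootRefl_mem hl.1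
    have hneg : longest Ω α ∉ Pos Ω := fun h1 =>
      h.not_neg_pos h1 (h.longest_neg h.isLongest_longest (simple_pos hl.1))
    have hlen := h.weylLength_mul_refl_of_neg hW hl.1 hneg
    have h1 : weylLength Ω (rootRefl α) = 1 := by
      have := h.weylLength_mul_refl (one_mem _) hl.1 (simple_pos hl.1)
      rwa [one_mul, weylLength_one, zero_add] at this
    have key : ∀ F, ratDiv Ω (longest Ω) F =
        ratDiv Ω (longest Ω * rootRefl α) (nablaRat α F) := fun F => by
      have e : longest Ω * rootRefl α * rootRefl α = longest Ω := by
        rw [mul_assoc, rootRefl_mul_self, mul_one]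
      rw [← h.ratDiv_rootRefl hl.1, h.ratDiv_mul (mul_mem hW hs) hs, e]
      rw [e, h1, hlen]
    rw [wordProd_cons, ratAct_mul, h.sgn_refl_mul hl.2.wordProd_mem hl.1, neg_smul, key,
      nablaRat_ratAct, map_neg, ← key, ih _ hl.2]

/-- Compute `∂_{ω₀}` of the antisymmetrization of `F` in two ways. Each summand contributes `∂_{ω₀}
F`; on the other hand the antisymmetrization is `Δ` times an invariant, which can be pulled out. -/
theorem SimpleSystem.card_mul_ratDiv_longest [Fintype (reflGroup Ω)] (h : SimpleSystem Ω)
    (F : RatFn n) :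
    (Fintype.card (reflGroup Ω) : RatFn n) * emb (vandermonde Ω) * ratDiv Ω (longest Ω) F =
      ratDiv Ω (longest Ω) (emb (vandermonde Ω)) * antisym Ω F := by
  have hΔ := emb_ne_zero h.vandermonde_ne_zero
  have h1 : ratDiv Ω (longest Ω) (antisym Ω F) =
      (Fintype.card (reflGroup Ω) : RatFn n) * ratDiv Ω (longest Ω) F := by
    rw [antisym, map_sum]
    have : ∀ u : reflGroup Ω, ratDiv Ω (longest Ω) (sgn Ω u • ratAct u F) =
        ratDiv Ω (longest Ω) F := fun u => by
      rw [map_smul, h.ratDiv_longest_ratAct u.2, smul_smul, sgn_mul_self, one_smul]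
    rw [Finset.sum_congr rfl fun u _ => this u, Finset.sum_const, Finset.card_univ,
      nsmul_eq_mul]
  have h2 : antisym Ω F = antisym Ω F / emb (vandermonde Ω) * emb (vandermonde Ω) :=
    (div_mul_cancel₀ _ hΔ).symm
  have h3 : ∀ α ∈ Ω, ratAct (rootRefl α) (antisym Ω F / emb (vandermonde Ω)) =
      antisym Ω F / emb (vandermonde Ω) := fun α hα => by
    rw [map_div₀, h.ratAct_antisym hα, ratAct_emb, h.polyAct_vandermonde_of_simple hα, map_neg]
    exact neg_div_neg_eq _ _
  rw [mul_right_comm, ← h1, h2, ratDiv_invariant_mul h.longest_mem h3, ← h2]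
  field_simp

/-- The identity `|W| Δ ∂_{ω₀} F = ∂_{ω₀}(Δ) ∑ sgn(u) u(F)` is a linear relation between
automorphisms of `L`, so by Dedekind the coefficients of `ω₀` agree. In `∂_{ω₀}` this coefficient is
`ω₀(1/Δ) = sgn(ω₀)/Δ`. -/
theorem SimpleSystem.ratDiv_longest_vandermonde [Fintype (reflGroup Ω)] (h : SimpleSystem Ω) :
    ratDiv Ω (longest Ω) (emb (vandermonde Ω)) = (Fintype.card (reflGroup Ω) : RatFn n) := by
  obtain ⟨hr, hw⟩ := reducedWord_spec (Ω := Ω) h.longest_mem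
  obtain ⟨c, h1, -, h3⟩ := wordOp_expansion h hr.1
  have hΔ := emb_ne_zero h.vandermonde_ne_zero
  have hli := (linearIndependent_monoidHom (RatFn n) (RatFn n)).comp
    (fun u : reflGroup Ω => ((ratAct (u : Vec n ≃ₗ[ℂ] Vec n) : RatFn n →* RatFn n)))
    fun u w huw => Subtype.ext (ratAct_injective u.2 w.2 fun F => DFunLike.congr_fun huw F)
  rw [Fintype.linearIndependent_iff] at hli
  set d := ratDiv Ω (longest Ω) (emb (vandermonde Ω)) with hd
  have h4 := hli (fun u => (Fintype.card (reflGroup Ω) : RatFn n) * emb (vandermonde Ω) * c u -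
      emb (C (sgn Ω u)) * d) (by
    funext F
    rw [Finset.sum_apply]
    have h5 := h.card_mul_ratDiv_longest F
    rw [← hd, ratDiv, h1, antisym, Finset.mul_sum, Finset.mul_sum, ← sub_eq_zero,
      ← Finset.sum_sub_distrib] at h5
    rw [Pi.zero_apply, ← h5]
    refine Finset.sum_congr rfl fun u _ => ?_
    simp only [Pi.smul_apply, Function.comp_apply, smul_eq_mul, ← emb_C_mul]
    change _ * ratAct _ F = _
    ring) ⟨_, hr.1.wordProd_mem⟩
  have hprod : ((invList (reducedWord Ω (longest Ω))).map lin).prod = emb (vandermonde Ω) := by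
    classical
    obtain ⟨h5, h6⟩ := h.invList_spec hr
    rw [← List.prod_toFinset _ h5, vandermonde_eq]
    have h7 : ((invList (reducedWord Ω (longest Ω))).toFinset : Set (Vec n)) = Pos Ω := by
      ext β
      rw [List.coe_toFinset, Set.mem_ofPred_eq, h6, hw]
      exact ⟨fun h => h.1, fun hβ => ⟨hβ, h.longest_neg h.isLongest_longest hβ⟩⟩
    rw [prodLin, ← h7, finprod_mem_coe_finset, map_prod]
    rfl
  rw [h3 hr, hprod] at h4
  have h5 : ratAct (longest Ω) (emb (vandermonde Ω)) =
      emb (C (sgn Ω (longest Ω))) * emb (vandermonde Ω) := by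
    rw [h.ratAct_vandermonde h.longest_mem, emb_C_mul]
  have h6 : emb (C (sgn Ω (longest Ω))) * emb (C (sgn Ω (longest Ω))) = (1 : RatFn n) := by
    rw [← map_mul, ← C_mul, sgn_mul_self, C_1, map_one]
  simp only [hw] at h4
  rw [map_inv₀, h5] at h4
  set e : RatFn n := emb (C (sgn Ω (longest Ω)))
  have he : e ≠ 0 := left_ne_zero_of_mul (h6 ▸ one_ne_zero)
  have h7 : e⁻¹ = e := inv_eq_of_mul_eq_one_left h6
  have h8 : e * ((Fintype.card (reflGroup Ω) : RatFn n) - d) = 0 := by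
    rw [← h4, mul_inv, h7]
    field_simp
  exact (sub_eq_zero.mp ((mul_eq_zero.mp h8).resolve_left he)).symm

theorem SimpleSystem.vandermonde_mul_ratDiv_longest [Fintype (reflGroup Ω)]
    (h : SimpleSystem Ω) (F : RatFn n) :
    emb (vandermonde Ω) * ratDiv Ω (longest Ω) F = antisym Ω F := by
  have h1 := h.card_mul_ratDiv_longest F
  rw [h.ratDiv_longest_vandermonde, mul_assoc] at h1
  exact mul_left_cancel₀ (Nat.cast_ne_zero.mpr Fintype.card_ne_zero) h1

theorem SimpleSystem.ratDiv_longest_eq [Fintype (reflGroup Ω)] (h : SimpleSystem Ω)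
    (F : RatFn n) : ratDiv Ω (longest Ω) F =
      ∑ u : reflGroup Ω, ratAct u (F / emb (vandermonde Ω)) := by
  have hΔ := emb_ne_zero h.vandermonde_ne_zero
  rw [← mul_right_inj' hΔ, h.vandermonde_mul_ratDiv_longest, antisym, Finset.mul_sum]
  refine Finset.sum_congr rfl fun u _ => ?_
  have he : emb (C (sgn Ω u)) * emb (C (sgn Ω u)) = (1 : RatFn n) := by
    rw [← map_mul, ← C_mul, sgn_mul_self, C_1, map_one]
  rw [map_div₀, h.ratAct_vandermonde u.2, ← emb_C_mul, ← emb_C_mul]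
  set e : RatFn n := emb (C (sgn Ω u))
  have he0 : e ≠ 0 := left_ne_zero_of_mul (he ▸ one_ne_zero)
  field_simp
  rw [sq, he, one_mul]

/-- The divided difference of the longest one of the minimal length representatives of `W/W_y`, as
a sum over `W`. -/
theorem SimpleSystem.card_mul_ratDiv_minRep (h : SimpleSystem Ω) {y : Vec n}
    (hy : IsStandard Ω y) {Θ : Set (Vec n)} (hΘdef : Θ = rootsAt Ω y) {g : Vec n ≃ₗ[ℂ] Vec n} (hg : IsLongest Ω (minReps Ω y) g)
    [Fintype (reflGroup Ω)] [Fintype (reflGroup Θ)] {F : RatFn n}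
    (hF : ∀ α ∈ Θ, ratAct (rootRefl α) F = F) :
    (Fintype.card (reflGroup Θ) : RatFn n) * ratDiv Ω g F =
      ∑ u : reflGroup Ω, ratAct u (F / emb (prodLin {α | α ∈ Pos Ω ∧ α ⬝ᵥ y ≠ 0})) := by
  have hΘ : Θ ⊆ Ω := hΘdef ▸ rootsAt_subset Ω y
  have hΘs := h.mono hΘ
  obtain ⟨h1, h2⟩ := h.longest_minRep hy hg
  rw [← hΘdef] at h1 h2
  have hm := reflGroup_mono hΘ hΘs.longest_mem
  -- Since `y` is standard, the positive roots that vanish at `y` are exactly the positive roots of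
  -- `Θ`.
  have hsplit : vandermonde Ω =
      prodLin {α | α ∈ Pos Ω ∧ α ⬝ᵥ y ≠ 0} * vandermonde Θ := by
    rw [vandermonde_eq, vandermonde_eq, ← prodLin_union (h.pos_finite.subset fun _ h => h.1)
      hΘs.pos_finite]
    · congr 1
      have hset : Pos Ω = {α | α ∈ Pos Ω ∧ α ⬝ᵥ y ≠ 0} ∪ Pos Θ := by
        ext α
        rw [Set.mem_union, h.mem_pos_sub hΘ, hΘdef, ← hy.rootsAt_eq]
        constructor
        · intro hα
          by_cases h0 : α ⬝ᵥ y = 0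
          · exact Or.inr ⟨hα, hα.1, h0⟩
          · exact Or.inl ⟨hα, h0⟩
        · rintro (hα | hα)
          · exact hα.1
          · exact hα.1
      rw [← hset]
    · rw [Set.disjoint_left]
      rintro α ⟨-, h3⟩ h4
      rw [hΘdef] at h4
      exact h3 (dotProduct_eq_zero_of_mem_subsystem h4.1)
  have hΔ := emb_ne_zero hΘs.vandermonde_ne_zero
  -- `∂_{ω₀}` is `∂_g` after the longest divided difference of `Θ`. The latter pulls out the
  -- invariant `F` and turns the Vandermonde product of `Θ` into the order of its group.
  have key : ratDiv Ω (longest Ω) (F * emb (vandermonde Θ)) =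
      (Fintype.card (reflGroup Θ) : RatFn n) * ratDiv Ω g F := by
    rw [← h1, ← h.ratDiv_mul hg.1.1 hm h2, ← h.ratDiv_sub hΘ hΘs.longest_mem,
      ratDiv_invariant_mul hΘs.longest_mem hF, hΘs.ratDiv_longest_vandermonde, mul_comm F,
      ratDiv_invariant_mul hg.1.1]
    exact fun α _ => map_natCast _ _
  rw [← key, h.ratDiv_longest_eq, hsplit, map_mul]
  refine Finset.sum_congr rfl fun u _ => ?_
  rw [mul_div_mul_right _ _ hΔ]

end

/-! ### Divided differences on `Λ` -/

/-- `s_α` moves each linear form by a multiple of `α`, so it induces the identity on `Λ/(α)`. -/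
theorem linForm_dvd_sub (α : Vec n) (f : Poly n) :
    linForm α ∣ f - polyAct (rootRefl α) f := by
  rw [← Ideal.mem_span_singleton, ← Ideal.Quotient.eq]
  have : (Ideal.Quotient.mkₐ ℂ (Ideal.span {linForm α})) =
      (Ideal.Quotient.mkₐ ℂ (Ideal.span {linForm α})).comp
        (polyAct (rootRefl α) : Poly n →ₐ[ℂ] Poly n) := by
    refine MvPolynomial.algHom_ext fun i => ?_
    refine Ideal.Quotient.eq.mpr (Ideal.mem_span_singleton.mpr ?_)
    change linForm α ∣ X i - polyAct (rootRefl α) (X i)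
    rw [← linForm_single, polyAct_rootRefl_linForm, ← linForm_sub, rootRefl_apply, sub_sub_cancel,
      linForm_smul]
    exact dvd_mul_left _ _
  exact DFunLike.congr_fun this f

theorem nabla_spec (α : Vec n) (f : Poly n) :
    linForm α * nabla α f = f - polyAct (rootRefl α) f :=
  Classical.epsilon_spec (p := fun q => linForm α * q = f - polyAct (rootRefl α) f)
    (let ⟨q, hq⟩ := linForm_dvd_sub α f; ⟨q, hq.symm⟩)

theorem emb_nabla {α : Vec n} (h : α ≠ 0) (f : Poly n) :
    emb (nabla α f) = nablaRat α (emb f) := by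
  rw [nablaRat_apply, eq_inv_mul_iff_mul_eq₀ (lin_ne_zero h), lin, ← map_mul, nabla_spec, map_sub,
    ratAct_emb]

/-- The composition of the twisted derivations of the letters of a word, on `Λ`. -/
def polyWord (l : List (Vec n)) (f : Poly n) : Poly n := l.foldr nabla f

theorem polyWord_cons (α : Vec n) (l : List (Vec n)) (f : Poly n) :
    polyWord (α :: l) f = nabla α (polyWord l f) := rfl

theorem divDiff_eq (Ω : Set (Vec n)) (w : Vec n ≃ₗ[ℂ] Vec n) (f : Poly n) :
    divDiff Ω w f = polyWord (reducedWord Ω w) f := rfl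

theorem emb_polyWord {l : List (Vec n)} (h : ∀ α ∈ l, α ≠ 0) (f : Poly n) :
    emb (polyWord l f) = wordOp l (emb f) := by
  induction l with
  | nil => rfl
  | cons α l ih =>
    rw [List.forall_mem_cons] at h
    rw [polyWord_cons, emb_nabla h.1, ih h.2, wordOp_cons]

/-! ### Homogeneity -/

theorem isHomogeneous_linForm (α : Vec n) : (linForm α).IsHomogeneous 1 :=
  IsHomogeneous.sum _ _ _ fun _ _ => isHomogeneous_C_mul_X _ _

theorem polyAct_isHomogeneous {g : Vec n ≃ₗ[ℂ] Vec n} {f : Poly n} {d : ℕ}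
    (hf : f.IsHomogeneous d) : (polyAct g f).IsHomogeneous d := by
  have := hf.aeval (g := fun i => (∑ j, C ((g⁻¹ : Vec n ≃ₗ[ℂ] Vec n) (Pi.single j 1) i) * X j) +
    C ((0 : Vec n) i)) (n := 1) fun i => by
      rw [Pi.zero_apply, C_0, add_zero]
      exact IsHomogeneous.sum _ _ _ fun _ _ => isHomogeneous_C_mul_X _ _
  rw [one_mul] at this
  exact this

theorem polyAct_homogeneousComponent (g : Vec n ≃ₗ[ℂ] Vec n) (d : ℕ) (f : Poly n) :
    polyAct g (homogeneousComponent d f) = homogeneousComponent d (polyAct g f) := by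
  conv_rhs => rw [← sum_homogeneousComponent f, map_sum, map_sum]
  have : ∀ i, homogeneousComponent d (polyAct g (homogeneousComponent i f)) =
      if i = d then polyAct g (homogeneousComponent i f) else 0 := fun i => by
    rw [homogeneousComponent_of_mem (m := d) (n := i)]
    · by_cases h : d = i
      · rw [if_pos h, if_pos h.symm]
      · rw [if_neg h, if_neg (Ne.symm h)]
    · exact polyAct_isHomogeneous (homogeneousComponent_isHomogeneous i f)
  simp only [this]
  rw [Finset.sum_ite_eq']
  split_ifs with h
  · rfl
  · rw [Finset.mem_range, not_lt] at h
    rw [homogeneousComponent_eq_zero _ _ (by omega), map_zero]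

theorem homogeneousComponent_linForm_mul (α : Vec n) (d : ℕ) (q : Poly n) :
    homogeneousComponent (d + 1) (linForm α * q) = linForm α * homogeneousComponent d q := by
  conv_lhs => rw [← sum_homogeneousComponent q, Finset.mul_sum, map_sum]
  have : ∀ i, homogeneousComponent (d + 1) (linForm α * homogeneousComponent i q) =
      if i = d then linForm α * homogeneousComponent i q else 0 := fun i => by
    rw [homogeneousComponent_of_mem (m := d + 1) (n := 1 + i)]
    · by_cases h : i = d
      · rw [if_pos h, if_pos (by omega)]
      · rw [if_neg h, if_neg (by omega)]
    · exact (isHomogeneous_linForm α).mul (homogeneousComponent_isHomogeneous i q)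
  simp only [this]
  rw [Finset.sum_ite_eq']
  split_ifs with h
  · rfl
  · rw [Finset.mem_range, not_lt] at h
    rw [homogeneousComponent_eq_zero _ _ (by omega), mul_zero]

theorem isHomogeneous_of_linForm_mul {α : Vec n} (hα : α ≠ 0) {d : ℕ} {q : Poly n}
    (h : (linForm α * q).IsHomogeneous (d + 1)) : q.IsHomogeneous d := by
  have h0 : ∀ i, i ≠ d → homogeneousComponent i q = 0 := fun i hi => by
    have h1 := homogeneousComponent_linForm_mul α i q
    rw [homogeneousComponent_of_mem (m := i + 1) (n := d + 1) h, if_neg (by omega)] at h1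
    exact (mul_eq_zero.mp h1.symm).resolve_left (linForm_ne_zero hα)
  rw [← sum_homogeneousComponent q]
  refine IsHomogeneous.sum _ _ _ fun i _ => ?_
  by_cases hi : i = d
  · rw [← hi]; exact homogeneousComponent_isHomogeneous i q
  · rw [h0 i hi]; exact isHomogeneous_zero _ _ _

theorem nabla_isHomogeneous {α : Vec n} (hα : α ≠ 0) {d : ℕ} {f : Poly n}
    (h : f.IsHomogeneous (d + 1)) : (nabla α f).IsHomogeneous d :=
  isHomogeneous_of_linForm_mul hα (by
    rw [nabla_spec]; exact h.sub (polyAct_isHomogeneous h))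

theorem nabla_eq_zero {α : Vec n} (hα : α ≠ 0) {f : Poly n} (h : f.IsHomogeneous 0) :
    nabla α f = 0 := by
  obtain ⟨a, rfl⟩ : ∃ a, f = C a := ⟨_, totalDegree_eq_zero_iff_eq_C.mp
    (Nat.le_zero.mp h.totalDegree_le)⟩
  have := nabla_spec α (C a)
  rw [← algebraMap_eq, AlgEquiv.commutes, sub_self] at this
  exact (mul_eq_zero.mp this).resolve_left (linForm_ne_zero hα)

theorem nabla_zero {α : Vec n} (hα : α ≠ 0) : nabla α (0 : Poly n) = 0 :=
  nabla_eq_zero hα (isHomogeneous_zero _ _ _)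

theorem polyWord_isHomogeneous {l : List (Vec n)} (hl : ∀ α ∈ l, α ≠ 0) {d : ℕ} {f : Poly n}
    (h : f.IsHomogeneous (l.length + d)) : (polyWord l f).IsHomogeneous d := by
  induction l generalizing d with
  | nil =>
    rw [List.length_nil, zero_add] at h
    exact h
  | cons α l ih =>
    rw [List.forall_mem_cons] at hl
    refine nabla_isHomogeneous hl.1 (ih hl.2 ?_)
    rw [List.length_cons] at h
    convert h using 1
    omega

theorem polyWord_eq_zero {l : List (Vec n)} (hl : ∀ α ∈ l, α ≠ 0) {d : ℕ} {f : Poly n}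
    (h : f.IsHomogeneous d) (hd : d < l.length) : polyWord l f = 0 := by
  induction l with
  | nil => simp at hd
  | cons α l ih =>
    rw [List.forall_mem_cons] at hl
    rw [List.length_cons] at hd
    rcases Nat.lt_or_ge d l.length with h1 | h1
    · rw [polyWord_cons, ih hl.2 h1, nabla_zero hl.1]
    · have : d = l.length + 0 := by omega
      rw [this] at h
      exact nabla_eq_zero hl.1 (polyWord_isHomogeneous hl.2 h)

theorem eval_zero_of_isHomogeneous {d : ℕ} (hd : 0 < d) {f : Poly n} (h : f.IsHomogeneous d) :
    eval 0 f = 0 := by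
  rw [eval_zero, constantCoeff_eq]
  exact h.coeff_eq_zero (by rw [map_zero]; omega)

/-! ### The divided differences of the group elements -/

section

variable {Ω : Set (Vec n)}

theorem SimpleSystem.ne_zero_of_isWord (h : SimpleSystem Ω) {l : List (Vec n)}
    (hl : IsWord Ω l) : ∀ α ∈ l, α ≠ 0 := fun α hα =>
  h.ne_zero (subset_subsystem Ω (hl α hα))

theorem SimpleSystem.emb_divDiff (h : SimpleSystem Ω) {w : Vec n ≃ₗ[ℂ] Vec n}
    (hw : w ∈ reflGroup Ω) (f : Poly n) : emb (divDiff Ω w f) = ratDiv Ω w (emb f) :=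
  emb_polyWord (h.ne_zero_of_isWord (reducedWord_spec hw).1.1) f

theorem SimpleSystem.divDiff_add (h : SimpleSystem Ω) {w : Vec n ≃ₗ[ℂ] Vec n}
    (hw : w ∈ reflGroup Ω) (f g : Poly n) :
    divDiff Ω w (f + g) = divDiff Ω w f + divDiff Ω w g := emb_injective <| by
  rw [map_add, h.emb_divDiff hw, h.emb_divDiff hw, h.emb_divDiff hw, map_add, map_add]

theorem SimpleSystem.divDiff_C_mul (h : SimpleSystem Ω) {w : Vec n ≃ₗ[ℂ] Vec n}
    (hw : w ∈ reflGroup Ω) (c : ℂ) (f : Poly n) :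
    divDiff Ω w (C c * f) = C c * divDiff Ω w f := emb_injective <| by
  rw [map_mul, h.emb_divDiff hw, h.emb_divDiff hw, map_mul, emb_C_mul, emb_C_mul, map_smul]

theorem SimpleSystem.divDiff_invariant_mul (h : SimpleSystem Ω) {w : Vec n ≃ₗ[ℂ] Vec n}
    (hw : w ∈ reflGroup Ω) {p : Poly n} (hp : p ∈ invariants Ω) (f : Poly n) :
    divDiff Ω w (p * f) = p * divDiff Ω w f := emb_injective <| by
  rw [map_mul, h.emb_divDiff hw, h.emb_divDiff hw, map_mul, ratDiv_invariant_mul hw]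
  intro α hα
  rw [ratAct_emb, hp _ (rootRefl_mem hα)]

theorem SimpleSystem.divDiff_mul (h : SimpleSystem Ω) {u w : Vec n ≃ₗ[ℂ] Vec n}
    (hu : u ∈ reflGroup Ω) (hw : w ∈ reflGroup Ω)
    (hl : weylLength Ω (u * w) = weylLength Ω u + weylLength Ω w) (f : Poly n) :
    divDiff Ω u (divDiff Ω w f) = divDiff Ω (u * w) f := emb_injective <| by
  rw [h.emb_divDiff hu, h.emb_divDiff hw, h.emb_divDiff (mul_mem hu hw), h.ratDiv_mul hu hw hl]

theorem SimpleSystem.divDiff_mul_eq_zero (h : SimpleSystem Ω) {u w : Vec n ≃ₗ[ℂ] Vec n}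
    (hu : u ∈ reflGroup Ω) (hw : w ∈ reflGroup Ω)
    (hl : weylLength Ω (u * w) ≠ weylLength Ω u + weylLength Ω w) (f : Poly n) :
    divDiff Ω u (divDiff Ω w f) = 0 := emb_injective <| by
  rw [h.emb_divDiff hu, h.emb_divDiff hw, h.ratDiv_mul_eq_zero hu hw hl, map_zero]

/-- The functional `f ↦ ∂_w(f)(0)`. -/
def divEval (h : SimpleSystem Ω) (w : reflGroup Ω) : Poly n →ₗ[ℂ] ℂ where
  toFun f := eval 0 (divDiff Ω w f)
  map_add' f g := by rw [h.divDiff_add w.2, map_add]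
  map_smul' c f := by
    rw [smul_eq_C_mul, h.divDiff_C_mul w.2, map_mul, eval_C]; rfl

theorem divEval_apply (h : SimpleSystem Ω) (w : reflGroup Ω) (f : Poly n) :
    divEval h w f = eval 0 (divDiff Ω w f) := rfl

/-- `∂_w` lowers degrees by `ℓ(w)`, so only the component of degree `ℓ(w)` contributes at `0`. -/
theorem divEval_of_isHomogeneous (h : SimpleSystem Ω) (w : reflGroup Ω) {d : ℕ} {f : Poly n}
    (hf : f.IsHomogeneous d) (hd : d ≠ weylLength Ω w) : divEval h w f = 0 := by
  obtain ⟨h1, h2⟩ := reducedWord_spec w.2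
  have hlen := h1.2
  rw [h2] at hlen
  have h3 := h.ne_zero_of_isWord h1.1
  rw [divEval_apply, divDiff_eq]
  rcases Nat.lt_or_ge d (weylLength Ω w) with h4 | h4
  · rw [polyWord_eq_zero h3 hf (by omega), map_zero]
  · exact eval_zero_of_isHomogeneous (d := d - weylLength Ω w) (by omega)
      (polyWord_isHomogeneous h3 (by rwa [hlen, Nat.add_sub_cancel' h4]))

/-! ### Schubert polynomials -/

theorem SimpleSystem.weylLength_inv_mul_longest (h : SimpleSystem Ω) {w : Vec n ≃ₗ[ℂ] Vec n}
    (hw : w ∈ reflGroup Ω) :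
    weylLength Ω (w⁻¹ * longest Ω) + weylLength Ω w = weylLength Ω (longest Ω) := by
  rw [← weylLength_inv hw]
  exact h.weylLength_mul_longest h.isLongest_longest (inv_mem hw)

/-- Here `w τ⁻¹ ω₀ = (τ w⁻¹)⁻¹ ω₀`, and complementation of lengths turns the hypothesis into
additivity of the lengths of `w` and `τ⁻¹ ω₀`. -/
theorem SimpleSystem.divDiff_schubert (h : SimpleSystem Ω) {w τ : Vec n ≃ₗ[ℂ] Vec n}
    (hw : w ∈ reflGroup Ω) (hτ : τ ∈ reflGroup Ω)
    (hl : weylLength Ω (τ * w⁻¹) + weylLength Ω w = weylLength Ω τ) :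
    divDiff Ω w (schubert Ω τ) = schubert Ω (τ * w⁻¹) := by
  have h0 := h.longest_mem
  have h1 := h.weylLength_inv_mul_longest hτ
  have h2 := h.weylLength_inv_mul_longest (mul_mem hτ (inv_mem hw))
  have e : (τ * w⁻¹)⁻¹ * longest Ω = w * (τ⁻¹ * longest Ω) := by
    rw [mul_inv_rev, inv_inv, mul_assoc]
  rw [schubert, h.divDiff_C_mul hw, h.divDiff_mul hw (mul_mem (inv_mem hτ) h0), ← e]
  · rfl
  · rw [← e]; omega

theorem SimpleSystem.divDiff_schubert_eq_zero (h : SimpleSystem Ω) {w τ : Vec n ≃ₗ[ℂ] Vec n}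
    (hw : w ∈ reflGroup Ω) (hτ : τ ∈ reflGroup Ω)
    (hl : weylLength Ω (τ * w⁻¹) + weylLength Ω w ≠ weylLength Ω τ) :
    divDiff Ω w (schubert Ω τ) = 0 := by
  have h0 := h.longest_mem
  have h1 := h.weylLength_inv_mul_longest hτ
  have h2 := h.weylLength_inv_mul_longest (mul_mem hτ (inv_mem hw))
  have e : (τ * w⁻¹)⁻¹ * longest Ω = w * (τ⁻¹ * longest Ω) := by
    rw [mul_inv_rev, inv_inv, mul_assoc]
  rw [schubert, h.divDiff_C_mul hw, h.divDiff_mul_eq_zero hw (mul_mem (inv_mem hτ) h0), mul_zero]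
  rw [← e]; omega

/-- The normalizing factor `|W|⁻¹` cancels `∂_{ω₀} Δ = |W|`. -/
theorem SimpleSystem.schubert_one (h : SimpleSystem Ω) : schubert Ω 1 = 1 := by
  have := h.finiteGroup
  have := Fintype.ofFinite (reflGroup Ω)
  refine emb_injective ?_
  rw [schubert, inv_one, one_mul, map_mul, h.emb_divDiff h.longest_mem,
    h.ratDiv_longest_vandermonde, Nat.card_eq_fintype_card]
  have h1 : ((Fintype.card (reflGroup Ω) : ℕ) : RatFn n) =
      emb (C ((Fintype.card (reflGroup Ω) : ℕ) : ℂ)) := by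
    rw [map_natCast, map_natCast]
  rw [h1, ← map_mul, ← C_mul, inv_mul_cancel₀ (Nat.cast_ne_zero.mpr Fintype.card_ne_zero), C_1]

theorem SimpleSystem.isHomogeneous_vandermonde (h : SimpleSystem Ω) :
    (vandermonde Ω).IsHomogeneous (weylLength Ω (longest Ω)) := by
  have h0 : inversions Ω (longest Ω) = Pos Ω :=
    Set.Subset.antisymm (fun _ h => h.1) fun β hβ => ⟨hβ, h.longest_neg h.isLongest_longest hβ⟩
  rw [h.weylLength_eq h.longest_mem, h0, vandermonde_eq, prodLin,
    finprod_mem_eq_finite_toFinset_prod _ h.pos_finite, Set.ncard_eq_toFinset_card _ h.pos_finite,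
    Finset.card_eq_sum_ones]
  exact IsHomogeneous.prod _ _ _ fun α _ => isHomogeneous_linForm α

theorem SimpleSystem.isHomogeneous_schubert (h : SimpleSystem Ω) {τ : Vec n ≃ₗ[ℂ] Vec n}
    (hτ : τ ∈ reflGroup Ω) : (schubert Ω τ).IsHomogeneous (weylLength Ω τ) := by
  have hw := mul_mem (inv_mem hτ) h.longest_mem
  obtain ⟨h1, h2⟩ := reducedWord_spec hw
  have hlen := h1.2
  rw [h2] at hlen
  refine IsHomogeneous.C_mul (polyWord_isHomogeneous (h.ne_zero_of_isWord h1.1) ?_) _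
  rw [hlen, h.weylLength_inv_mul_longest hτ]
  exact h.isHomogeneous_vandermonde

/-- Degrees settle the case of different lengths. For equal lengths a nonzero value would force `ℓ(τ
w⁻¹) = 0`. -/
theorem divEval_schubert [DecidableEq (reflGroup Ω)] (h : SimpleSystem Ω) (w τ : reflGroup Ω) :
    divEval h w (schubert Ω τ) = if τ = w then 1 else 0 := by
  by_cases hl : weylLength Ω τ = weylLength Ω w
  · by_cases he : τ = w
    · rw [he, if_pos rfl, divEval_apply, h.divDiff_schubert w.2 w.2, mul_inv_cancel,
        h.schubert_one, map_one]
      rw [mul_inv_cancel, weylLength_one, zero_add]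
    · rw [if_neg he, divEval_apply, h.divDiff_schubert_eq_zero w.2 τ.2, map_zero]
      intro h1
      have h2 := eq_one_of_weylLength (mul_mem τ.2 (inv_mem w.2)) (by omega)
      exact he (Subtype.ext (mul_inv_eq_one.mp h2))
  · rw [if_neg (fun he : τ = w => hl (he ▸ rfl)),
      divEval_of_isHomogeneous h w (h.isHomogeneous_schubert τ.2) hl]

/-! ### The coinvariant algebra -/

theorem polyAct_mem_coinvIdeal {g : Vec n ≃ₗ[ℂ] Vec n} (hg : g ∈ reflGroup Ω) {f : Poly n}
    (hf : f ∈ coinvIdeal Ω) : polyAct g f ∈ coinvIdeal Ω := by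
  have hle : coinvIdeal Ω ≤ (coinvIdeal Ω).comap (polyAct g) :=
    Ideal.span_le.mpr fun p hp => by
      rw [SetLike.mem_coe, Ideal.mem_comap, hp.1 g hg]
      exact Ideal.subset_span hp
  exact hle hf

/-- `∂_w` is linear over the invariants, and those of positive degree vanish at `0`. -/
theorem divEval_coinvIdeal (h : SimpleSystem Ω) (w : reflGroup Ω) {f : Poly n}
    (hf : f ∈ coinvIdeal Ω) : divEval h w f = 0 := by
  suffices H : ∀ a : Poly n, divEval h w (a * f) = 0 by
    have := H 1
    rwa [one_mul] at this
  refine Submodule.span_induction (p := fun f _ => ∀ a : Poly n, divEval h w (a * f) = 0) ?_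
    (fun a => by rw [mul_zero, map_zero])
    (fun x y _ _ hx hy a => by rw [mul_add, map_add, hx, hy, add_zero])
    (fun b x _ hx a => by rw [smul_eq_mul, ← mul_assoc]; exact hx _) hf
  rintro p ⟨hp, d, hd, hd'⟩ a
  rw [divEval_apply, mul_comm, h.divDiff_invariant_mul w.2 hp, map_mul,
    eval_zero_of_isHomogeneous hd hd', zero_mul]

theorem mem_coinvIdeal_of_invariant {p : Poly n} (hp : p ∈ invariants Ω) (h0 : eval 0 p = 0) :
    p ∈ coinvIdeal Ω := by
  rw [← sum_homogeneousComponent p]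
  refine sum_mem fun i _ => ?_
  rcases Nat.eq_zero_or_pos i with rfl | hi
  · rw [homogeneousComponent_zero]
    have : coeff 0 p = 0 := by rw [← constantCoeff_eq, ← h0, eval_zero]
    rw [this, C_0]
    exact zero_mem _
  · refine Ideal.subset_span ⟨fun g hg => ?_, i, hi, homogeneousComponent_isHomogeneous i p⟩
    rw [polyAct_homogeneousComponent, hp g hg]

theorem totalDegree_polyAct_le (g : Vec n ≃ₗ[ℂ] Vec n) (f : Poly n) :
    (polyAct g f).totalDegree ≤ f.totalDegree := by
  rw [← sum_homogeneousComponent f, map_sum]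
  refine (totalDegree_finsetSum_le fun i hi => ?_)
  rw [sum_homogeneousComponent]
  rw [Finset.mem_range] at hi
  exact ((polyAct_isHomogeneous (homogeneousComponent_isHomogeneous i f)).totalDegree_le).trans
    (by omega)

theorem sum_subgroup_mul {G M : Type*} [Group G] [AddCommMonoid M] {H : Subgroup G} [Fintype H]
    {g : G} (hg : g ∈ H) (F : G → M) : ∑ w : H, F (g * w) = ∑ w : H, F w :=
  Equiv.sum_comp (Equiv.mulLeft (⟨g, hg⟩ : H)) fun w : H => F w

/-- Averaging: modulo `I_W`, `|W| f` is congruent to the sum of its translates under `W`, an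
invariant that vanishes at `0`. -/
theorem SimpleSystem.mem_coinvIdeal_of_sub (h : SimpleSystem Ω) {f : Poly n}
    (h0 : eval 0 f = 0) (h2 : ∀ w ∈ reflGroup Ω, f - polyAct w f ∈ coinvIdeal Ω) :
    f ∈ coinvIdeal Ω := by
  have := h.finiteGroup
  have := Fintype.ofFinite (reflGroup Ω)
  have h3 : ∑ w : reflGroup Ω, polyAct w f ∈ coinvIdeal Ω := by
    refine mem_coinvIdeal_of_invariant (fun g hg => ?_) ?_
    · rw [map_sum, ← sum_subgroup_mul hg fun w => polyAct w f]
      exact Finset.sum_congr rfl fun w _ => (polyAct_mul _ _ _).symm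
    · rw [map_sum]
      refine Finset.sum_eq_zero fun w _ => ?_
      rw [eval_polyAct, map_zero, h0]
  have h4 : ∑ w : reflGroup Ω, (f - polyAct w f) ∈ coinvIdeal Ω :=
    sum_mem fun w _ => h2 w w.2
  have h5 := add_mem h4 h3
  have e : ∑ w : reflGroup Ω, (f - polyAct w f) + ∑ w : reflGroup Ω, polyAct w f =
      (Fintype.card (reflGroup Ω) : ℂ) • f := by
    rw [Finset.sum_sub_distrib, sub_add_cancel, Finset.sum_const, Finset.card_univ,
      Nat.cast_smul_eq_nsmul]
  rw [e] at h5
  have h6 := Ideal.mul_mem_left _ (C ((Fintype.card (reflGroup Ω) : ℂ)⁻¹)) h5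
  rwa [← smul_eq_C_mul, smul_smul,
    inv_mul_cancel₀ (Nat.cast_ne_zero.mpr Fintype.card_ne_zero), one_smul] at h6

/-- The polynomial `∇_α f` has smaller degree and satisfies the same conditions, so `f - s_α f = α
∇_α f` lies in `I_W` by induction. Telescoping along words gives `f - w f ∈ I_W` for all `w`, and
averaging concludes. No structure theorem for the invariants is used. -/
theorem SimpleSystem.mem_coinvIdeal_of_words (h : SimpleSystem Ω) : ∀ (d : ℕ) (f : Poly n),
    f.totalDegree ≤ d → (∀ l, IsWord Ω l → eval 0 (polyWord l f) = 0) → f ∈ coinvIdeal Ω := by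
  intro d
  induction d with
  | zero =>
    intro f hd hl
    obtain ⟨a, rfl⟩ : ∃ a, f = C a := ⟨_, totalDegree_eq_zero_iff_eq_C.mp (Nat.le_zero.mp hd)⟩
    have := hl [] isWord_nil
    change eval 0 (C a) = 0 at this
    rw [eval_C] at this
    rw [this, C_0]
    exact zero_mem _
  | succ d ih =>
    intro f hd hl
    have h1 : ∀ α ∈ Ω, f - polyAct (rootRefl α) f ∈ coinvIdeal Ω := fun α hα => by
      have hα0 := h.ne_zero (subset_subsystem Ω hα)
      rw [← nabla_spec]
      refine Ideal.mul_mem_left _ _ (ih _ ?_ fun l hl' => ?_)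
      · by_cases hq : nabla α f = 0
        · rw [hq, totalDegree_zero]; exact Nat.zero_le d
        · have h2 := totalDegree_mul_of_isDomain (linForm_ne_zero hα0) hq
          rw [(isHomogeneous_linForm α).totalDegree (linForm_ne_zero hα0), nabla_spec] at h2
          have h3 := totalDegree_sub f (polyAct (rootRefl α) f)
          have h4 := totalDegree_polyAct_le (rootRefl α) f
          have h5 : max f.totalDegree (polyAct (rootRefl α) f).totalDegree ≤ d + 1 :=
            max_le hd (h4.trans hd)
          omega
      · have := hl (l ++ [α]) (isWord_append.mpr ⟨hl', isWord_cons.mpr ⟨hα, isWord_nil⟩⟩)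
        rwa [polyWord, List.foldr_append] at this
    have h2 : ∀ w ∈ reflGroup Ω, f - polyAct w f ∈ coinvIdeal Ω := fun w hw => by
      obtain ⟨l, hl', rfl⟩ := exists_word hw
      clear hw
      induction l with
      | nil => rw [wordProd_nil, polyAct_one, sub_self]; exact zero_mem _
      | cons α l ihl =>
        rw [isWord_cons] at hl'
        have h3 := add_mem (h1 α hl'.1) (polyAct_mem_coinvIdeal (rootRefl_mem hl'.1) (ihl hl'.2))
        rwa [map_sub, sub_add_sub_cancel, ← polyAct_mul, ← wordProd_cons] at h3
    exact h.mem_coinvIdeal_of_sub (hl [] isWord_nil) h2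

theorem mem_coinvIdeal_iff (h : SimpleSystem Ω) {f : Poly n} :
    f ∈ coinvIdeal Ω ↔ ∀ w, divEval h w f = 0 := by
  refine ⟨fun hf w => divEval_coinvIdeal h w hf, fun hf => ?_⟩
  refine h.mem_coinvIdeal_of_words _ f le_rfl fun l hl => ?_
  by_cases hr : IsReduced Ω l
  · have : polyWord l f = divDiff Ω (wordProd l) f := emb_injective <| by
      rw [emb_polyWord (h.ne_zero_of_isWord hl), h.wordOp_eq_ratDiv hr,
        h.emb_divDiff hl.wordProd_mem]
    rw [this]
    exact hf ⟨_, hl.wordProd_mem⟩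
  · have : polyWord l f = 0 := emb_injective <| by
      rw [emb_polyWord (h.ne_zero_of_isWord hl), h.wordOp_eq_zero hl hr, map_zero]; rfl
    rw [this, map_zero]

/-- The Schubert polynomials form a basis of the coinvariant algebra, with dual basis the
functionals `f ↦ ∂_w(f)(0)`. -/
theorem sub_sum_schubert_mem [Fintype (reflGroup Ω)] (h : SimpleSystem Ω) (f : Poly n) :
    f - ∑ w : reflGroup Ω, C (divEval h w f) * schubert Ω w ∈ coinvIdeal Ω := by
  classical
  rw [mem_coinvIdeal_iff h]
  intro w
  rw [map_sub, map_sum]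
  simp only [← smul_eq_C_mul, map_smul, divEval_schubert, smul_eq_mul, mul_ite, mul_one, mul_zero]
  rw [Finset.sum_ite_eq' Finset.univ w, if_pos (Finset.mem_univ w), sub_self]

end

/-! ### Differential operators with constant coefficients -/

section

variable {A B : Type*} [AddCommGroup A] [Module ℂ A] [AddCommGroup B] [Module ℂ B]

/-- The product of powers of the operators `d i` with exponents `m`. -/
def monoOp (d : Fin n → Module.End ℂ A) (m : Fin n →₀ ℕ) : Module.End ℂ A :=
  (List.ofFn fun i => d i ^ m i).prod

theorem substOp_eq (d : Fin n → Module.End ℂ A) (P : Poly n) :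
    substOp d P = ∑ m ∈ P.support, P.coeff m • monoOp d m := rfl

theorem intertwine_list {d : Fin n → Module.End ℂ A} {d' : Fin n → Module.End ℂ B}
    {T : A →ₗ[ℂ] B} (hT : ∀ i a, T (d i a) = d' i (T a)) (m : Fin n →₀ ℕ) (l : List (Fin n))
    (a : A) :
    T ((l.map fun i => d i ^ m i).prod a) = (l.map fun i => d' i ^ m i).prod (T a) := by
  have hpow : ∀ i k a, T ((d i ^ k) a) = (d' i ^ k) (T a) := by
    intro i k
    induction k with
    | zero => intro a; rfl
    | succ k ih => intro a; rw [pow_succ, pow_succ, Module.End.mul_apply, Module.End.mul_apply, ih, hT]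
  induction l with
  | nil => rfl
  | cons i l ih =>
    rw [List.map_cons, List.prod_cons, List.map_cons, List.prod_cons, Module.End.mul_apply,
      Module.End.mul_apply, hpow, ih]

/-- Substitution of operators is compatible with linear maps that intertwine the operators. -/
theorem intertwine {d : Fin n → Module.End ℂ A} {d' : Fin n → Module.End ℂ B}
    {T : A →ₗ[ℂ] B} (hT : ∀ i a, T (d i a) = d' i (T a)) (P : Poly n) (a : A) :
    T (substOp d P a) = substOp d' P (T a) := by
  rw [substOp_eq, substOp_eq, LinearMap.sum_apply, LinearMap.sum_apply, map_sum]
  refine Finset.sum_congr rfl fun m _ => ?_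
  rw [LinearMap.smul_apply, LinearMap.smul_apply, map_smul, monoOp, monoOp, List.ofFn_eq_map,
    List.ofFn_eq_map, intertwine_list hT]

end

theorem coeff_pderiv_pow (i : Fin n) (a : ℕ) (k : Fin n →₀ ℕ) (f : Poly n) :
    ((k i).factorial : ℂ) * coeff k (((pderiv i).toLinearMap ^ a : Module.End ℂ (Poly n)) f) =
      ((k i + a).factorial : ℂ) * coeff (k + Finsupp.single i a) f := by
  induction a generalizing k with
  | zero => simp
  | succ a ih =>
    rw [pow_succ', Module.End.mul_apply]
    change _ * coeff k (pderiv i _) = _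
    rw [coeff_pderiv]
    have h1 := ih (k + Finsupp.single i 1)
    have h2 : (k + Finsupp.single i 1 : Fin n →₀ ℕ) i = k i + 1 := by simp
    have h3 : k + Finsupp.single i 1 + Finsupp.single i a = k + Finsupp.single i (a + 1) := by
      rw [add_assoc, ← Finsupp.single_add, add_comm 1 a]
    rw [h2, h3, Nat.factorial_succ] at h1
    have h4 : k i + (a + 1) = k i + 1 + a := by omega
    rw [h4, ← h1]
    push_cast
    ring

theorem coeff_pderiv_list (m : Fin n →₀ ℕ) {l : List (Fin n)} (hl : l.Nodup) (k : Fin n →₀ ℕ)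
    (hk : ∀ i ∈ l, k i = 0) (f : Poly n) :
    coeff k ((l.map fun i => ((pderiv i).toLinearMap ^ m i : Module.End ℂ (Poly n))).prod f) =
      (l.map fun i => ((m i).factorial : ℂ)).prod *
        coeff (k + (l.map fun i => Finsupp.single i (m i)).sum) f := by
  induction l generalizing k with
  | nil => simp
  | cons i l ih =>
    rw [List.nodup_cons] at hl
    rw [List.map_cons, List.prod_cons, Module.End.mul_apply, List.map_cons, List.prod_cons,
      List.map_cons, List.sum_cons]
    have h1 := coeff_pderiv_pow i (m i) k
      ((l.map fun i => ((pderiv i).toLinearMap ^ m i : Module.End ℂ (Poly n))).prod f)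
    rw [hk i List.mem_cons_self, Nat.factorial_zero, Nat.cast_one, one_mul, zero_add] at h1
    rw [h1, ih hl.2, ← add_assoc, mul_assoc]
    intro j hj
    have hne : j ≠ i := fun h => hl.1 (h ▸ hj)
    rw [Finsupp.add_apply, Finsupp.single_eq_of_ne hne, add_zero]
    exact hk j (List.mem_cons_of_mem i hj)

/-- The product of the factorials of the exponents. -/
def multiFactorial (m : Fin n →₀ ℕ) : ℂ := ((List.finRange n).map fun i => ((m i).factorial : ℂ)).prod

theorem multiFactorial_ne_zero (m : Fin n →₀ ℕ) : multiFactorial m ≠ 0 := by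
  rw [multiFactorial, Ne, List.prod_eq_zero_iff, List.mem_map]
  rintro ⟨i, -, hi⟩
  exact Nat.factorial_ne_zero _ (Nat.cast_eq_zero.mp hi)

theorem eval_zero_monoOp (m : Fin n →₀ ℕ) (f : Poly n) :
    eval 0 (monoOp (fun i => (pderiv i).toLinearMap) m f) = multiFactorial m * coeff m f := by
  rw [eval_zero, constantCoeff_eq, monoOp, List.ofFn_eq_map,
    coeff_pderiv_list m (List.nodup_finRange n) 0 (fun _ _ => rfl), zero_add]
  congr 2
  rw [← List.ofFn_eq_map, List.sum_ofFn]
  exact Finsupp.univ_sum_single m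

theorem pairing_eq (P f : Poly n) :
    pairing P f = ∑ m ∈ P.support, coeff m P * (multiFactorial m * coeff m f) := by
  rw [pairing, theta, substOp_eq, LinearMap.sum_apply, map_sum]
  refine Finset.sum_congr rfl fun m _ => ?_
  rw [LinearMap.smul_apply, smul_eval, eval_zero_monoOp]

theorem pairing_eq_of_subset {P f : Poly n} {s : Finset (Fin n →₀ ℕ)} (h : P.support ⊆ s) :
    pairing P f = ∑ m ∈ s, coeff m P * (multiFactorial m * coeff m f) := by
  rw [pairing_eq]
  refine Finset.sum_subset h fun m _ hm => ?_
  rw [notMem_support_iff.mp hm, zero_mul]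

theorem pairing_comm (P f : Poly n) : pairing P f = pairing f P := by
  classical
  rw [pairing_eq_of_subset (s := P.support ∪ f.support) Finset.subset_union_left,
    pairing_eq_of_subset (s := P.support ∪ f.support) Finset.subset_union_right]
  exact Finset.sum_congr rfl fun m _ => by ring

/-- The pairing with a fixed polynomial, as a linear functional. -/
def pairingLin (P : Poly n) : Poly n →ₗ[ℂ] ℂ := (MvPolynomial.aeval (0 : Vec n)).toLinearMap ∘ₗ theta P

theorem pairingLin_apply (P f : Poly n) : pairingLin P f = pairing P f := rfl

/-- A functional that is concentrated in one degree is the pairing with a polynomial. -/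
theorem exists_pairing {φ : Poly n →ₗ[ℂ] ℂ} {d : ℕ}
    (hφ : ∀ e, e ≠ d → ∀ f : Poly n, f.IsHomogeneous e → φ f = 0) :
    ∃ P : Poly n, ∀ f, pairing P f = φ f := by
  classical
  -- The exponents of degree `d`. Concentration in one degree leaves only finitely many
  -- coefficients, so the representing series is a polynomial.
  let s : Finset (Fin n →₀ ℕ) := Finset.finsuppAntidiag Finset.univ d
  have hs : ∀ m, m ∈ s ↔ m.degree = d := fun m => by
    rw [Finset.mem_finsuppAntidiag, Finsupp.degree_eq_sum]
    exact ⟨fun h => h.1, fun h => ⟨h, Finset.subset_univ _⟩⟩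
  let P : Poly n := ∑ m ∈ s, monomial m ((multiFactorial m)⁻¹ * φ (monomial m 1))
  have hP : ∀ m, coeff m P = if m ∈ s then (multiFactorial m)⁻¹ * φ (monomial m 1) else 0 := by
    intro m
    simp only [P, coeff_sum, coeff_monomial]
    rw [Finset.sum_ite_eq']
  refine ⟨P, fun f => ?_⟩
  have key : pairingLin P = φ := by
    refine MvPolynomial.basisMonomials (Fin n) ℂ |>.ext fun k => ?_
    rw [coe_basisMonomials, pairingLin_apply, pairing_comm, pairing_eq_of_subset
      (s := {k}) support_monomial_subset, Finset.sum_singleton, coeff_monomial, if_pos rfl, hP,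
      one_mul]
    split_ifs with h
    · rw [← mul_assoc, mul_inv_cancel₀ (multiFactorial_ne_zero k), one_mul]
    · rw [mul_zero, hφ k.degree (fun h1 => h ((hs k).mpr h1)) _
        (isHomogeneous_monomial 1 rfl)]
  rw [← key]; rfl

/-! ### Postnikov–Stanley polynomials and Littlewood–Richardson coefficients -/

section

variable {Ω : Set (Vec n)}

theorem eq_of_dual [Fintype (reflGroup Ω)] (h : SimpleSystem Ω) {φ ψ : Poly n →ₗ[ℂ] ℂ}
    (hφ : ∀ f ∈ coinvIdeal Ω, φ f = 0) (hψ : ∀ f ∈ coinvIdeal Ω, ψ f = 0)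
    (hS : ∀ w : reflGroup Ω, φ (schubert Ω w) = ψ (schubert Ω w)) : φ = ψ := by
  refine LinearMap.ext fun f => ?_
  have h1 := sub_sum_schubert_mem h f
  have h2 := hφ _ h1
  have h3 := hψ _ h1
  rw [map_sub, sub_eq_zero] at h2 h3
  rw [h2, h3, map_sum, map_sum]
  refine Finset.sum_congr rfl fun w _ => ?_
  rw [← smul_eq_C_mul, map_smul, map_smul, hS]

/-- The pairing with `P_σ` is the functional `f ↦ ∂_σ(f)(0)`. -/
theorem pairing_psPoly (h : SimpleSystem Ω) (σ : reflGroup Ω) (f : Poly n) :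
    pairing (psPoly Ω σ) f = divEval h σ f := by
  classical
  have := h.finiteGroup
  have := Fintype.ofFinite (reflGroup Ω)
  -- This `P` shows that the conditions defining `P_σ` can be met. They determine the pairing with
  -- any solution, because `I_W` and the Schubert polynomials span `Λ`.
  obtain ⟨P, hP⟩ := exists_pairing fun e he f hf => divEval_of_isHomogeneous h σ hf he
  have hspec : IsDualSchubert Ω σ (psPoly Ω σ) := by
    refine Classical.epsilon_spec (p := IsDualSchubert Ω σ) ⟨P, fun f hf => ?_, ?_,
      fun τ hτ hne => ?_⟩
    · rw [pairing_comm, hP, divEval_coinvIdeal h σ hf]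
    · rw [hP, divEval_schubert, if_pos rfl]
    · rw [hP, divEval_schubert h σ ⟨τ, hτ⟩, if_neg fun he => hne (congrArg Subtype.val he)]
  have key : pairingLin (psPoly Ω σ) = divEval h σ := by
    refine eq_of_dual h (fun f hf => ?_) (fun f hf => divEval_coinvIdeal h σ hf) fun w => ?_
    · rw [pairingLin_apply, pairing_comm, hspec.1 f hf]
    · rw [pairingLin_apply, divEval_schubert]
      split_ifs with he
      · rw [he, hspec.2.1]
      · exact hspec.2.2 w w.2 fun h1 => he (Subtype.ext h1)
  rw [← key]; rfl

/-- Whatever expansion is chosen, the dual functionals read off its coefficients, so they are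
unique. -/
theorem lrCoeff_eq (h : SimpleSystem Ω) (σ τ ρ : reflGroup Ω) :
    lrCoeff Ω σ τ ρ = divEval h ρ (schubert Ω σ * schubert Ω τ) := by
  classical
  have := h.finiteGroup
  have := Fintype.ofFinite (reflGroup Ω)
  have hspec : schubert Ω σ * schubert Ω τ -
      ∑ᶠ μ : reflGroup Ω, C (lrCoeff Ω σ τ μ) * schubert Ω μ ∈ coinvIdeal Ω := by
    refine Classical.epsilon_spec (p := fun c : reflGroup Ω → ℂ =>
      schubert Ω σ * schubert Ω τ - ∑ᶠ μ : reflGroup Ω, C (c μ) * schubert Ω μ ∈ coinvIdeal Ω)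
      ⟨fun μ => divEval h μ (schubert Ω σ * schubert Ω τ), ?_⟩
    rw [finsum_eq_sum_of_fintype]
    exact sub_sum_schubert_mem h _
  rw [finsum_eq_sum_of_fintype] at hspec
  have h1 := divEval_coinvIdeal h ρ hspec
  rw [map_sub, sub_eq_zero, map_sum] at h1
  rw [h1]
  simp only [← smul_eq_C_mul, map_smul, divEval_schubert, smul_eq_mul, mul_ite, mul_one, mul_zero]
  rw [Finset.sum_ite_eq' Finset.univ ρ, if_pos (Finset.mem_univ ρ)]

/-- The coproduct formula for the functionals `f ↦ ∂_ρ(f)(0)`. -/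
theorem divEval_mul [Fintype (reflGroup Ω)] (h : SimpleSystem Ω) (ρ : reflGroup Ω)
    (p f : Poly n) : divEval h ρ (p * f) =
      ∑ ν : reflGroup Ω, (∑ μ : reflGroup Ω, lrCoeff Ω ν μ ρ * divEval h μ p) * divEval h ν f := by
  -- Since the functional kills the ideal, first `f` and then `p` may be replaced by their Schubert
  -- expansions.
  have hf := Ideal.mul_mem_left _ p (sub_sum_schubert_mem h f)
  have h1 := divEval_coinvIdeal h ρ hf
  rw [mul_sub, map_sub, sub_eq_zero, Finset.mul_sum, map_sum] at h1
  rw [h1]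
  refine Finset.sum_congr rfl fun ν _ => ?_
  have e1 : p * (C (divEval h ν f) * schubert Ω ν) = divEval h ν f • (schubert Ω ν * p) := by
    rw [smul_eq_C_mul]; ring
  rw [e1, map_smul, smul_eq_mul, mul_comm]
  congr 1
  have hp := Ideal.mul_mem_left _ (schubert Ω ν) (sub_sum_schubert_mem h p)
  have h2 := divEval_coinvIdeal h ρ hp
  rw [mul_sub, map_sub, sub_eq_zero, Finset.mul_sum, map_sum] at h2
  rw [h2]
  refine Finset.sum_congr rfl fun μ _ => ?_
  have e2 : schubert Ω ν * (C (divEval h μ p) * schubert Ω μ) =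
      divEval h μ p • (schubert Ω ν * schubert Ω μ) := by
    rw [smul_eq_C_mul]; ring
  rw [e2, map_smul, smul_eq_mul, ← lrCoeff_eq, mul_comm]

end

/-! ### Translations -/

theorem polyShift_X (z : Vec n) (i : Fin n) : polyShift z (X i) = X i + C (z i) :=
  MvPolynomial.funext fun x => by
    rw [eval_polyShift, map_add, eval_X, eval_X, eval_C, Pi.add_apply]

theorem pderiv_polyShift (z : Vec n) (i : Fin n) (f : Poly n) :
    polyShift z (pderiv i f) = pderiv i (polyShift z f) := by
  classical
  induction f using MvPolynomial.induction_on with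
  | C a => rw [pderiv_C, map_zero, ← algebraMap_eq, AlgEquiv.commutes, algebraMap_eq, pderiv_C]
  | add p q hp hq => rw [map_add, map_add, map_add, map_add, hp, hq]
  | mul_X p j hp =>
    have e1 : pderiv i (p * X j) = p * pderiv i (X j) + X j * pderiv i p :=
      (pderiv i).leibniz p (X j)
    have e2 : polyShift z (p * X j) = polyShift z p * (X j + C (z j)) := by
      rw [map_mul (polyShift z), polyShift_X]
    have e3 : pderiv i (polyShift z p * (X j + C (z j))) =
        polyShift z p * pderiv i (X j + C (z j)) + (X j + C (z j)) * pderiv i (polyShift z p) :=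
      (pderiv i).leibniz _ _
    have e4 : polyShift z (pderiv i (X j)) = pderiv i (X j) := by
      rw [pderiv_X]
      rcases eq_or_ne j i with rfl | hj
      · rw [Pi.single_eq_same, map_one]
      · rw [Pi.single_eq_of_ne hj, map_zero]
    rw [e1, e2, e3, map_add (polyShift z), map_mul (polyShift z), map_mul (polyShift z), hp, e4,
      polyShift_X, map_add (pderiv i), pderiv_C, add_zero]

theorem theta_polyShift (P : Poly n) (z : Vec n) (f : Poly n) :
    polyShift z (theta P f) = theta P (polyShift z f) :=
  intertwine (T := (polyShift z).toLinearMap) (fun i f => pderiv_polyShift z i f) P f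

theorem eval_theta (P : Poly n) (v : Vec n) (f : Poly n) :
    eval v (theta P f) = pairing P (polyShift v f) := by
  rw [pairing, ← theta_polyShift, eval_polyShift, zero_add]

/-- Operators with constant coefficients commute with translations; this reduces `D_σ^v` on `Γ` to a
divided difference at the origin. -/
theorem bgg_val {Φ Ω : Set (Vec n)} (h : SimpleSystem Ω) (σ : reflGroup Ω) (v : Vec n)
    (γ : invariants Φ) : (bgg Φ Ω σ v).val γ = divEval h σ (polyShift v γ) := by
  rw [← pairing_psPoly, ← eval_theta]
  rfl

/-! ### Translations of rational functions -/

/-- The translation `t_z` of `L`. -/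
abbrev shift (z : Vec n) : RatFn n ≃ₐ[ℂ] RatFn n := ratShift (Multiplicative.ofAdd z)

theorem shift_emb (z : Vec n) (p : Poly n) : shift z (emb p) = emb (polyShift z p) :=
  extendRat_algebraMap _ _

theorem shift_add (y z : Vec n) (F : RatFn n) : shift (y + z) F = shift y (shift z F) := by
  rw [shift, ofAdd_add, map_mul]; rfl

theorem shift_zero (F : RatFn n) : shift 0 F = F := by
  rw [shift, ofAdd_zero, map_one]; rfl

theorem polyAct_polyShift (g : Vec n ≃ₗ[ℂ] Vec n) (z : Vec n) (p : Poly n) :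
    polyAct g (polyShift z p) = polyShift (g z) (polyAct g p) :=
  MvPolynomial.funext fun x => by
    have e : g⁻¹ (g z) = z := by rw [← LinearEquiv.mul_apply, inv_mul_cancel]; rfl
    rw [eval_polyAct, eval_polyShift, eval_polyShift, eval_polyAct, map_add, e]

theorem ratAct_shift (g : Vec n ≃ₗ[ℂ] Vec n) (z : Vec n) (F : RatFn n) :
    ratAct g (shift z F) = shift (g z) (ratAct g F) := by
  have : (ratAct g) * (shift z) = (shift (g z)) * (ratAct g) := ratAlgEquiv_ext fun p => by
    rw [AlgEquiv.mul_apply, AlgEquiv.mul_apply, shift_emb, ratAct_emb, ratAct_emb, shift_emb,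
      polyAct_polyShift]
  exact DFunLike.congr_fun this F

/-- Clear on polynomials; for `F = p/q` it is forced by applying the Leibniz rule to `q F = p`. -/
theorem ratDeriv_shift (z : Vec n) (i : Fin n) (F : RatFn n) :
    shift z (ratDeriv i F) = ratDeriv i (shift z F) := by
  obtain ⟨p, q, hq, rfl⟩ := IsFractionRing.div_surjective (A := Poly n) F
  have hq0 : emb q ≠ 0 := emb_ne_zero (nonZeroDivisors.ne_zero hq)
  have hq1 : shift z (emb q) ≠ 0 := (map_ne_zero_iff _ (shift z).injective).mpr hq0
  set F := emb p / emb q with hF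
  have h1 : emb q * F = emb p := mul_div_cancel₀ _ hq0
  have h2 := congrArg (fun x => shift z (ratDeriv i x)) h1
  have h3 := congrArg (fun x => ratDeriv i (shift z x)) h1
  have l1 : ratDeriv i (emb q * F) = emb q * ratDeriv i F + F * ratDeriv i (emb q) :=
    (ratDeriv i).leibniz _ _
  have l2 : ratDeriv i (shift z (emb q) * shift z F) = shift z (emb q) * ratDeriv i (shift z F) +
      shift z F * ratDeriv i (shift z (emb q)) := (ratDeriv i).leibniz _ _
  have key : ∀ p : Poly n, shift z (ratDeriv i (emb p)) = ratDeriv i (shift z (emb p)) :=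
    fun p => by
      rw [ratDeriv_algebraMap, shift_emb, shift_emb, ratDeriv_algebraMap, pderiv_polyShift]
  beta_reduce at h2 h3
  rw [l1, map_add (shift z), map_mul (shift z), map_mul (shift z), key, key, ← h3,
    map_mul (shift z), l2] at h2
  exact mul_left_cancel₀ hq1 (add_right_cancel h2)

theorem thetaRat_shift (P : Poly n) (z : Vec n) (F : RatFn n) :
    shift z (thetaRat P F) = thetaRat P (shift z F) :=
  intertwine (T := (shift z).toLinearMap) (fun i F => ratDeriv_shift z i F) P F

theorem thetaRat_emb (P f : Poly n) : thetaRat P (emb f) = emb (theta P f) :=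
  (intertwine (T := (Algebra.algHom ℂ (Poly n) (RatFn n)).toLinearMap)
    (fun i f => (ratDeriv_algebraMap i f).symm) P f).symm

/-! ### Regular functions and their values -/

theorem evalRat_eq {v : Vec n} {F : RatFn n} {p q : Poly n} (hq : eval v q ≠ 0)
    (h : F * emb q = emb p) : evalRat v F = eval v p / eval v q := by
  have hspec : ∃ p' q' : Poly n, eval v q' ≠ 0 ∧ F * emb q' = emb p' ∧
      evalRat v F = eval v p' / eval v q' :=
    Classical.epsilon_spec (p := fun c => ∃ p q : Poly n, eval v q ≠ 0 ∧
      F * emb q = emb p ∧ c = eval v p / eval v q) ⟨_, p, q, hq, h, rfl⟩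
  obtain ⟨p', q', hq', h', e⟩ := hspec
  rw [e, div_eq_div_iff hq' hq, ← map_mul, ← map_mul]
  congr 1
  refine emb_injective ?_
  rw [map_mul, map_mul, ← h, ← h']
  ring

theorem isRegularAt_emb (v : Vec n) (p : Poly n) : IsRegularAt v (emb p) :=
  ⟨p, 1, by rw [map_one]; exact one_ne_zero, by rw [map_one, mul_one]⟩

theorem evalRat_emb (v : Vec n) (p : Poly n) : evalRat v (emb p) = eval v p := by
  rw [evalRat_eq (p := p) (q := 1) (by rw [map_one]; exact one_ne_zero) (by rw [map_one, mul_one]), map_one,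
    div_one]

theorem IsRegularAt.add {v : Vec n} {F G : RatFn n} (hF : IsRegularAt v F)
    (hG : IsRegularAt v G) :
    IsRegularAt v (F + G) ∧ evalRat v (F + G) = evalRat v F + evalRat v G := by
  obtain ⟨p, q, hq, h⟩ := hF
  obtain ⟨p', q', hq', h'⟩ := hG
  have h0 : eval v (q * q') ≠ 0 := by rw [map_mul]; exact mul_ne_zero hq hq'
  have h1 : (F + G) * emb (q * q') = emb (p * q' + p' * q) := by
    rw [map_mul, map_add, map_mul, map_mul, ← h, ← h']; ring
  refine ⟨⟨_, _, h0, h1⟩, ?_⟩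
  rw [evalRat_eq h0 h1, evalRat_eq hq h, evalRat_eq hq' h', map_add, map_mul, map_mul, map_mul]
  field_simp

theorem IsRegularAt.mul {v : Vec n} {F G : RatFn n} (hF : IsRegularAt v F)
    (hG : IsRegularAt v G) :
    IsRegularAt v (F * G) ∧ evalRat v (F * G) = evalRat v F * evalRat v G := by
  obtain ⟨p, q, hq, h⟩ := hF
  obtain ⟨p', q', hq', h'⟩ := hG
  have h0 : eval v (q * q') ≠ 0 := by rw [map_mul]; exact mul_ne_zero hq hq'
  have h1 : (F * G) * emb (q * q') = emb (p * p') := by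
    rw [map_mul, map_mul, ← h, ← h']; ring
  refine ⟨⟨_, _, h0, h1⟩, ?_⟩
  rw [evalRat_eq h0 h1, evalRat_eq hq h, evalRat_eq hq' h', map_mul, map_mul]
  field_simp

theorem IsRegularAt.sum {ι : Type*} {v : Vec n} {s : Finset ι} {F : ι → RatFn n}
    (hF : ∀ i ∈ s, IsRegularAt v (F i)) :
    IsRegularAt v (∑ i ∈ s, F i) ∧ evalRat v (∑ i ∈ s, F i) = ∑ i ∈ s, evalRat v (F i) := by
  classical
  induction s using Finset.induction_on with
  | empty =>
    rw [Finset.sum_empty, Finset.sum_empty, ← map_zero emb]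
    exact ⟨isRegularAt_emb v 0, by rw [evalRat_emb, map_zero]⟩
  | insert i s hi ih =>
    rw [Finset.sum_insert hi, Finset.sum_insert hi]
    obtain ⟨h1, h2⟩ := ih fun j hj => hF j (Finset.mem_insert_of_mem hj)
    obtain ⟨h3, h4⟩ := (hF i (Finset.mem_insert_self i s)).add h1
    exact ⟨h3, by rw [h4, h2]⟩

theorem IsRegularAt.ratDeriv {v : Vec n} {F : RatFn n} (hF : IsRegularAt v F) (i : Fin n) :
    IsRegularAt v (ratDeriv i F) := by
  obtain ⟨p, q, hq, h⟩ := hF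
  refine ⟨pderiv i p * q - p * pderiv i q, q * q, by rw [map_mul]; exact mul_ne_zero hq hq, ?_⟩
  have l1 : GaloisBGG.ratDeriv i (F * emb q) =
      F * GaloisBGG.ratDeriv i (emb q) + emb q * GaloisBGG.ratDeriv i F :=
    (GaloisBGG.ratDeriv i).leibniz _ _
  rw [h, ratDeriv_algebraMap, ratDeriv_algebraMap] at l1
  rw [map_sub, map_mul, map_mul, map_mul, l1, ← h]
  ring

theorem IsRegularAt.shift {v : Vec n} {F : RatFn n} (hF : IsRegularAt v F) :
    IsRegularAt 0 (shift v F) ∧ evalRat 0 (GaloisBGG.shift v F) = evalRat v F := by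
  obtain ⟨p, q, hq, h⟩ := hF
  have h0 : eval 0 (polyShift v q) ≠ 0 := by rwa [eval_polyShift, zero_add]
  have h1 : GaloisBGG.shift v F * emb (polyShift v q) = emb (polyShift v p) := by
    rw [← shift_emb, ← shift_emb, ← h, map_mul (GaloisBGG.shift v)]
  refine ⟨⟨_, _, h0, h1⟩, ?_⟩
  rw [evalRat_eq h0 h1, evalRat_eq hq h, eval_polyShift, eval_polyShift, zero_add]

/-- Functions of the form `s ^ k * G` with `G` regular at `0`. -/
def FlatAt (s : Poly n) (k : ℕ) (F : RatFn n) : Prop :=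
  ∃ G, IsRegularAt 0 G ∧ F = emb (s ^ k) * G

theorem FlatAt.ratDeriv {s : Poly n} {k : ℕ} {F : RatFn n} (hF : FlatAt s (k + 1) F)
    (i : Fin n) : FlatAt s k (ratDeriv i F) := by
  obtain ⟨G, hG, rfl⟩ := hF
  refine ⟨emb (s * 1) * GaloisBGG.ratDeriv i G + emb (((k + 1 : ℕ) : Poly n) * pderiv i s) * G, ?_, ?_⟩
  · exact (((isRegularAt_emb 0 _).mul (hG.ratDeriv i)).1.add
      ((isRegularAt_emb 0 _).mul hG).1).1
  · have l1 : GaloisBGG.ratDeriv i (emb (s ^ (k + 1)) * G) =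
        emb (s ^ (k + 1)) * GaloisBGG.ratDeriv i G +
          G * GaloisBGG.ratDeriv i (emb (s ^ (k + 1))) := (GaloisBGG.ratDeriv i).leibniz _ _
    have l2 : pderiv i (s ^ (k + 1)) = ((k + 1 : ℕ) : Poly n) * (s ^ k * pderiv i s) := by
      rw [Derivation.leibniz_pow, Nat.add_sub_cancel, smul_eq_mul, nsmul_eq_mul]
    rw [l1, ratDeriv_algebraMap, l2]
    simp only [map_mul, map_pow, mul_one, map_natCast]
    ring

theorem FlatAt.list {s : Poly n} (m : Fin n →₀ ℕ) (l : List (Fin n)) {k : ℕ} {F : RatFn n}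
    (hF : FlatAt s (k + (l.map m).sum) F) :
    FlatAt s k ((l.map fun i => ((GaloisBGG.ratDeriv i).toLinearMap ^ m i :
      Module.End ℂ (RatFn n))).prod F) := by
  induction l generalizing k with
  | nil => simpa using hF
  | cons i l ih =>
    rw [List.map_cons, List.sum_cons, ← add_assoc] at hF
    rw [List.map_cons, List.prod_cons, Module.End.mul_apply]
    have h1 := ih hF
    generalize (l.map fun i => ((GaloisBGG.ratDeriv i).toLinearMap ^ m i :
      Module.End ℂ (RatFn n))).prod F = H at h1
    clear ih hF
    generalize m i = a at h1 ⊢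
    induction a generalizing H with
    | zero => exact h1
    | succ a iha =>
      rw [pow_succ, Module.End.mul_apply]
      exact iha _ (FlatAt.ratDeriv h1 i)

theorem FlatAt.eval {s : Poly n} (hs : eval 0 s = 0) {F : RatFn n} (hF : FlatAt s 1 F) :
    IsRegularAt 0 F ∧ evalRat 0 F = 0 := by
  obtain ⟨G, hG, rfl⟩ := hF
  obtain ⟨h1, h2⟩ := (isRegularAt_emb 0 (s ^ 1)).mul hG
  refine ⟨h1, ?_⟩
  rw [h2, evalRat_emb, map_pow, hs, pow_one, zero_mul]

/-- Each derivative uses up at most one power of `s`, so one factor `s` survives an operator of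
order `deg P`. -/
theorem evalRat_thetaRat_of_flatAt {s : Poly n} (hs : eval 0 s = 0) (P : Poly n) {F : RatFn n}
    (hF : FlatAt s (1 + P.totalDegree) F) :
    IsRegularAt 0 (thetaRat P F) ∧ evalRat 0 (thetaRat P F) = 0 := by
  have key : ∀ m ∈ P.support, IsRegularAt 0 (P.coeff m •
      monoOp (fun i => (ratDeriv i).toLinearMap) m F) ∧
      evalRat 0 (P.coeff m • monoOp (fun i => (ratDeriv i).toLinearMap) m F) = 0 := by
    intro m hm
    have hd : ((List.finRange n).map m).sum ≤ P.totalDegree := by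
      rw [← List.ofFn_eq_map, List.sum_ofFn]
      have := le_totalDegree hm
      rwa [Finsupp.sum_fintype _ _ fun _ => rfl] at this
    have hF' : FlatAt s (1 + ((List.finRange n).map m).sum) F := by
      obtain ⟨G, hG, rfl⟩ := hF
      obtain ⟨e, he⟩ := Nat.exists_eq_add_of_le hd
      refine ⟨emb (s ^ e) * G, ((isRegularAt_emb 0 _).mul hG).1, ?_⟩
      rw [he, ← mul_assoc, ← map_mul, ← pow_add, add_assoc]
    have h1 := FlatAt.list m (List.finRange n) hF'
    rw [← List.ofFn_eq_map] at h1
    obtain ⟨h2, h3⟩ := FlatAt.eval hs h1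
    rw [← emb_C_mul]
    obtain ⟨h4, h5⟩ := (isRegularAt_emb 0 (C (P.coeff m))).mul h2
    exact ⟨h4, by rw [monoOp, h5, h3, mul_zero]⟩
  rw [thetaRat, substOp_eq, LinearMap.sum_apply]
  simp only [LinearMap.smul_apply]
  obtain ⟨h1, h2⟩ := IsRegularAt.sum fun m hm => (key m hm).1
  exact ⟨h1, by rw [h2, Finset.sum_eq_zero fun m hm => (key m hm).2]⟩

/-! ### The values `D_σ^v(F)` -/

section

variable {Ω : Set (Vec n)}

/-- A rational function that is regular at `0` has an invariant denominator with value `1` at `0`. -/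
theorem SimpleSystem.exists_invariant_denominator (h : SimpleSystem Ω) {F : RatFn n}
    (hF : IsRegularAt 0 F) :
    ∃ p q : Poly n, q ∈ invariants Ω ∧ eval 0 q = 1 ∧ F * emb q = emb p := by
  have := h.finiteGroup
  have := Fintype.ofFinite (reflGroup Ω)
  obtain ⟨p, q, hq, hpq⟩ := hF
  -- The norm of `q` is an invariant multiple of `q`. It does not vanish at `0`, because `W` fixes
  -- the origin, and is divided by its value there.
  have hinv : ∏ w : reflGroup Ω, polyAct w q ∈ invariants Ω := by
    intro g hg
    rw [map_prod, ← Equiv.prod_comp (Equiv.mulLeft (⟨g, hg⟩ : reflGroup Ω))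
      fun w : reflGroup Ω => polyAct w q]
    exact Finset.prod_congr rfl fun w _ => (polyAct_mul _ _ _).symm
  have h0 : eval 0 (∏ w : reflGroup Ω, polyAct w q) ≠ 0 := by
    rw [map_prod]
    refine Finset.prod_ne_zero_iff.mpr fun w _ => ?_
    rwa [eval_polyAct, map_zero]
  obtain ⟨r, hr⟩ : q ∣ ∏ w : reflGroup Ω, polyAct w q := by
    have := Finset.dvd_prod_of_mem (fun w : reflGroup Ω => polyAct w q) (Finset.mem_univ 1)
    rwa [Subgroup.coe_one, polyAct_one] at this
  set Q := ∏ w : reflGroup Ω, polyAct w q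
  refine ⟨p * r * C (eval 0 Q)⁻¹, Q * C (eval 0 Q)⁻¹,
    mul_mem hinv ((invariants Ω).algebraMap_mem _), ?_, ?_⟩
  · rw [map_mul, eval_C, mul_inv_cancel₀ h0]
  · have hQ : F * emb Q = emb (p * r) := by rw [hr, map_mul, map_mul, ← mul_assoc, hpq]
    rw [map_mul, map_mul emb (p * r), ← mul_assoc, hQ]

theorem SimpleSystem.ratDiv_div (h : SimpleSystem Ω) (σ : reflGroup Ω) {F : RatFn n}
    {p q : Poly n} (hq : q ∈ invariants Ω) (hpq : F * emb q = emb p) :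
    ratDiv Ω σ F * emb q = emb (divDiff Ω σ p) := by
  rw [h.emb_divDiff σ.2, ← hpq, mul_comm F, ratDiv_invariant_mul σ.2, mul_comm]
  intro α hα
  rw [ratAct_emb, hq _ (rootRefl_mem hα)]

theorem SimpleSystem.evalRat_ratDiv (h : SimpleSystem Ω) (σ : reflGroup Ω) {F : RatFn n}
    {p q : Poly n} (hq : q ∈ invariants Ω) (hq0 : eval 0 q = 1) (hpq : F * emb q = emb p) :
    IsRegularAt 0 (ratDiv Ω σ F) ∧ evalRat 0 (ratDiv Ω σ F) = divEval h σ p := by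
  have h1 := h.ratDiv_div σ hq hpq
  have h2 : eval 0 q ≠ 0 := by rw [hq0]; exact one_ne_zero
  refine ⟨⟨_, q, h2, h1⟩, ?_⟩
  rw [evalRat_eq h2 h1, hq0, div_one, divEval_apply]

/-- Expand `1/q` as a geometric series in `1 - q`. The first `1 + deg P_σ` terms form an invariant
polynomial `r` with `r(0) = 1`, and the remainder vanishes to too high an order to be seen by
`Θ(P_σ)` at `0`. So `t_v F` may be replaced by `r p`, and `∂_σ(r p)(0) = r(0) ∂_σ(p)(0)`. -/
theorem SimpleSystem.psValue_eq (h : SimpleSystem Ω) (σ : reflGroup Ω) {v : Vec n}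
    {F : RatFn n} (hF : IsRegularAt v F) {p q : Poly n} (hq : q ∈ invariants Ω)
    (hq0 : eval 0 q = 1) (hpq : shift v F * emb q = emb p) :
    psValue Ω σ v F = divEval h σ p := by
  set P := psPoly Ω σ with hP
  set N := 1 + P.totalDegree with hN
  set r : Poly n := ∑ i ∈ Finset.range N, (1 - q) ^ i with hr
  have hrinv : r ∈ invariants Ω :=
    sum_mem fun i _ => pow_mem (sub_mem (one_mem _) hq) i
  have hqr : q * r = 1 - (1 - q) ^ N := by
    have := mul_neg_geom_sum (1 - q) N
    rwa [sub_sub_cancel] at this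
  have hs0 : eval 0 (1 - q) = 0 := by rw [map_sub, map_one, hq0, sub_self]
  have hr0 : eval 0 r = 1 := by
    have := congrArg (eval 0) hqr
    rw [map_mul, hq0, one_mul, map_sub, map_one, map_pow, hs0, hN, pow_add, pow_one, zero_mul,
      sub_zero] at this
    exact this
  have hreg := (hF.shift).1
  have hsplit : shift v F = emb (r * p) + emb ((1 - q) ^ N) * shift v F := by
    have h1 : emb ((1 - q) ^ N) = 1 - emb q * emb r := by
      rw [← map_mul, hqr, map_sub, map_one, sub_sub_cancel]
    rw [h1, map_mul, ← hpq]
    ring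
  obtain ⟨h2, h3⟩ := evalRat_thetaRat_of_flatAt hs0 P ⟨shift v F, hreg, rfl⟩
  rw [← hN] at h2 h3
  have h4 : thetaRat P (shift v F) = emb (theta P (r * p)) +
      thetaRat P (emb ((1 - q) ^ N) * shift v F) := by
    conv_lhs => rw [hsplit]
    rw [map_add, thetaRat_emb]
  have h5 := (isRegularAt_emb 0 (theta P (r * p))).add h2
  rw [← h4, h3, add_zero, evalRat_emb] at h5
  have h6 : IsRegularAt v (thetaRat P F) := by
    obtain ⟨a, b, hb, hab⟩ := h5.1
    rw [← thetaRat_shift] at hab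
    refine ⟨polyShift (-v) a, polyShift (-v) b, by rwa [eval_polyShift, add_neg_cancel], ?_⟩
    have := congrArg (shift (-v)) hab
    rwa [map_mul (shift (-v)), ← shift_add, neg_add_cancel, shift_zero, shift_emb,
      shift_emb] at this
  rw [psValue, ← hP, ← h6.shift.2, thetaRat_shift, h5.2]
  change pairing P (r * p) = _
  rw [pairing_psPoly h, divEval_apply, h.divDiff_invariant_mul σ.2 hrinv, map_mul, hr0, one_mul,
    divEval_apply]

end

/-! ### Operators in the smash product -/

open Multiplicative (ofAdd toAdd)
open SkewMonoidAlgebra (single)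

theorem coeff_single_ofAdd (y z : Vec n) (l : RatFn n) :
    (single (ofAdd z) l : Smash n).coeff (ofAdd y) = if z = y then l else 0 := by
  classical
  rw [SkewMonoidAlgebra.coeff_single_apply]
  by_cases h : z = y
  · rw [if_pos h, if_pos (congrArg ofAdd h)]
  · rw [if_neg h, if_neg fun e => h (ofAdd.injective e)]

theorem dagger_single (z : Vec n) (l : RatFn n) :
    (dagger (single (ofAdd z) l)).unop = single (ofAdd (-z)) (shift (-z) l) := by
  have : dagger (single (ofAdd z) l) =
      MulOpposite.op (ofRat l) * MulOpposite.op (single (ofAdd z)⁻¹ 1) :=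
    SkewMonoidAlgebra.liftNC_single _ _ _ _
  rw [this, ← MulOpposite.op_mul, MulOpposite.unop_op]
  change single (ofAdd z)⁻¹ 1 * single 1 l = _
  rw [SkewMonoidAlgebra.single_mul_single, mul_one, one_mul]
  rfl

theorem dagger_coeff (X : Smash n) (y : Vec n) :
    (dagger X).unop.coeff (ofAdd y) = shift y (X.coeff (ofAdd (-y))) := by
  induction X using SkewMonoidAlgebra.induction_on with
  | zero =>
    rw [map_zero, MulOpposite.unop_zero, SkewMonoidAlgebra.coeff_zero, Finsupp.coe_zero,
      Pi.zero_apply, Pi.zero_apply, map_zero (shift y)]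
  | single z l =>
    obtain ⟨z, rfl⟩ := ofAdd.surjective z
    rw [dagger_single, coeff_single_ofAdd, coeff_single_ofAdd]
    by_cases h : -z = y
    · subst h
      rw [if_pos rfl, if_pos (neg_neg z).symm]
    · rw [if_neg h, if_neg fun e => h (by rw [e, neg_neg]), map_zero (shift y)]
  | add X Y hX hY =>
    rw [map_add, MulOpposite.unop_add, SkewMonoidAlgebra.coeff_add, SkewMonoidAlgebra.coeff_add,
      Finsupp.add_apply, Finsupp.add_apply, map_add (shift y), hX, hY]

/-- The support of `X†` as a finite set. -/
def daggerFinset (X : Smash n) : Finset (Vec n) :=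
  (dagger X).unop.support.map toAdd.toEmbedding

theorem mem_daggerFinset {X : Smash n} {y : Vec n} :
    y ∈ daggerFinset X ↔ y ∈ daggerSupport X := by
  rw [daggerFinset, Finset.mem_map_equiv, SkewMonoidAlgebra.mem_support_iff]
  rfl

theorem toOp_apply (X : Smash n) (F : RatFn n) :
    toOp X F = X.sum fun z l => l * ratShift z F := by
  induction X using SkewMonoidAlgebra.induction_on with
  | zero => rw [map_zero, SkewMonoidAlgebra.sum_zero_index]; rfl
  | single z l =>
    rw [SkewMonoidAlgebra.sum_single_index (zero_mul _)]
    have : toOp (single z l) = Algebra.lmul ℂ (RatFn n) l * (ratShift z).toLinearMap :=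
      SkewMonoidAlgebra.liftNC_single _ _ _ _
    rw [this]
    rfl
  | add X Y hX hY =>
    rw [map_add, LinearMap.add_apply, hX, hY, SkewMonoidAlgebra.sum_add_index']
    · exact fun z => zero_mul _
    · exact fun z a b => add_mul _ _ _

theorem daggerOp_apply (X : Smash n) (F : RatFn n) :
    daggerOp X F = ∑ y ∈ daggerFinset X, (dagger X).unop.coeff (ofAdd y) * shift y F := by
  rw [daggerOp, toOp_apply, SkewMonoidAlgebra.sum_def', daggerFinset, Finset.sum_map]
  rfl

/-- The action `g (l t_z) = g(l) t_{g z}` on the smash product. -/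
def smashAct (g : Vec n ≃ₗ[ℂ] Vec n) : Smash n →ₐ[ℂ] Smash n :=
  SkewMonoidAlgebra.liftNCAlgHom (ofRat.comp (ratAct g).toAlgHom)
    { toFun := fun z => single (ofAdd (g (toAdd z))) 1
      map_one' := by rw [toAdd_one, map_zero]; rfl
      map_mul' := fun y z => by
        rw [SkewMonoidAlgebra.single_mul_single, smul_one, mul_one, toAdd_mul, map_add,
          ofAdd_add] }
    (fun {F z} => by
      change single 1 (ratAct g (z • F)) * single (ofAdd (g (toAdd z))) 1 =
        single (ofAdd (g (toAdd z))) 1 * single 1 (ratAct g F)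
      rw [SkewMonoidAlgebra.single_mul_single, SkewMonoidAlgebra.single_mul_single, smul_one,
        mul_one, one_mul, mul_one, one_mul]
      exact congrArg _ (ratAct_shift g (toAdd z) F))

theorem smashAct_coeff (g : Vec n ≃ₗ[ℂ] Vec n) (X : Smash n) (z : Vec n) :
    (smashAct g X).coeff (ofAdd (g z)) = ratAct g (X.coeff (ofAdd z)) := by
  induction X using SkewMonoidAlgebra.induction_on with
  | zero =>
    rw [map_zero, SkewMonoidAlgebra.coeff_zero, Finsupp.coe_zero, Pi.zero_apply, Pi.zero_apply,
      map_zero (ratAct g)]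
  | single y l =>
    obtain ⟨y, rfl⟩ := ofAdd.surjective y
    have : smashAct g (single (ofAdd y) l) = single 1 (ratAct g l) * single (ofAdd (g y)) 1 :=
      SkewMonoidAlgebra.liftNC_single _ _ _ _
    rw [this, SkewMonoidAlgebra.single_mul_single, smul_one, mul_one, one_mul, coeff_single_ofAdd,
      coeff_single_ofAdd]
    by_cases h : y = z
    · rw [if_pos h, if_pos (congrArg g h)]
    · rw [if_neg h, if_neg fun e => h (g.injective e), map_zero (ratAct g)]
  | add X Y hX hY =>
    rw [map_add, SkewMonoidAlgebra.coeff_add, SkewMonoidAlgebra.coeff_add,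
      Finsupp.add_apply, Finsupp.add_apply, map_add (ratAct g), hX, hY]

variable {Φ : Set (Vec n)}

/-- As the fixed points of algebra endomorphisms, invariant operators form a subalgebra, so
invariance passes from the generators to `U`. -/
theorem isInvariantOp_iff {X : Smash n} :
    IsInvariantOp Φ X ↔ ∀ g ∈ reflGroup Φ, smashAct g X = X := by
  refine forall₂_congr fun g _ => ⟨fun h => ?_, fun h z => ?_⟩
  · refine SkewMonoidAlgebra.ext fun a => ?_
    obtain ⟨a, rfl⟩ := ofAdd.surjective a
    obtain ⟨z, rfl⟩ := g.surjective a
    rw [smashAct_coeff, h]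
  · rw [← smashAct_coeff, h]

theorem isInvariantOp_ofGamma (γ : invariants Φ) : IsInvariantOp Φ (ofGamma Φ γ) := by
  intro g hg z
  have : ofGamma Φ γ = single (ofAdd 0) (emb (γ : Poly n)) := rfl
  rw [this, coeff_single_ofAdd, coeff_single_ofAdd]
  by_cases h : 0 = z
  · rw [if_pos h, if_pos (by rw [← h, map_zero]), ratAct_emb, γ.2 g hg]
  · rw [if_neg h, if_neg fun e => h (g.injective (by rw [map_zero]; exact e)),
      map_zero (ratAct g)]

theorem IsCorationalGaloisOrder.isInvariantOp {S : Set (Vec n)} {U : Subalgebra ℂ (Smash n)}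
    (hU : IsCorationalGaloisOrder Φ S U) {X : Smash n} (hX : X ∈ U) : IsInvariantOp Φ X := by
  obtain ⟨𝒳, -, h, rfl⟩ := hU
  rw [isInvariantOp_iff]
  intro g hg
  have : Algebra.adjoin ℂ (Set.range (ofGamma Φ) ∪ 𝒳) ≤
      AlgHom.equalizer (smashAct g) (AlgHom.id ℂ (Smash n)) := by
    refine Algebra.adjoin_le ?_
    rintro X (⟨γ, rfl⟩ | hX)
    · exact isInvariantOp_iff.mp (isInvariantOp_ofGamma γ) g hg
    · exact isInvariantOp_iff.mp (h X hX).1 g hg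
  exact this hX

theorem IsInvariantOp.dagger_coeff {X : Smash n} (hX : IsInvariantOp Φ X)
    {g : Vec n ≃ₗ[ℂ] Vec n} (hg : g ∈ reflGroup Φ) (y : Vec n) :
    ratAct g ((dagger X).unop.coeff (ofAdd y)) = (dagger X).unop.coeff (ofAdd (g y)) := by
  rw [GaloisBGG.dagger_coeff, GaloisBGG.dagger_coeff, ratAct_shift, ← map_neg, hX g hg]

theorem IsInvariantOp.map_mem_daggerSupport {X : Smash n} (hX : IsInvariantOp Φ X)
    {g : Vec n ≃ₗ[ℂ] Vec n} (hg : g ∈ reflGroup Φ) {y : Vec n} (hy : y ∈ daggerSupport X) :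
    g y ∈ daggerSupport X := by
  change (dagger X).unop.coeff (ofAdd (g y)) ≠ 0
  rw [← hX.dagger_coeff hg]
  exact (map_ne_zero_iff _ (ratAct g).injective).mpr hy

theorem daggerOp_ofGamma (γ : invariants Φ) (F : RatFn n) :
    daggerOp (ofGamma Φ γ) F = emb (γ : Poly n) * F := by
  have h : (dagger (ofGamma Φ γ)).unop = single 1 (emb (γ : Poly n)) := by
    have : ofGamma Φ γ = single (ofAdd 0) (emb (γ : Poly n)) := rfl
    rw [this, dagger_single, neg_zero, shift_zero]
    rfl
  rw [daggerOp, h, toOp_apply, SkewMonoidAlgebra.sum_single_index (zero_mul _), map_one]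
  rfl

theorem IsInvariantOp.ratAct_daggerOp {X : Smash n} (hX : IsInvariantOp Φ X)
    {g : Vec n ≃ₗ[ℂ] Vec n} (hg : g ∈ reflGroup Φ) (F : RatFn n) :
    ratAct g (daggerOp X F) = daggerOp X (ratAct g F) := by
  rw [daggerOp_apply, daggerOp_apply, map_sum]
  refine Finset.sum_bij (fun y _ => g y) (fun y hy => ?_) (fun _ _ _ _ e => g.injective e)
    (fun y hy => ?_) (fun y _ => ?_)
  · exact mem_daggerFinset.mpr (hX.map_mem_daggerSupport hg (mem_daggerFinset.mp hy))
  · refine ⟨g⁻¹ y, mem_daggerFinset.mpr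
      (hX.map_mem_daggerSupport (inv_mem hg) (mem_daggerFinset.mp hy)), ?_⟩
    rw [← LinearEquiv.mul_apply, mul_inv_cancel]
    rfl
  · rw [map_mul (ratAct g), hX.dagger_coeff hg, ratAct_shift]

/-! ### Relative invariants and denominators -/

/-- The roots that occur in the relative invariant of `χ`. -/
def signRoots (Φ S : Set (Vec n)) (χ : reflGroup Φ →* ℂˣ) : Set (Vec n) :=
  {α | α ∈ posRoots Φ S ∧ ∃ h : rootRefl α ∈ reflGroup Φ, χ ⟨rootRefl α, h⟩ = -1}

theorem relInvariant_eq (Φ S : Set (Vec n)) (χ : reflGroup Φ →* ℂˣ) :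
    relInvariant Φ S χ = prodLin (signRoots Φ S χ) := rfl

/-- Right multiplication of `X` by `d` multiplies the coefficient of `t_{-y}` by `t_{-y}(d)`, and
the translation `t_y` contained in the dagger undoes this. -/
theorem dagger_coeff_mul_mem_range {X : Smash n} {d : Poly n}
    (h : ∀ z, (X * ofRat (emb d)).coeff z ∈ emb.range) (y : Vec n) :
    (dagger X).unop.coeff (ofAdd y) * emb d ∈ (emb (n := n)).range := by
  obtain ⟨p, hp⟩ := h (ofAdd (-y))
  have : (X * ofRat (emb d)).coeff (ofAdd (-y)) =
      X.coeff (ofAdd (-y)) * (ofAdd (-y)) • emb d :=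
    SkewMonoidAlgebra.coeff_mul_single_one _ _ _
  rw [this] at hp
  refine ⟨polyShift y p, ?_⟩
  rw [← shift_emb, hp, map_mul (shift y), dagger_coeff]
  congr 1
  change shift y (shift (-y) _) = _
  rw [← shift_add, add_neg_cancel, shift_zero]

/-! ### Divisibility by linear forms -/

theorem linForm_irreducible {α : Vec n} (h : α ≠ 0) : Irreducible (linForm α) := by
  obtain ⟨i, hi⟩ := Function.ne_iff.mp h
  have e : linForm α = sumSMulX (Finsupp.equivFunOnFinite.symm α) := by
    rw [sumSMulX, Finsupp.linearCombination_apply, Finsupp.sum_fintype _ _ (by simp), linForm]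
    refine Finset.sum_congr rfl fun j _ => ?_
    rw [smul_eq_C_mul]
    rfl
  rw [e]
  refine irreducible_sumSMulX _ ⟨i, ?_⟩ fun r hr => ?_
  · rw [Finsupp.mem_support_iff]
    exact hi
  · obtain ⟨s, hs⟩ := hr i
    refine IsUnit.mk0 r fun h0 => hi ?_
    rw [h0, zero_mul] at hs
    exact hs

theorem linForm_prime {α : Vec n} (h : α ≠ 0) : Prime (linForm α) :=
  (linForm_irreducible h).prime

theorem exists_smul_of_linForm_dvd {α β : Vec n} (hα : α ≠ 0) (h : linForm α ∣ linForm β) :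
    ∃ c : ℂ, β = c • α := by
  obtain ⟨i, hi⟩ := Function.ne_iff.mp hα
  rw [Pi.zero_apply] at hi
  obtain ⟨r, hr⟩ := h
  refine ⟨β i / α i, funext fun j => ?_⟩
  -- The point lies on the hyperplane of `α`, so `β` vanishes at it.
  have := congrArg (eval (Pi.single j (α i) - Pi.single i (α j))) hr
  rw [map_mul, eval_linForm, eval_linForm, dotProduct_sub, dotProduct_sub, dotProduct_single,
    dotProduct_single, dotProduct_single, dotProduct_single, mul_comm (α j), sub_self, zero_mul,
    sub_eq_zero] at this
  rw [Pi.smul_apply, smul_eq_mul, div_mul_eq_mul_div, eq_div_iff hi, this]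

/-- A set of nonisotropic vectors, no two of which are proportional. -/
structure IsReducedSet (A : Set (Vec n)) : Prop where
  finite : A.Finite
  nonisotropic : ∀ α ∈ A, α ⬝ᵥ α ≠ 0
  eq_of_smul : ∀ α ∈ A, ∀ β ∈ A, ∀ c : ℂ, β = c • α → α = β

theorem IsReducedSet.mono {A B : Set (Vec n)} (hA : IsReducedSet A) (h : B ⊆ A) :
    IsReducedSet B :=
  ⟨hA.finite.subset h, fun α hα => hA.nonisotropic α (h hα),
    fun α hα β hβ => hA.eq_of_smul α (h hα) β (h hβ)⟩

theorem IsReducedSet.ne_zero {A : Set (Vec n)} (hA : IsReducedSet A) {α : Vec n} (hα : α ∈ A) :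
    α ≠ 0 := fun h => hA.nonisotropic α hα (by rw [h, dotProduct_zero])

theorem IsReducedSet.not_dvd_prodLin {A : Set (Vec n)} (hA : IsReducedSet A) {α : Vec n}
    (hα : α ∈ A) : ¬ linForm α ∣ prodLin (A \ {α}) := by
  refine finprod_mem_induction (fun p => ¬ linForm α ∣ p)
    (fun h => (linForm_prime (hA.ne_zero hα)).not_isUnit (isUnit_of_dvd_one h))
    (fun p q hp hq h => ?_) fun β hβ h => ?_
  · exact ((linForm_prime (hA.ne_zero hα)).dvd_or_dvd h).elim hp hq
  · obtain ⟨c, hc⟩ := exists_smul_of_linForm_dvd (hA.ne_zero hα) h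
    exact hβ.2 (hA.eq_of_smul α hα β hβ.1 c hc).symm

theorem IsReducedSet.prodLin_dvd {A : Set (Vec n)} (hA : IsReducedSet A) {q : Poly n}
    (h : ∀ α ∈ A, linForm α ∣ q) : prodLin A ∣ q := by
  rw [prodLin, finprod_mem_eq_finite_toFinset_prod _ hA.finite]
  refine Finset.prod_dvd_of_isRelPrime (fun α hα β hβ hne => ?_) fun α hα =>
    h α (hA.finite.mem_toFinset.mp hα)
  rw [Set.Finite.coe_toFinset] at hα hβ
  change IsRelPrime (linForm α) (linForm β)
  rw [(linForm_irreducible (hA.ne_zero hα)).isRelPrime_iff_not_dvd]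
  intro hd
  obtain ⟨c, hc⟩ := exists_smul_of_linForm_dvd (hA.ne_zero hα) hd
  exact hne (hA.eq_of_smul α hα β hβ c hc)

theorem prodLin_sdiff {A B : Set (Vec n)} (hA : A.Finite) (h : B ⊆ A) :
    prodLin A = prodLin B * prodLin (A \ B) := by
  rw [← prodLin_union (hA.subset h) (hA.subset Set.sdiff_subset) Set.disjoint_sdiff_right,
    Set.union_sdiff_cancel h]

/-- A rational function that is invariant under `s_α` has no simple pole along `α`. -/
theorem linForm_dvd_of_invariant {α : Vec n} (hα : α ⬝ᵥ α ≠ 0) {F : RatFn n}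
    (hF : ratAct (rootRefl α) F = F) {d q : Poly n} (hd : ¬ linForm α ∣ d)
    (hq : F * emb (linForm α * d) = emb q) : linForm α ∣ q := by
  have hα0 : α ≠ 0 := fun h => hα (by rw [h, dotProduct_zero])
  set s := polyAct (rootRefl α)
  have h1 : F * (-emb (linForm α) * emb (s d)) = emb (s q) := by
    have := congrArg (ratAct (rootRefl α)) hq
    rwa [map_mul (ratAct (rootRefl α)), hF, ratAct_emb, ratAct_emb, map_mul s, map_mul,
      polyAct_rootRefl_linForm, rootRefl_self hα, linForm_neg, map_neg] at this
  have h2 : q * s d = -(s q * d) := by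
    refine emb_injective ?_
    rw [map_neg, map_mul, map_mul, ← h1, ← hq, map_mul]
    ring
  have h3 : linForm α ∣ 2 * (q * d) := by
    -- By `h2` the terms `s q * d` and `q * s d` cancel, and both differences are divisible by `α`.
    have e : 2 * (q * d) = (q - s q) * d + q * (d - s d) := by linear_combination h2
    rw [e]
    exact dvd_add ((linForm_dvd_sub α q).mul_right _) ((linForm_dvd_sub α d).mul_left _)
  have hp := linForm_prime hα0
  rcases hp.dvd_or_dvd h3 with h4 | h4
  · have : IsUnit (2 : Poly n) := by
      have := (isUnit_iff_ne_zero.mpr (two_ne_zero (α := ℂ))).map (C : ℂ →+* Poly n)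
      rwa [map_ofNat] at this
    exact absurd (isUnit_of_dvd_unit h4 this) hp.not_isUnit
  · exact (hp.dvd_or_dvd h4).resolve_right hd

/-- Each root of `B` occurs once in the denominator, where invariance forbids a simple pole. The
linear forms are pairwise coprime, so their product divides the numerator. -/
theorem IsReducedSet.mul_prodLin_sdiff_mem_range {A B : Set (Vec n)} (hA : IsReducedSet A)
    (hBA : B ⊆ A) {F : RatFn n} (hF : F * emb (prodLin A) ∈ (emb (n := n)).range)
    (hB : ∀ α ∈ B, ratAct (rootRefl α) F = F) :
    F * emb (prodLin (A \ B)) ∈ (emb (n := n)).range := by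
  obtain ⟨q, hq⟩ := hF
  have hdvd : prodLin B ∣ q := (hA.mono hBA).prodLin_dvd fun α hα => by
    refine linForm_dvd_of_invariant (hA.nonisotropic α (hBA hα)) (hB α hα)
      (hA.not_dvd_prodLin (hBA hα)) ?_
    rw [hq]
    have e : prodLin {α} = linForm α := finprod_mem_singleton
    rw [prodLin_sdiff hA.finite (Set.singleton_subset_iff.mpr (hBA hα)), e]
  obtain ⟨r, rfl⟩ := hdvd
  refine ⟨r, ?_⟩
  have h0 : emb (prodLin B) ≠ 0 :=
    emb_ne_zero (prodLin_ne_zero fun α hα => (hA.mono hBA).ne_zero hα)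
  refine mul_left_cancel₀ h0 ?_
  rw [← map_mul, hq, prodLin_sdiff hA.finite hBA, map_mul]
  ring

/-! ### Positive roots of `Φ` -/

section

variable {Φ S Ω : Set (Vec n)}

theorem IsBase.eq_of_smul (hΦ : IsRootSystem Φ) (hS : IsBase Φ S) {α β : Vec n}
    (hα : α ∈ posRoots Φ S) (hβ : β ∈ posRoots Φ S) {c : ℂ} (h : β = c • α) : α = β := by
  rcases (hΦ.reduced α hα.1 c).mp (h ▸ hβ.1) with rfl | rfl
  · rw [h, one_smul]
  · rw [neg_one_smul] at h
    have h0 := cone_pointed hS.linearIndependent hα.2 (h ▸ hβ.2)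
    exact absurd (by rw [h0, dotProduct_zero]) (hΦ.nonisotropic α hα.1)

theorem IsBase.isReducedSet (hΦ : IsRootSystem Φ) (hS : IsBase Φ S) {A : Set (Vec n)}
    (hA : A ⊆ posRoots Φ S) : IsReducedSet A :=
  ⟨hΦ.finite.subset fun _ h => (hA h).1, fun _ h => hΦ.nonisotropic _ (hA h).1,
    fun _ hα _ hβ _ h => hS.eq_of_smul hΦ (hA hα) (hA hβ) h⟩

theorem IsBase.mem_pos (hΦ : IsRootSystem Φ) (hG : Finite (reflGroup Φ)) (hS : IsBase Φ S)
    (hΩ : Ω ⊆ S) {α : Vec n} (hα : α ∈ posRoots Φ S) (hα' : α ∈ subsystem Ω) : α ∈ Pos Ω := by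
  refine ((hS.simpleSystem hΦ hG hΩ).pos_or_neg hα').resolve_right fun h => ?_
  have h0 := cone_pointed hS.linearIndependent hα.2 (Submodule.span_mono hΩ h.2)
  exact hΦ.nonisotropic α hα.1 (by rw [h0, dotProduct_zero])

theorem signRoots_subset (Φ S : Set (Vec n)) (χ : reflGroup Φ →* ℂˣ) :
    signRoots Φ S χ ⊆ posRoots Φ S := fun _ h => h.1

/-! ### `X†` preserves `Γ` -/

/-- `X†(γ)` has at most simple poles, all along roots of `d_χ`. It is invariant under the
reflections in these roots, so it has no poles at all. -/
theorem mem_rightHartwigOrder_of_hasRationalDenominator (hΦ : IsRootSystem Φ) (hS : IsBase Φ S)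
    {X : Smash n} (hX : IsInvariantOp Φ X) (hd : HasRationalDenominator Φ S X) :
    X ∈ rightHartwigOrder Φ := by
  intro γ
  obtain ⟨χ, hχ⟩ := hd
  set D := signRoots Φ S χ
  have hD : IsReducedSet D := hS.isReducedSet hΦ (signRoots_subset Φ S χ)
  have hγ : ∀ g ∈ reflGroup Φ, ratAct g (daggerOp X (emb (γ : Poly n))) =
      daggerOp X (emb (γ : Poly n)) := fun g hg => by
    rw [hX.ratAct_daggerOp hg, ratAct_emb, γ.2 g hg]
  have hrange : daggerOp X (emb (γ : Poly n)) * emb (prodLin D) ∈ (emb (n := n)).range := by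
    rw [daggerOp_apply, Finset.sum_mul]
    refine sum_mem fun y _ => ?_
    rw [mul_right_comm, shift_emb]
    exact mul_mem (dagger_coeff_mul_mem_range hχ y) ⟨_, rfl⟩
  have := hD.mul_prodLin_sdiff_mem_range subset_rfl hrange fun α hα =>
    hγ _ (rootRefl_mem (signRoots_subset Φ S χ hα).1)
  rw [sdiff_self, prodLin, Set.bot_eq_empty, finprod_mem_empty, map_one, mul_one] at this
  obtain ⟨p, hp⟩ := this
  refine ⟨⟨p, fun g hg => emb_injective ?_⟩, hp.symm⟩
  rw [← ratAct_emb, hp, hγ g hg]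

theorem ofGamma_mem_rightHartwigOrder (γ : invariants Φ) : ofGamma Φ γ ∈ rightHartwigOrder Φ :=
  fun δ => ⟨γ * δ, by rw [daggerOp_ofGamma, ← map_mul]; rfl⟩

theorem IsCorationalGaloisOrder.le_rightHartwigOrder (hΦ : IsRootSystem Φ) (hS : IsBase Φ S)
    {U : Subalgebra ℂ (Smash n)} (hU : IsCorationalGaloisOrder Φ S U) :
    U ≤ rightHartwigOrder Φ := by
  obtain ⟨𝒳, -, h, rfl⟩ := hU
  refine Algebra.adjoin_le ?_
  rintro X (⟨γ, rfl⟩ | hX)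
  · exact ofGamma_mem_rightHartwigOrder γ
  · exact mem_rightHartwigOrder_of_hasRationalDenominator hΦ hS (h X hX).1 (h X hX).2

/-! ### Regularity of the coefficients of the formula -/

/-- The poles of `h_y` are simple and lie along roots of `d_χ`; those vanishing at `y` drop out, as
their reflections fix `h_y`. Of the rest, those passing through `u` belong to the subsystem of the
simple roots at `u`, and the product in `F_y` cancels them. -/
theorem isRegularAt_formulaCoeff (hΦ : IsRootSystem Φ) (hG : Finite (reflGroup Φ))
    (hS : IsBase Φ S) (hΩ : Ω ⊆ S) {X : Smash n} (hX : IsInvariantOp Φ X)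
    (hd : HasRationalDenominator Φ S X) {u : Vec n} (hu : IsStandard Ω u)
    (huΦ : rootsAt Φ u ⊆ subsystem Ω) (y : Vec n) :
    IsRegularAt u (formulaCoeff (rootsAt Ω u) X y) := by
  obtain ⟨χ, hχ⟩ := hd
  set Θ := rootsAt Ω u with hΘ
  have hΘΩ : Θ ⊆ Ω := rootsAt_subset Ω u
  have hDpos := signRoots_subset Φ S χ
  set D := signRoots Φ S χ
  have hD : IsReducedSet D := hS.isReducedSet hΦ hDpos
  set E := {α | α ∈ posRoots (subsystem Θ) Θ ∧ α ⬝ᵥ y ≠ 0} with hE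
  have hEfin : E.Finite := (hS.simpleSystem hΦ hG (hΘΩ.trans hΩ)).pos_finite.subset fun _ h => h.1
  set B := {α | α ∈ D ∧ α ⬝ᵥ y = 0}
  set A₁ := {α | α ∈ D \ B ∧ α ⬝ᵥ u = 0}
  have h1 := hD.mul_prodLin_sdiff_mem_range (B := B) (fun _ h => h.1)
    (dagger_coeff_mul_mem_range hχ y) fun α hα => by
      rw [hX.dagger_coeff (rootRefl_mem (hDpos hα.1).1), rootRefl_of_dotProduct_eq_zero hα.2]
  have hA₁ : A₁ ⊆ E := fun α hα => by
    refine ⟨hS.mem_pos hΦ hG (hΘΩ.trans hΩ) (hDpos hα.1.1) ?_, fun h => hα.1.2 ⟨hα.1.1, h⟩⟩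
    rw [hΘ, ← hu.rootsAt_eq]
    exact ⟨huΦ ⟨(hDpos hα.1.1).1, hα.2⟩, hα.2⟩
  have hDB : (D \ B).Finite := hD.finite.subset Set.sdiff_subset
  obtain ⟨p, hp⟩ := h1
  refine ⟨p * prodLin (E \ A₁), prodLin ((D \ B) \ A₁), eval_prodLin_ne_zero fun α hα h =>
    hα.2 ⟨hα.1, h⟩, ?_⟩
  have e1 : emb (prodLin E) = emb (prodLin A₁) * emb (prodLin (E \ A₁)) := by
    rw [← map_mul, ← prodLin_sdiff hEfin hA₁]
  have e2 : emb (prodLin (D \ B)) = emb (prodLin A₁) * emb (prodLin ((D \ B) \ A₁)) := by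
    rw [← map_mul, ← prodLin_sdiff hDB fun _ h => h.1]
  change _ * emb (prodLin E) * emb (prodLin ((D \ B) \ A₁)) = emb (p * prodLin (E \ A₁))
  rw [map_mul, hp, e1, e2]
  ring

end

/-! ### Orbit sums and divided differences -/

section

variable {Θ : Set (Vec n)}

/-- The fibre is a left coset of the stabilizer of `y`, which is the group of the simple roots at
`y` because `y` is standard. -/
theorem SimpleSystem.card_fiber (h : SimpleSystem Θ) [DecidableEq (Vec n)] [Fintype (reflGroup Θ)]
    {y z : Vec n} (hy : IsStandard Θ y) [Fintype (reflGroup (rootsAt Θ y))]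
    (hz : ∃ g ∈ reflGroup Θ, g z = y) :
    (Finset.univ.filter fun u : reflGroup Θ => (u : Vec n ≃ₗ[ℂ] Vec n) y = z).card =
      Fintype.card (reflGroup (rootsAt Θ y)) := by
  obtain ⟨g, hg, hgz⟩ := hz
  have hgy : g⁻¹ y = z := by
    rw [← hgz, ← LinearEquiv.mul_apply, inv_mul_cancel]; rfl
  have hsub : reflGroup (rootsAt Θ y) ≤ reflGroup Θ := reflGroup_mono (rootsAt_subset Θ y)
  rw [← Finset.card_univ]
  symm
  refine Finset.card_bij (fun s _ => ⟨g⁻¹ * s, mul_mem (inv_mem hg) (hsub s.2)⟩) (fun s _ => ?_)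
    (fun s _ t _ e => Subtype.ext (mul_left_cancel (Subtype.ext_iff.mp e))) fun u hu => ?_
  · rw [Finset.mem_filter]
    refine ⟨Finset.mem_univ _, ?_⟩
    change (g⁻¹ * (s : Vec n ≃ₗ[ℂ] Vec n)) y = z
    rw [LinearEquiv.mul_apply, fixes_of_mem_reflGroup_rootsAt s.2, hgy]
  · rw [Finset.mem_filter] at hu
    refine ⟨⟨g * u, h.stabilizer hy (mul_mem hg u.2) ?_⟩, Finset.mem_univ _, Subtype.ext ?_⟩
    · rw [LinearEquiv.mul_apply, hu.2, hgz]
    · exact inv_mul_cancel_left _ _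

theorem SimpleSystem.ratAct_prodLin_support (h : SimpleSystem Θ) {y α : Vec n}
    (hα : α ∈ rootsAt Θ y) :
    polyAct (rootRefl α) (prodLin {β | β ∈ Pos Θ ∧ β ⬝ᵥ y ≠ 0}) =
      prodLin {β | β ∈ Pos Θ ∧ β ⬝ᵥ y ≠ 0} := by
  refine polyAct_prodLin (h.pos_finite.subset fun _ hβ => hβ.1) (rootRefl_mem hα.1)
    fun β hβ => ⟨h.rootRefl_pos hα.1 hβ.1 fun e => hβ.2 (e ▸ hα.2), ?_⟩
  have e := dotProduct_map_map (rootRefl_mem hα.1) β y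
  rw [rootRefl_of_dotProduct_eq_zero hα.2] at e
  rw [e]
  exact hβ.2

/-- A sum over a stable set is a sum of divided differences at representatives of the orbits. -/
theorem SimpleSystem.orbit_sum (h : SimpleSystem Θ) {H : Vec n → RatFn n}
    (hH : ∀ g ∈ reflGroup Θ, ∀ z, ratAct g (H z) = H (g z)) {A Y : Finset (Vec n)}
    (hA : ∀ g ∈ reflGroup Θ, ∀ z ∈ A, g z ∈ A) (hY : IsStandardReps Θ A Y)
    {w : Vec n → Vec n ≃ₗ[ℂ] Vec n} (hw : ∀ y ∈ Y, IsLongest Θ (minReps Θ y) (w y)) :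
    ∑ z ∈ A, H z = ∑ y ∈ Y,
      ratDiv Θ (w y) (H y * emb (prodLin {α | α ∈ Pos Θ ∧ α ⬝ᵥ y ≠ 0})) := by
  classical
  have := h.finiteGroup
  have := Fintype.ofFinite (reflGroup Θ)
  -- Multiplied by the order of the stabilizer of `y`, the divided difference becomes the sum of
  -- `H(u y)` over the whole group, where each point of the orbit occurs that many times.
  have key : ∀ y ∈ Y, ratDiv Θ (w y) (H y * emb (prodLin {α | α ∈ Pos Θ ∧ α ⬝ᵥ y ≠ 0})) =
      ∑ z ∈ A, if ∃ g ∈ reflGroup Θ, g z = y then H z else 0 := by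
    intro y hy
    obtain ⟨hyA, hys⟩ := hY.1 y hy
    have : Finite (reflGroup (rootsAt Θ y)) := (h.mono (rootsAt_subset Θ y)).finiteGroup
    have := Fintype.ofFinite (reflGroup (rootsAt Θ y))
    have hc : (Fintype.card (reflGroup (rootsAt Θ y)) : RatFn n) ≠ 0 :=
      Nat.cast_ne_zero.mpr Fintype.card_ne_zero
    have hp : emb (prodLin {α | α ∈ Pos Θ ∧ α ⬝ᵥ y ≠ 0}) ≠ 0 :=
      emb_ne_zero (prodLin_ne_zero fun α hα => h.ne_zero hα.1.1)
    refine mul_left_cancel₀ hc ?_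
    rw [h.card_mul_ratDiv_minRep hys rfl (hw y hy), Finset.mul_sum]
    · have e1 : ∀ u : reflGroup Θ, ratAct u (H y * emb (prodLin {α | α ∈ Pos Θ ∧ α ⬝ᵥ y ≠ 0}) /
          emb (prodLin {α | α ∈ Pos Θ ∧ α ⬝ᵥ y ≠ 0})) = H ((u : Vec n ≃ₗ[ℂ] Vec n) y) := by
        intro u
        rw [mul_div_cancel_right₀ _ hp, hH u u.2]
      rw [Finset.sum_congr rfl fun u _ => e1 u,
        ← Finset.sum_fiberwise_of_maps_to (s := Finset.univ) (t := A)
          (g := fun u : reflGroup Θ => (u : Vec n ≃ₗ[ℂ] Vec n) y)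
          fun u _ => hA u u.2 y hyA]
      refine Finset.sum_congr rfl fun z _ => ?_
      rw [Finset.sum_congr rfl (g := fun _ => H z)
        fun u hu => by rw [(Finset.mem_filter.mp hu).2], Finset.sum_const, nsmul_eq_mul]
      by_cases hz : ∃ g ∈ reflGroup Θ, g z = y
      · rw [if_pos hz, h.card_fiber hys hz]
      · rw [if_neg hz, mul_zero, Finset.filter_eq_empty_iff.mpr, Finset.card_empty, Nat.cast_zero,
          zero_mul]
        intro u _ hu
        refine hz ⟨u⁻¹, inv_mem u.2, ?_⟩
        rw [← hu, ← LinearEquiv.mul_apply, inv_mul_cancel]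
        rfl
    · intro α hα
      rw [map_mul (ratAct (rootRefl α)), hH _ (rootRefl_mem hα.1),
        rootRefl_of_dotProduct_eq_zero hα.2, ratAct_emb, h.ratAct_prodLin_support hα]
  rw [Finset.sum_congr rfl key, Finset.sum_comm]
  refine Finset.sum_congr rfl fun z hz => ?_
  obtain ⟨y, ⟨hy, hy'⟩, huniq⟩ := hY.2 z hz
  rw [Finset.sum_eq_single_of_mem y hy, if_pos hy']
  intro b hb hne
  exact if_neg fun hb' => hne (huniq b ⟨hb, hb'⟩)

/-- A translation along the hyperplane of `α` fixes the linear form `α` and commutes with `s_α`. -/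
theorem shift_nablaRat {α u : Vec n} (hα : α ⬝ᵥ u = 0) (F : RatFn n) :
    shift u (nablaRat α F) = nablaRat α (shift u F) := by
  have e : polyShift u (linForm α) = linForm α := MvPolynomial.funext fun x => by
    rw [eval_polyShift, eval_linForm, eval_linForm, dotProduct_add, hα, add_zero]
  have e2 : ratAct (rootRefl α) (shift u F) = shift u (ratAct (rootRefl α) F) := by
    rw [ratAct_shift, rootRefl_of_dotProduct_eq_zero hα]
  rw [nablaRat_apply, nablaRat_apply, e2]
  rw [map_mul (shift u), map_inv₀ (shift u), map_sub (shift u), lin, shift_emb, e]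

theorem shift_wordOp {u : Vec n} {l : List (Vec n)} (hl : ∀ α ∈ l, α ⬝ᵥ u = 0) (F : RatFn n) :
    shift u (wordOp l F) = wordOp l (shift u F) := by
  induction l with
  | nil => rfl
  | cons α l ih =>
    rw [wordOp_cons, wordOp_cons, shift_nablaRat (hl α List.mem_cons_self),
      ih fun β hβ => hl β (List.mem_cons_of_mem _ hβ)]

/-! ### The explicit formula -/

/-- Evaluation at an invariant polynomial, as a functional on `Γ*`. -/
def GammaDual.valAt {Φ : Set (Vec n)} (γ : invariants Φ) : GammaDual Φ →ₗ[ℂ] ℂ where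
  toFun φ := φ.val γ
  map_add' _ _ := rfl
  map_smul' _ _ := rfl

variable {Φ S Ω : Set (Vec n)}

theorem psValue₂_eq (h : SimpleSystem Ω) [Fintype (reflGroup Ω)] (ν τ : reflGroup Ω) {u : Vec n}
    {F : RatFn n} (hF : IsRegularAt u F) {p q : Poly n} (hq : q ∈ invariants Ω)
    (hq0 : eval 0 q = 1) (hpq : shift u F * emb q = emb p) :
    psValue₂ Ω ν τ u F = ∑ μ : reflGroup Ω, lrCoeff Ω ν μ τ * divEval h μ p := by
  rw [psValue₂, finsum_eq_sum_of_fintype]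
  exact Finset.sum_congr rfl fun μ _ => by rw [h.psValue_eq μ hF hq hq0 hpq]

/-- The value at `0` of a divided difference of `t_u(F) f`, in terms of the values `D_{ν,τ}^u(F)`. -/
theorem SimpleSystem.evalRat_ratDiv_mul (h : SimpleSystem Ω) [Fintype (reflGroup Ω)]
    (τ : reflGroup Ω) {u : Vec n} {F : RatFn n} (hF : IsRegularAt u F) (f : Poly n) :
    IsRegularAt 0 (ratDiv Ω τ (shift u F * emb f)) ∧
      evalRat 0 (ratDiv Ω τ (shift u F * emb f)) =
        ∑ ν : reflGroup Ω, psValue₂ Ω ν τ u F * divEval h ν f := by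
  obtain ⟨p, q, hq, hq0, hpq⟩ := h.exists_invariant_denominator hF.shift.1
  have e : shift u F * emb f * emb q = emb (p * f) := by rw [map_mul, ← hpq]; ring
  obtain ⟨h1, h2⟩ := h.evalRat_ratDiv τ hq hq0 e
  refine ⟨h1, ?_⟩
  rw [h2, divEval_mul]
  exact Finset.sum_congr rfl fun ν _ => by rw [psValue₂_eq h ν τ hF hq hq0 hpq]

/-- Invariance of `X` and of `F` makes `y ↦ h_y t_y(F)` equivariant, so its sum over the support
splits into orbit sums. The product of roots required by each of these is the one built into `F_y`.
-/
theorem daggerOp_eq_sum_ratDiv {X : Smash n} (hX : IsInvariantOp Φ X) {Θ : Set (Vec n)}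
    (h : SimpleSystem Θ) (hΘ : Θ ⊆ Φ) {Y : Finset (Vec n)}
    (hY : IsStandardReps Θ (daggerSupport X) Y) {w : Vec n → Vec n ≃ₗ[ℂ] Vec n}
    (hw : ∀ y ∈ Y, IsLongest Θ (minReps Θ y) (w y)) {F : RatFn n}
    (hF : ∀ g ∈ reflGroup Θ, ratAct g F = F) :
    daggerOp X F = ∑ y ∈ Y, ratDiv Θ (w y) (formulaCoeff Θ X y * shift y F) := by
  have hG := reflGroup_mono hΘ
  have hA : (daggerFinset X : Set (Vec n)) = daggerSupport X :=
    Set.ext fun y => mem_daggerFinset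
  rw [daggerOp_apply, h.orbit_sum (Y := Y) (w := w)
    (H := fun y => (dagger X).unop.coeff (ofAdd y) * shift y F) _ _ (hA ▸ hY) hw]
  · refine Finset.sum_congr rfl fun y _ => congrArg _ ?_
    rw [formulaCoeff, mul_right_comm]
  · intro g hg z
    rw [map_mul (ratAct g), hX.dagger_coeff (hG hg), ratAct_shift, hF g hg]
  · intro g hg z hz
    exact mem_daggerFinset.mpr (hX.map_mem_daggerSupport (hG hg) (mem_daggerFinset.mp hz))

/-- Apply `∂_σ` at `0` to `t_u X†(γ)`, with `X†(γ)` written as a sum of divided differences for the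
stabilizer of `u`. -/
theorem dualAct_bgg (hΦ : IsRootSystem Φ) (hG : Finite (reflGroup Φ)) (hS : IsBase Φ S)
    (hΩ : Ω ⊆ S) (X : rightHartwigOrder Φ) (hX : IsInvariantOp Φ X.1)
    (hd : HasRationalDenominator Φ S X.1) {u : Vec n} (hu : IsStandard Ω u)
    (huΦ : rootsAt Φ u ⊆ subsystem Ω) {Y : Finset (Vec n)}
    (hY : IsStandardReps (rootsAt Ω u) (daggerSupport X.1) Y) {w : Vec n → reflGroup Ω}
    (hw : ∀ y ∈ Y, IsLongest (rootsAt Ω u) (minReps (rootsAt Ω u) y) (w y)) (σ : reflGroup Ω) :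
    dualAct X (bgg Φ Ω σ u) =
      ∑ y ∈ Y with weylLength Ω (σ * w y) = weylLength Ω σ + weylLength Ω (w y),
        ∑ᶠ ν : reflGroup Ω, psValue₂ Ω ν (σ * w y) u (formulaCoeff (rootsAt Ω u) X.1 y) •
          bgg Φ Ω ν (u + y) := by
  have h := hS.simpleSystem hΦ hG hΩ
  have := h.finiteGroup
  have := Fintype.ofFinite (reflGroup Ω)
  have hΘΩ := rootsAt_subset Ω u
  set Θ := rootsAt Ω u with hΘ
  have hΘs := h.mono hΘΩ
  have hreg : ∀ y, IsRegularAt u (formulaCoeff Θ X.1 y) := fun y =>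
    isRegularAt_formulaCoeff hΦ hG hS hΩ hX hd hu huΦ y
  refine GammaDual.ext fun γ => ?_
  have hΘΦ : Θ ⊆ Φ := (hΘΩ.trans hΩ).trans hS.subset
  have e1 : emb (polyShift u (daggerGamma X γ : Poly n)) = ∑ y ∈ Y, ratDiv Ω (w y)
      (shift u (formulaCoeff Θ X.1 y) * emb (polyShift (u + y) γ)) := by
    rw [← shift_emb, daggerGamma_spec, daggerOp_eq_sum_ratDiv hX hΘs hΘΦ hY hw
      fun g hg => by rw [ratAct_emb, γ.2 g (reflGroup_mono hΘΦ hg)], map_sum (shift u)]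
    refine Finset.sum_congr rfl fun y hy => ?_
    have hwy := (hw y hy).1.1
    -- The letters of this word vanish at `u`, which lets `t_u` pass through the divided difference.
    have hz : ∀ α ∈ reducedWord Θ (w y), α ⬝ᵥ u = 0 := fun α hα =>
      ((reducedWord_spec hwy).1.1 α hα).2
    rw [ratDiv, shift_wordOp hz, ← ratDiv, h.ratDiv_sub hΘΩ hwy, map_mul (shift u), ← shift_add,
      shift_emb]
  -- The composite is `∂_{σω^y}` or zero according to lengths. Regularity of each term is recorded
  -- because evaluation at `0` is additive only on regular functions; the total being a polynomial
  -- is not enough.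
  have e2 : ∀ y ∈ Y, IsRegularAt 0 (ratDiv Ω σ (ratDiv Ω (w y)
      (shift u (formulaCoeff Θ X.1 y) * emb (polyShift (u + y) γ)))) ∧
      evalRat 0 (ratDiv Ω σ (ratDiv Ω (w y)
        (shift u (formulaCoeff Θ X.1 y) * emb (polyShift (u + y) γ)))) =
      if weylLength Ω (σ * w y) = weylLength Ω σ + weylLength Ω (w y) then
        ∑ ν : reflGroup Ω, psValue₂ Ω ν (σ * w y) u (formulaCoeff Θ X.1 y) *
          divEval h ν (polyShift (u + y) γ) else 0 := by
    intro y hy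
    by_cases hl : weylLength Ω (σ * w y) = weylLength Ω σ + weylLength Ω (w y)
    · rw [h.ratDiv_mul σ.2 (w y).2 hl, if_pos hl]
      exact h.evalRat_ratDiv_mul (σ * w y) (hreg y) _
    · rw [h.ratDiv_mul_eq_zero σ.2 (w y).2 hl, if_neg hl, ← map_zero emb]
      exact ⟨isRegularAt_emb 0 0, by rw [evalRat_emb, map_zero]⟩
  have e3 : divEval h σ (polyShift u (daggerGamma X γ : Poly n)) =
      evalRat 0 (ratDiv Ω σ (emb (polyShift u (daggerGamma X γ : Poly n)))) :=
    (h.evalRat_ratDiv σ (one_mem _) (map_one _) (by rw [map_one, mul_one])).2.symm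
  rw [dualAct_val, bgg_val h, e3, e1, map_sum, (IsRegularAt.sum fun y hy => (e2 y hy).1).2,
    Finset.sum_congr rfl fun y hy => (e2 y hy).2, ← Finset.sum_filter]
  change _ = GammaDual.valAt γ _
  rw [map_sum]
  refine Finset.sum_congr rfl fun y _ => ?_
  rw [finsum_eq_sum_of_fintype, map_sum]
  refine Finset.sum_congr rfl fun ν _ => ?_
  rw [map_smul, smul_eq_mul]
  congr 1
  exact (bgg_val h ν (u + y) γ).symm

end

/-! ### Gelfand–Tsetlin modules -/

/-- Powers of distinct maximal ideals are coprime. Here `b` will act as a projector: it annihilates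
the components at `s` and is the identity on the one at `𝔪`. -/
theorem exists_mem_pow_of_notMem {R : Type*} [CommSemiring R] (𝔪 : MaximalSpectrum R)
    (s : Finset (MaximalSpectrum R)) (hs : 𝔪 ∉ s) (k : ℕ) :
    ∃ a ∈ 𝔪.asIdeal ^ k, ∃ b : R, (∀ 𝔫 ∈ s, b ∈ 𝔫.asIdeal ^ k) ∧ a + b = 1 := by
  have h : IsCoprime (𝔪.asIdeal ^ k) (∏ 𝔫 ∈ s, 𝔫.asIdeal ^ k) := by
    refine IsCoprime.prod_right fun 𝔫 h𝔫 => IsCoprime.pow ?_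
    have := 𝔪.isMaximal
    have := 𝔫.isMaximal
    exact Ideal.isCoprime_of_isMaximal fun e => hs (MaximalSpectrum.ext e ▸ h𝔫)
  obtain ⟨a, ha, b, hb, e⟩ := Ideal.isCoprime_iff_exists.mp h
  exact ⟨a, ha, b, fun 𝔫 h𝔫 => (Finset.inf_le (f := fun 𝔫 : MaximalSpectrum R => 𝔫.asIdeal ^ k) h𝔫)
    (Ideal.prod_le_inf hb), e⟩

section

variable {R A M : Type*} [CommSemiring R] [Semiring A] [AddCommMonoid M] [Module A M] {j : R →+* A}

theorem exists_pow_smul_eq_zero (x : DirectSum (MaximalSpectrum R)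
      fun 𝔪 => weightSpace j M 𝔪.asIdeal) :
    ∃ k : ℕ, ∀ l ≥ k, ∀ 𝔪, ∀ r ∈ 𝔪.asIdeal ^ l, j r • (x 𝔪 : M) = 0 := by
  classical
  choose k hk using fun 𝔪 => (x 𝔪).2
  refine ⟨x.support.sup k, fun l hl 𝔪 r hr => ?_⟩
  by_cases h : 𝔪 ∈ x.support
  · exact hk 𝔪 r (Ideal.pow_le_pow_right ((Finset.le_sup h).trans hl) hr)
  · rw [DFinsupp.notMem_support_iff.mp h, ZeroMemClass.coe_zero, smul_zero]

/-- One ring element recovers the component at `𝔪` from the total sum. Using the same element for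
both `x` and `y` avoids subtraction, which `M` need not have. -/
theorem weightSpace_injective [DecidableEq (MaximalSpectrum R)] :
    Function.Injective (DirectSum.coeAddMonoidHom
      fun 𝔪 : MaximalSpectrum R => weightSpace j M 𝔪.asIdeal) := by
  classical
  intro x y hxy
  refine DFinsupp.ext fun 𝔪 => Subtype.ext ?_
  obtain ⟨k, hk⟩ := exists_pow_smul_eq_zero x
  obtain ⟨l, hl⟩ := exists_pow_smul_eq_zero y
  obtain ⟨a, ha, b, hb, hab⟩ := exists_mem_pow_of_notMem 𝔪 ((x.support ∪ y.support).erase 𝔪)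
    (Finset.notMem_erase _ _) (max k l)
  have key : ∀ z : DirectSum (MaximalSpectrum R) fun 𝔪 => weightSpace j M 𝔪.asIdeal,
      z.support ⊆ x.support ∪ y.support →
      (∀ 𝔫, ∀ r ∈ 𝔫.asIdeal ^ (max k l), j r • (z 𝔫 : M) = 0) →
      j b • DirectSum.coeAddMonoidHom (fun 𝔪 : MaximalSpectrum R => weightSpace j M 𝔪.asIdeal) z =
        z 𝔪 := by
    intro z hz hz'
    have e1 : j b • (z 𝔪 : M) = z 𝔪 := by
      conv_rhs => rw [← one_smul A (z 𝔪 : M), ← map_one j, ← hab, map_add, add_smul, hz' 𝔪 a ha,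
        zero_add]
    rw [DirectSum.coeAddMonoidHom_eq_dfinsuppSum, DFinsupp.sum, Finset.smul_sum]
    by_cases h : 𝔪 ∈ z.support
    · rw [Finset.sum_eq_single_of_mem 𝔪 h, e1]
      exact fun 𝔫 h𝔫 hne => hz' 𝔫 b (hb 𝔫 (Finset.mem_erase.mpr ⟨hne, hz h𝔫⟩))
    · rw [DFinsupp.notMem_support_iff.mp h, ZeroMemClass.coe_zero]
      exact Finset.sum_eq_zero fun 𝔫 h𝔫 => hz' 𝔫 b (hb 𝔫 (Finset.mem_erase.mpr
        ⟨fun e => h (e ▸ h𝔫), hz h𝔫⟩))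
  rw [← key x Finset.subset_union_left (hk _ (le_max_left k l)), hxy,
    key y Finset.subset_union_right (hl _ (le_max_right k l))]

/-- Directness of the sum is automatic, so only generation by weight vectors has to be checked. -/
theorem isGelfandTsetlin_of_forall_mem {N : Submodule A M}
    (h : ∀ x : N, x ∈ AddSubmonoid.closure
      (⋃ 𝔪 : MaximalSpectrum R, (weightSpace j N 𝔪.asIdeal : Set N))) :
    IsGelfandTsetlin j N := by
  let := Classical.decEq (MaximalSpectrum R)
  refine ⟨weightSpace_injective, fun x => ?_⟩
  refine AddMonoidHom.mem_mrange.mp ((AddSubmonoid.closure_le.mpr ?_) (h x))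
  refine Set.iUnion_subset fun 𝔪 y hy => ?_
  exact ⟨DirectSum.of (fun 𝔪 : MaximalSpectrum R => weightSpace j N 𝔪.asIdeal) 𝔪 ⟨y, hy⟩,
    DirectSum.coeAddMonoidHom_of _ _ _⟩

theorem isGelfandTsetlin_of_iSup {k : Type*} [Semiring k] [Module k M] {ι : Type*}
    {B : ι → Submodule k M} {N : Submodule A M} (hN : (N : Set M) = ↑(⨆ i, B i))
    (hB : ∀ i, ∀ ψ ∈ B i, ∃ 𝔪 : MaximalSpectrum R, ∃ l : ℕ, ∀ r ∈ 𝔪.asIdeal ^ l, j r • ψ = 0) :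
    IsGelfandTsetlin j N := by
  refine isGelfandTsetlin_of_forall_mem fun x => ?_
  have hmem : ∀ ψ, ψ ∈ N ↔ ψ ∈ ⨆ i, B i := fun ψ => Set.ext_iff.mp hN ψ
  suffices H : ∃ hx : (x : M) ∈ N, (⟨x, hx⟩ : N) ∈ AddSubmonoid.closure
      (⋃ 𝔪 : MaximalSpectrum R, (weightSpace j N 𝔪.asIdeal : Set N)) from H.2
  refine Submodule.iSup_induction _ (motive := fun ψ => ∃ hx : ψ ∈ N, (⟨ψ, hx⟩ : N) ∈
    AddSubmonoid.closure (⋃ 𝔪 : MaximalSpectrum R, (weightSpace j N 𝔪.asIdeal : Set N)))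
    ((hmem x).mp x.2) ?_ ?_ ?_
  · intro i ψ hψ
    obtain ⟨𝔪, l, hl⟩ := hB i ψ hψ
    exact ⟨(hmem ψ).mpr (Submodule.mem_iSup_of_mem i hψ), AddSubmonoid.subset_closure
      (Set.mem_iUnion.mpr ⟨𝔪, l, fun r hr => Subtype.ext (hl r hr)⟩)⟩
  · exact ⟨zero_mem N, zero_mem _⟩
  · rintro x y ⟨hx, hx'⟩ ⟨hy, hy'⟩
    exact ⟨add_mem hx hy, add_mem hx' hy'⟩

end

/-! ### The spaces of differential operators -/

section

variable {Φ S Ω : Set (Vec n)}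

/-- A functional that kills `I_W` is the combination of the functionals `∂_w(·)(0)` with
coefficients its values at the Schubert polynomials. -/
theorem mem_bggSpace (h : SimpleSystem Ω) {φ : Poly n →ₗ[ℂ] ℂ}
    (hφ : ∀ f ∈ coinvIdeal Ω, φ f = 0) {u : Vec n} {ψ : GammaDual Φ}
    (hψ : ∀ γ : invariants Φ, ψ.val γ = φ (polyShift u γ)) : ψ ∈ bggSpace Φ Ω u := by
  have := h.finiteGroup
  have := Fintype.ofFinite (reflGroup Ω)
  have e : ψ = ∑ w : reflGroup Ω, φ (schubert Ω w) • bgg Φ Ω w u := by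
    refine GammaDual.ext fun γ => ?_
    change _ = GammaDual.valAt γ _
    rw [hψ, map_sum]
    have h1 := hφ _ (sub_sum_schubert_mem h (polyShift u (γ : Poly n)))
    rw [map_sub, sub_eq_zero, map_sum] at h1
    rw [h1]
    refine Finset.sum_congr rfl fun w _ => ?_
    rw [map_smul, ← smul_eq_C_mul, map_smul, smul_eq_mul, smul_eq_mul, mul_comm,
      ← bgg_val (Φ := Φ) h]
    rfl
  rw [e]
  exact sum_mem fun w _ => Submodule.smul_mem _ _ (Submodule.subset_span ⟨w, w.2, rfl⟩)

/-- For invariant `γ` one has `t_{gu} γ = g(t_u γ)`, and composing a functional that kills `I_W`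
with `g` again kills `I_W`. -/
theorem bggSpace_map_le (h : SimpleSystem Ω) (hΩ : Ω ⊆ Φ) {g : Vec n ≃ₗ[ℂ] Vec n}
    (hg : g ∈ reflGroup Ω) (u : Vec n) : bggSpace Φ Ω (g u) ≤ bggSpace Φ Ω u := by
  refine Submodule.span_le.mpr ?_
  rintro _ ⟨σ, hσ, rfl⟩
  let φ : Poly n →ₗ[ℂ] ℂ := divEval h ⟨σ, hσ⟩ ∘ₗ (polyAct g).toLinearMap
  have hφ : ∀ f, φ f = divEval h ⟨σ, hσ⟩ (polyAct g f) := fun f => rfl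
  clear_value φ
  refine mem_bggSpace h (φ := φ)
    (fun f hf => (hφ f).trans (divEval_coinvIdeal h _ (polyAct_mem_coinvIdeal hg hf))) fun γ => ?_
  have e : polyAct g (polyShift u (γ : Poly n)) = polyShift (g u) (γ : Poly n) := by
    rw [polyAct_polyShift, γ.2 g (reflGroup_mono hΩ hg)]
  rw [hφ, e]
  exact bgg_val h ⟨σ, hσ⟩ (g u) γ

theorem bggSpace_map (h : SimpleSystem Ω) (hΩ : Ω ⊆ Φ) {g : Vec n ≃ₗ[ℂ] Vec n}
    (hg : g ∈ reflGroup Ω) (u : Vec n) : bggSpace Φ Ω (g u) = bggSpace Φ Ω u := by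
  refine le_antisymm (bggSpace_map_le h hΩ hg u) ?_
  have := bggSpace_map_le (Φ := Φ) h hΩ (inv_mem hg) (g u)
  rwa [← LinearEquiv.mul_apply, inv_mul_cancel] at this

/-- The maximal ideal of `Γ` of a point of `V`. -/
def maxIdealAt (Φ : Set (Vec n)) (u : Vec n) : Ideal (invariants Φ) :=
  RingHom.ker ((MvPolynomial.aeval u : Poly n →ₐ[ℂ] ℂ).comp (invariants Φ).val)

theorem maxIdealAt_isMaximal (Φ : Set (Vec n)) (u : Vec n) : (maxIdealAt Φ u).IsMaximal :=
  RingHom.ker_isMaximal_of_surjective _ fun c =>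
    ⟨algebraMap ℂ (invariants Φ) c, AlgHom.commutes _ c⟩

/-! ### Powers of maximal ideals acting on the spaces of operators -/

theorem mem_idealOfVars_of_eval {f : Poly n} (hf : eval 0 f = 0) :
    f ∈ idealOfVars (Fin n) ℂ := by
  rw [← pow_one (idealOfVars (Fin n) ℂ), mem_pow_idealOfVars_iff']
  intro x hx
  have : x = 0 := (Finsupp.degree_eq_zero_iff x).mp (by omega)
  rw [this, ← constantCoeff_eq, ← hf, eval_zero]

theorem divEval_eq_zero_of_mem_pow (h : SimpleSystem Ω) (σ : reflGroup Ω) {k : ℕ} {f : Poly n}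
    (hf : f ∈ idealOfVars (Fin n) ℂ ^ k) (hk : weylLength Ω σ < k) : divEval h σ f = 0 := by
  rw [← sum_homogeneousComponent f, map_sum]
  refine Finset.sum_eq_zero fun i _ => ?_
  by_cases hi : i = weylLength Ω σ
  · have : homogeneousComponent i f = 0 := by
      refine homogeneousComponent_eq_zero' i f fun x hx hd => ?_
      have := (mem_pow_idealOfVars_iff k f).mp hf x hx
      omega
    rw [this, map_zero]
  · exact divEval_of_isHomogeneous h σ (homogeneousComponent_isHomogeneous i f) hi

theorem polyShift_mem_pow {u : Vec n} {k : ℕ} {r : invariants Φ} (hr : r ∈ maxIdealAt Φ u ^ k) :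
    polyShift u (r : Poly n) ∈ idealOfVars (Fin n) ℂ ^ k := by
  have hle : maxIdealAt Φ u ≤ (idealOfVars (Fin n) ℂ).comap
      ((polyShift u : Poly n →ₐ[ℂ] Poly n).comp (invariants Φ).val) := fun r hr => by
    refine mem_idealOfVars_of_eval ?_
    change eval 0 (polyShift u (r : Poly n)) = 0
    rw [eval_polyShift, zero_add]
    exact hr
  have := Ideal.le_comap_pow ((polyShift u : Poly n →ₐ[ℂ] Poly n).comp (invariants Φ).val)
    (K := idealOfVars (Fin n) ℂ) k (Ideal.pow_right_mono hle k hr)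
  exact this

theorem daggerGamma_ofGamma (r γ : invariants Φ) :
    daggerGamma ⟨ofGamma Φ r, ofGamma_mem_rightHartwigOrder r⟩ γ = r * γ :=
  daggerGamma_eq (by rw [daggerOp_ofGamma, ← map_mul]; rfl)

/-- Translation by `u` turns the `k`-th power of the ideal into polynomials vanishing to order `k`
at `0`, while `∂_σ` at `0` sees only degree `ℓ(σ)`. Hence exponent `ℓ(σ) + 1` suffices. -/
theorem exists_pow_dualAct_eq_zero (h : SimpleSystem Ω) {u : Vec n} {ψ : GammaDual Φ}
    (hψ : ψ ∈ bggSpace Φ Ω u) : ∃ k : ℕ, ∀ r ∈ maxIdealAt Φ u ^ k,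
      dualAct ⟨ofGamma Φ r, ofGamma_mem_rightHartwigOrder r⟩ ψ = 0 := by
  refine Submodule.span_induction (p := fun ψ _ => ∃ k : ℕ, ∀ r ∈ maxIdealAt Φ u ^ k,
    dualAct ⟨ofGamma Φ r, ofGamma_mem_rightHartwigOrder r⟩ ψ = 0) ?_ ⟨0, fun _ _ => rfl⟩ ?_ ?_ hψ
  · rintro _ ⟨σ, hσ, rfl⟩
    refine ⟨weylLength Ω σ + 1, fun r hr => GammaDual.ext fun γ => ?_⟩
    rw [dualAct_val, daggerGamma_ofGamma]
    change (bgg Φ Ω σ u).val (r * γ) = 0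
    rw [bgg_val h ⟨σ, hσ⟩]
    change divEval h ⟨σ, hσ⟩ (polyShift u ((r : Poly n) * (γ : Poly n))) = 0
    rw [map_mul]
    exact divEval_eq_zero_of_mem_pow h ⟨σ, hσ⟩
      (Ideal.mul_mem_right _ _ (polyShift_mem_pow hr)) (Nat.lt_succ_self _)
  · rintro x y - - ⟨k, hk⟩ ⟨l, hl⟩
    refine ⟨k + l, fun r hr => ?_⟩
    have h1 := hk r (Ideal.pow_le_pow_right (Nat.le_add_right k l) hr)
    have h2 := hl r (Ideal.pow_le_pow_right (Nat.le_add_left l k) hr)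
    change dualAct _ x + dualAct _ y = 0
    rw [h1, h2, add_zero]
  · rintro c x - ⟨k, hk⟩
    refine ⟨k, fun r hr => ?_⟩
    change c • dualAct _ x = 0
    rw [hk r hr, smul_zero]

end

/-! ### Existence of representatives -/

section

variable {Θ : Set (Vec n)}

theorem SimpleSystem.exists_isStandardReps (h : SimpleSystem Θ) {A : Finset (Vec n)}
    (hA : ∀ g ∈ reflGroup Θ, ∀ z ∈ A, g z ∈ A) : ∃ Y : Finset (Vec n), IsStandardReps Θ A Y := by
  classical
  let r : Setoid (Vec n) :=
    { r := fun z y => ∃ g ∈ reflGroup Θ, g z = y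
      iseqv := ⟨fun z => ⟨1, one_mem _, rfl⟩,
        fun {z y} ⟨g, hg, e⟩ => ⟨g⁻¹, inv_mem hg, by
          rw [← e, ← LinearEquiv.mul_apply, inv_mul_cancel]; rfl⟩,
        fun {x y z} ⟨g, hg, e⟩ ⟨k, hk, e'⟩ => ⟨k * g, mul_mem hk hg, by
          rw [LinearEquiv.mul_apply, e, e']⟩⟩ }
  choose s hs hs' using h.exists_isStandard
  -- The standard vector is chosen from the class of `z`, not from `z` itself, so that it is
  -- constant on orbits.
  let rep : Vec n → Vec n := fun z => s (Quotient.mk r z).out (Quotient.mk r z).out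
  have hrep : ∀ z, ∃ g ∈ reflGroup Θ, g z = rep z := fun z => by
    obtain ⟨g, hg, e⟩ : ∃ g ∈ reflGroup Θ, g z = (Quotient.mk r z).out :=
      r.symm (Quotient.mk_out z)
    exact ⟨s (Quotient.mk r z).out * g, mul_mem (hs _) hg, by rw [LinearEquiv.mul_apply, e]⟩
  have hrep' : ∀ z y, (∃ g ∈ reflGroup Θ, g z = y) → rep z = rep y := fun z y hzy => by
    have : Quotient.mk r z = Quotient.mk r y := Quotient.sound hzy
    simp only [rep, this]
  refine ⟨A.image rep, fun y hy => ?_, fun z hz => ?_⟩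
  · obtain ⟨z, hz, rfl⟩ := Finset.mem_image.mp hy
    refine ⟨?_, hs' _⟩
    obtain ⟨g, hg, e⟩ := hrep z
    exact e ▸ hA g hg z hz
  · refine ⟨rep z, ⟨Finset.mem_image_of_mem _ hz, hrep z⟩, ?_⟩
    rintro y ⟨hy, hzy⟩
    obtain ⟨x, -, rfl⟩ := Finset.mem_image.mp hy
    rw [hrep' z _ hzy, ← hrep' x _ (hrep x)]

theorem SimpleSystem.exists_longest_minReps (h : SimpleSystem Θ) (y : Vec n) :
    ∃ w ∈ reflGroup Θ, IsLongest Θ (minReps Θ y) w := by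
  obtain ⟨w, hw⟩ := h.exists_isLongest (A := minReps Θ y) (fun _ hg => hg.1)
    ⟨1, one_mem _, fun g _ _ => by rw [weylLength_one]; exact Nat.zero_le _⟩
  exact ⟨w, hw.1.1, hw⟩

end

/-! ### The submodule `V(Ω, T(v))` -/

section

variable {Φ S Ω : Set (Vec n)}

theorem rootsAt_map_subset {u : Vec n} (hΦ : IsRootSystem Φ) (hΩ : Ω ⊆ Φ)
    (hu : rootsAt Φ u ⊆ subsystem Ω) {g : Vec n ≃ₗ[ℂ] Vec n} (hg : g ∈ reflGroup Ω) :
    rootsAt Φ (g u) ⊆ subsystem Ω := by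
  intro α hα
  have h1 : g⁻¹ α ∈ rootsAt Φ u := by
    refine ⟨hΦ.map_mem (reflGroup_mono hΩ (inv_mem hg)) _ hα.1, ?_⟩
    rw [map_dotProduct (inv_mem hg), inv_inv]
    exact hα.2
  have := map_mem_subsystem hg (hu h1)
  rwa [← LinearEquiv.mul_apply, mul_inv_cancel] at this

theorem hasRationalDenominator_ofGamma (S : Set (Vec n)) (γ : invariants Φ) :
    HasRationalDenominator Φ S (ofGamma Φ γ) := by
  refine ⟨1, fun z => ?_⟩
  have h1 : signRoots Φ S 1 = ∅ := by
    refine Set.eq_empty_iff_forall_notMem.mpr fun α hα => ?_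
    obtain ⟨-, h, h2⟩ := hα
    have h3 : (1 : ℂ) = -1 := congrArg Units.val h2
    norm_num at h3
  have h2 : relInvariant Φ S 1 = 1 := by
    rw [relInvariant_eq, h1, prodLin, finprod_mem_empty]
  rw [h2, map_one, map_one, mul_one]
  obtain ⟨z, rfl⟩ := Multiplicative.ofAdd.surjective z
  have : ofGamma Φ γ = SkewMonoidAlgebra.single (Multiplicative.ofAdd 0) (emb (γ : Poly n)) := rfl
  rw [this, coeff_single_ofAdd]
  by_cases h : 0 = z
  · rw [if_pos h]
    exact ⟨_, rfl⟩
  · rw [if_neg h]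
    exact zero_mem _

theorem bggSpace_le_bggSum {v z : Vec n} {Z : AddSubmonoid (Vec n)} (hz : z ∈ Z) :
    bggSpace Φ Ω (v + z) ≤ bggSum Φ Ω v Z :=
  le_iSup₂_of_le (f := fun z (_ : z ∈ Z) => bggSpace Φ Ω (v + z)) z hz le_rfl

/-- Replacing `v + z` by a standard `u = g (v + z)` does not change its space of operators. The
explicit formula then lands at points `u + y = g (v + (z + g⁻¹ y))`, and `g⁻¹ y` is again in the
support of `X†`. -/
theorem dualAct_mem_bggSum_of_hasRationalDenominator (hΦ : IsRootSystem Φ)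
    (hG : Finite (reflGroup Φ)) (hS : IsBase Φ S) (hΩ : Ω ⊆ S) (X : rightHartwigOrder Φ)
    (hX : IsInvariantOp Φ X.1) (hd : HasRationalDenominator Φ S X.1) {v : Vec n}
    {Z : AddSubmonoid (Vec n)} (hZ : daggerSupport X.1 ⊆ Z)
    (hvZ : ∀ z ∈ Z, rootsAt Φ (v + z) ⊆ subsystem Ω) {ψ : GammaDual Φ}
    (hψ : ψ ∈ bggSum Φ Ω v Z) : dualAct X ψ ∈ bggSum Φ Ω v Z := by
  have h := hS.simpleSystem hΦ hG hΩ
  have hΩΦ := hΩ.trans hS.subset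
  have := h.finiteGroup
  let T : GammaDual Φ →ₗ[ℂ] GammaDual Φ :=
    { toFun := dualAct X
      map_add' := fun _ _ => rfl
      map_smul' := fun _ _ => rfl }
  suffices hle : bggSum Φ Ω v Z ≤ (bggSum Φ Ω v Z).comap T from hle hψ
  refine iSup₂_le fun z hz => ?_
  obtain ⟨g, hg, hu⟩ := h.exists_isStandard (v + z)
  have huΦ := rootsAt_map_subset hΦ hΩΦ (hvZ z hz) hg
  rw [← bggSpace_map h hΩΦ hg (v + z)]
  set u := g (v + z) with hu_def
  have hΘΩ := rootsAt_subset Ω u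
  have hΘs := h.mono hΘΩ
  have hA : (daggerFinset X.1 : Set (Vec n)) = daggerSupport X.1 :=
    Set.ext fun y => mem_daggerFinset
  obtain ⟨Y, hY⟩ := hΘs.exists_isStandardReps (A := daggerFinset X.1) fun k hk y hy =>
    mem_daggerFinset.mpr (hX.map_mem_daggerSupport (reflGroup_mono (hΘΩ.trans hΩΦ) hk)
      (mem_daggerFinset.mp hy))
  rw [hA] at hY
  choose w hw hw' using hΘs.exists_longest_minReps
  refine Submodule.span_le.mpr ?_
  rintro _ ⟨σ, hσ, rfl⟩
  change dualAct X (bgg Φ Ω σ u) ∈ bggSum Φ Ω v Z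
  rw [dualAct_bgg hΦ hG hS hΩ X hX hd hu huΦ hY
    (w := fun y => ⟨w y, reflGroup_mono hΘΩ (hw y)⟩) (fun y _ => hw' y) ⟨σ, hσ⟩]
  refine sum_mem fun y hy => ?_
  have := Fintype.ofFinite (reflGroup Ω)
  rw [finsum_eq_sum_of_fintype]
  refine sum_mem fun ν _ => Submodule.smul_mem _ _ ?_
  have e : u + y = g (v + (z + g⁻¹ y)) := by
    rw [← add_assoc, map_add, ← hu_def, ← LinearEquiv.mul_apply, mul_inv_cancel]
    rfl
  have hmem : z + g⁻¹ y ∈ Z := add_mem hz (hZ (hX.map_mem_daggerSupport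
    (reflGroup_mono hΩΦ (inv_mem hg)) (hY.1 y (Finset.mem_filter.mp hy).1).1))
  refine bggSpace_le_bggSum hmem ?_
  rw [← bggSpace_map h hΩΦ hg, ← e]
  exact Submodule.subset_span ⟨ν, ν.2, rfl⟩

theorem dualAct_of_algebraMap {X : rightHartwigOrder Φ} {c : ℂ}
    (h : X.1 = algebraMap ℂ (Smash n) c) (ψ : GammaDual Φ) : dualAct X ψ = c • ψ := by
  refine GammaDual.ext fun γ => ?_
  have h1 : X = ⟨ofGamma Φ (algebraMap ℂ (invariants Φ) c), ofGamma_mem_rightHartwigOrder _⟩ :=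
    Subtype.ext (h.trans (AlgHom.commutes (ofGamma Φ) c).symm)
  rw [dualAct_val, h1, daggerGamma_ofGamma, ← Algebra.smul_def, map_smul]
  rfl

theorem dualAct_of_add {X Y Z : rightHartwigOrder Φ} (h : Z.1 = X.1 + Y.1) (ψ : GammaDual Φ) :
    dualAct Z ψ = dualAct X ψ + dualAct Y ψ := by
  obtain rfl : Z = X + Y := Subtype.ext h
  exact (dualModule Φ).add_smul X Y ψ

theorem dualAct_of_mul {X Y Z : rightHartwigOrder Φ} (h : Z.1 = X.1 * Y.1) (ψ : GammaDual Φ) :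
    dualAct Z ψ = dualAct X (dualAct Y ψ) := by
  obtain rfl : Z = X * Y := Subtype.ext h
  exact (dualModule Φ).mul_smul X Y ψ

/-- The explicit formula needs a rational denominator, which the generators have but sums and
products need not; the rest of `U` is reached by induction over the generated algebra. -/
theorem IsCorationalGaloisOrder.dualAct_mem_bggSum (hΦ : IsRootSystem Φ)
    (hG : Finite (reflGroup Φ)) (hS : IsBase Φ S) (hΩ : Ω ⊆ S) {U : Subalgebra ℂ (Smash n)}
    (hU : IsCorationalGaloisOrder Φ S U) {v : Vec n}
    (hvZ : ∀ z ∈ shiftMonoid U, rootsAt Φ (v + z) ⊆ subsystem Ω) (X : rightHartwigOrder Φ)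
    (hX : X.1 ∈ U) {ψ : GammaDual Φ} (hψ : ψ ∈ bggSum Φ Ω v (shiftMonoid U)) :
    dualAct X ψ ∈ bggSum Φ Ω v (shiftMonoid U) := by
  have hle := hU.le_rightHartwigOrder hΦ hS
  have hinv : ∀ X ∈ U, IsInvariantOp Φ X := fun X hX => hU.isInvariantOp hX
  have hsupp : ∀ X ∈ U, daggerSupport X ⊆ shiftMonoid U := fun X hX y hy =>
    AddSubmonoid.subset_closure (Set.mem_iUnion₂.mpr ⟨X, hX, hy⟩)
  -- The monoid must stay that of all of `U` while the induction runs through elements of `U`; only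
  -- the inclusion of their supports is retained.
  generalize shiftMonoid U = Z at hψ hvZ hsupp ⊢
  have hgen : ∀ X (hX : X ∈ U), HasRationalDenominator Φ S X → ∀ ψ ∈ bggSum Φ Ω v Z,
      dualAct ⟨X, hle hX⟩ ψ ∈ bggSum Φ Ω v Z := fun X hX hd ψ hψ =>
    dualAct_mem_bggSum_of_hasRationalDenominator hΦ hG hS hΩ ⟨X, hle hX⟩ (hinv X hX) hd
      (hsupp X hX) hvZ hψ
  obtain ⟨𝒳, -, h𝒳, rfl⟩ := hU
  obtain ⟨X, hXH⟩ := X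
  suffices H : ∀ X (hX : X ∈ Algebra.adjoin ℂ (Set.range (ofGamma Φ) ∪ 𝒳)),
      ∀ ψ ∈ bggSum Φ Ω v Z, dualAct ⟨X, hle hX⟩ ψ ∈ bggSum Φ Ω v Z from H X hX ψ hψ
  clear hψ ψ hX hXH X
  intro X hX
  induction hX using Algebra.adjoin_induction with
  | mem X hX =>
    refine hgen X (Algebra.subset_adjoin hX) ?_
    rcases hX with ⟨γ, rfl⟩ | hX
    · exact hasRationalDenominator_ofGamma S γ
    · exact (h𝒳 X hX).2
  | algebraMap c =>
    intro ψ hψ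
    rw [dualAct_of_algebraMap (c := c) rfl]
    exact Submodule.smul_mem _ _ hψ
  | add X Y hX hY ihX ihY =>
    intro ψ hψ
    rw [dualAct_of_add (X := ⟨X, hle hX⟩) (Y := ⟨Y, hle hY⟩) rfl]
    exact add_mem (ihX ψ hψ) (ihY ψ hψ)
  | mul X Y hX hY ihX ihY =>
    intro ψ hψ
    rw [dualAct_of_mul (X := ⟨X, hle hX⟩) (Y := ⟨Y, hle hY⟩) rfl]
    exact ihX _ (ihY ψ hψ)

/-- The `U`-submodule `V(Ω, T(v))` of `Γ*`. -/
def bggModule (hΦ : IsRootSystem Φ) (hG : Finite (reflGroup Φ)) (hS : IsBase Φ S) (hΩ : Ω ⊆ S)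
    {U : Subalgebra ℂ (Smash n)} (hU : IsCorationalGaloisOrder Φ S U) {v : Vec n}
    (hvZ : ∀ z ∈ shiftMonoid U, rootsAt Φ (v + z) ⊆ subsystem Ω)
    (hH : U ≤ rightHartwigOrder Φ) :
    letI : Module U (GammaDual Φ) := dualModuleOf hH
    Submodule U (GammaDual Φ) :=
  letI : Module U (GammaDual Φ) := dualModuleOf hH
  { carrier := bggSum Φ Ω v (shiftMonoid U)
    add_mem' := fun h1 h2 => add_mem h1 h2
    zero_mem' := zero_mem _
    smul_mem' := fun X _ hψ => hU.dualAct_mem_bggSum hΦ hG hS hΩ hvZ ⟨X.1, hH X.2⟩ X.2 hψ }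

theorem bggModule_isGelfandTsetlin (hΦ : IsRootSystem Φ) (hG : Finite (reflGroup Φ))
    (hS : IsBase Φ S) (hΩ : Ω ⊆ S) {U : Subalgebra ℂ (Smash n)}
    (hU : IsCorationalGaloisOrder Φ S U) {v : Vec n}
    (hvZ : ∀ z ∈ shiftMonoid U, rootsAt Φ (v + z) ⊆ subsystem Ω)
    (hH : U ≤ rightHartwigOrder Φ) :
    letI : Module U (GammaDual Φ) := dualModuleOf hH
    IsGelfandTsetlin (gammaHom hU).toRingHom (bggModule hΦ hG hS hΩ hU hvZ hH) := by
  let : Module U (GammaDual Φ) := dualModuleOf hH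
  have h := hS.simpleSystem hΦ hG hΩ
  refine isGelfandTsetlin_of_iSup (R := invariants Φ) (A := U) (M := GammaDual Φ)
    (j := (gammaHom hU).toRingHom) (k := ℂ)
    (B := fun z : shiftMonoid U => bggSpace Φ Ω (v + z)) ?_ fun z ψ hψ => ?_
  · rw [iSup_subtype]
    rfl
  · exact ⟨⟨maxIdealAt Φ (v + z), maxIdealAt_isMaximal Φ (v + z)⟩,
      exists_pow_dualAct_eq_zero h hψ⟩

end

end GaloisBGG

end

/-! ### The theorem -/

open GaloisBGG in
theorem theoremT (n : ℕ) (Φ S Ω : Set (Vec n)) (hΦ : IsRootSystem Φ)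
    (hG : Finite (reflGroup Φ)) (hS : IsBase Φ S) (hΩ : Ω ⊆ S)
    (U : Subalgebra ℂ (Smash n)) (hU : IsCorationalGaloisOrder Φ S U)
    (v : Vec n) (hv : IsStandard Ω v)
    (hvZ : ∀ z ∈ shiftMonoid U, rootsAt Φ (v + z) ⊆ subsystem Ω) :
    ∃ hH : U ≤ rightHartwigOrder Φ,
      letI : Module U (GammaDual Φ) := dualModuleOf hH
      (∃ M : Submodule U (GammaDual Φ),
        (M : Set (GammaDual Φ)) = bggSum Φ Ω v (shiftMonoid U) ∧
        IsGelfandTsetlin (gammaHom hU).toRingHom M) ∧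
      ∀ X : U, HasRationalDenominator Φ S X.1 →
      ∀ z ∈ shiftMonoid U, ∀ g ∈ reflGroup Ω, ∀ v' : Vec n, v' = g (v + z) → IsStandard Ω v' →
      ∀ Y : Finset (Vec n), IsStandardReps (rootsAt Ω v') (daggerSupport X.1) Y →
      ∀ w : Vec n → reflGroup Ω,
        (∀ y ∈ Y, IsLongest (rootsAt Ω v') (minReps (rootsAt Ω v') y) (w y)) →
        (∀ y ∈ Y, IsRegularAt v' (formulaCoeff (rootsAt Ω v') X.1 y)) ∧
        ∀ σ : reflGroup Ω,
          X • bgg Φ Ω σ v' =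
            ∑ y ∈ Y with weylLength Ω (σ * w y) = weylLength Ω σ + weylLength Ω (w y),
              ∑ᶠ ν : reflGroup Ω,
                psValue₂ Ω ν (σ * w y) v' (formulaCoeff (rootsAt Ω v') X.1 y) •
                  bgg Φ Ω ν (v' + y) := by
  refine ⟨hU.le_rightHartwigOrder hΦ hS, ⟨bggModule hΦ hG hS hΩ hU hvZ _, rfl,
    bggModule_isGelfandTsetlin hΦ hG hS hΩ hU hvZ _⟩, ?_⟩
  intro X hd z hz g hg v' hv' hstd Y hY w hw
  have hvΦ : rootsAt Φ v' ⊆ subsystem Ω :=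
    hv' ▸ rootsAt_map_subset hΦ (hΩ.trans hS.subset) (hvZ z hz) hg
  have hX := hU.isInvariantOp X.2
  exact ⟨fun y _ => isRegularAt_formulaCoeff hΦ hG hS hΩ hX hd hstd hvΦ y,
    fun σ => dualAct_bgg hΦ hG hS hΩ ⟨X.1, _⟩ hX hd hstd hvΦ hY hw σ⟩
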